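/- Let $\pi\colon E\to M$ be a smooth vector bundle over a smooth $n$-dimensional manifold, $\mathcal E\subset J^k(\pi)$ a formally integrable differential equation, $\mathcal E^\infty\subset J^\infty(\pi)$ its infinite prolongation, $\pi_{\mathcal E}\colon\mathcal E^\infty\to M$ the projection and $\mathcal C_{\mathcal E}$ the Cartan connection. Let $\tau\colon W\to\mathcal E^\infty$ be a covering, i.e. a smooth fibre bundle, whose total space $W$ is a smooth manifold of finite dimension or the inverse limit of a sequence of surjective submersions of such manifolds, together with a flat connection $\mathcal C_\tau\colon D(M)\to D(W)$ in $\pi_{\mathcal E}\circ\tau$ with $\tau_*\circ\mathcal C_\tau=\mathcal C_{\mathcal E}$. Let $U_\tau\in D(\Lambda^1(W))$ be its connection form, where $D(\Lambda^i(W))$ denotes the derivations $C^\infty(W)\to\Lambda^i(W)$, and let $\partial_\tau=[\![U_\tau,\cdot\,]\!]$ be the differential given by the Frölicher–Nijenhuis bracket. Put $$D^v(\Lambda^i(W))=\{\Omega\in D(\Lambda^i(W)) : \Omega|_{C^\infty(M)}=0\},\qquad D^g(\Lambda^i(W))=\{\Omega\in D(\Lambda^i(W)) : \Omega|_{C^\infty(\mathcal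 E^\infty)}=0\},$$ and let $H_g^i(\mathcal E;\tau)$ and $H_s^i(\mathcal E;\tau)$ be the cohomology of the complexes $D^g(\Lambda^\bullet(W))$ and $D^s(\Lambda^\bullet(W))=D^v(\Lambda^\bullet(W))/D^g(\Lambda^\bullet(W))$ with the differentials induced by $\partial_\tau$. (The Cartan connection $\mathcal C_{\mathcal E}$ and the form $U_\tau$ exist and are unique.) Then: 1. $H_g^0(\mathcal E;\tau)$ is the set of gauge symmetries of $\tau$, i.e. of the nonlocal $\tau$-symmetries (the $\pi_{\mathcal E}\circ\tau$-vertical vector fields $X$ on $W$ such that $[X,\cdot\,]$ preserves the horizontal distribution of $\mathcal C_\tau$) that are $\tau$-vertical. 2. $H_s^0(\mathcal E;\tau)$ coincides with the set of $\tau$-shadows, i.e. of the smooth maps $s\colon W\to T^v\pi_{\mathcal E}$ into the bundle of $\pi_{\mathcal E}$-vertical tangent vectors which lie over $\tau$ and whose differential takes the horizontal distribution on $W$ to the Cartan distribution on $T^v\pi_{\mathcal E}$: the map $[X]\mapsto(w\mapsto\tau_*X_w)$ is a well-defined bijection. 3. $H_g^1(\mathcal E;\tau)$ is the set of equivalence classes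 of infinitesimal deformations of the covering structure $U_\tau$ acting trivially on the equation structure. Here an infinitesimal deformation is $U_t=U_\tau+t\Omega$ with $\Omega\in D(\Lambda^1(W))$, $[\![U_t,U_t]\!]=O(t^2)$, and $U_t=U_\tau$ on $C^\infty(\mathcal E^\infty)$. Two of them, $U_t$ and $U_t'$, are equivalent if for some $\tau$-vertical vector field $X$ on $W$ one has $U_t(f)+tL_X(U_t(f))=U'_t(f+tX(f))+O(t^2)$ for all $f\in C^\infty(W)$, i.e. if a first-order family of transformations of $W$ over $\mathcal E^\infty$ takes $U_t$ to $U_t'$. This is an equivalence relation, every such $\Omega$ is a cocycle, and the class of $U_\tau+t\Omega$ corresponds bijectively to the class of $\Omega$ in $H^1_g(\mathcal E;\tau)$. -/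

import Mathlib

open scoped Manifold ContDiff

universe u v w t

noncomputable section

/-! ### Differential spaces

A set with an algebra of "smooth" real functions that is closed under composition with smooth
functions of several variables and is local for the topology generated by the sets `{h ≠ 0}`.
Finite dimensional manifolds, jet spaces, infinite prolongations and total spaces of coverings are
all differential spaces, and smooth maps between them are the maps that pull smooth functions back
to smooth functions. On a space of infinite jets the smooth functions are those which locally depend
smoothly on a jet of some finite order. -/

structure DSpace where
  carrier : Type u
  IsSmooth : (carrier → ℝ) → Prop
  comp_smooth : ∀ (n : ℕ) (g : (Fin n → ℝ) → ℝ), ContDiff ℝ ∞ g →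
    ∀ f : Fin n → carrier → ℝ, (∀ i, IsSmooth (f i)) → IsSmooth (fun x => g (fun i => f i x))
  local_smooth : ∀ f : carrier → ℝ,
    (∀ x, ∃ h, IsSmooth h ∧ h x ≠ 0 ∧ ∃ g, IsSmooth g ∧ ∀ y, h y ≠ 0 → f y = g y) → IsSmooth f

namespace DSpace

instance : CoeSort DSpace.{u} (Type u) := ⟨DSpace.carrier⟩

/-- The algebra of smooth functions as a subalgebra of all real functions. -/
def smooth (X : DSpace.{u}) : Subalgebra ℝ (X → ℝ) where
  carrier := {f | X.IsSmooth f}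
  add_mem' {a b} ha hb := by
    have := X.comp_smooth 2 (fun v => v 0 + v 1) (by fun_prop) ![a, b]
      (by intro i; fin_cases i <;> simpa)
    exact this
  mul_mem' {a b} ha hb := by
    have := X.comp_smooth 2 (fun v => v 0 * v 1) (by fun_prop) ![a, b]
      (by intro i; fin_cases i <;> simpa)
    exact this
  algebraMap_mem' r := X.comp_smooth 0 (fun _ => r) contDiff_const (fun i => i.elim0)
    (fun i => i.elim0)

/-- `C^∞(X)`. -/
def Fn (X : DSpace.{u}) : Type u := X.smooth

instance (X : DSpace.{u}) : CommRing X.Fn := inferInstanceAs (CommRing X.smooth)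

instance (X : DSpace.{u}) : Algebra ℝ X.Fn := inferInstanceAs (Algebra ℝ X.smooth)

/-- `D(X)`, the vector fields on `X`: derivations of `C^∞(X)`. -/
abbrev Field (X : DSpace.{u}) : Type u := Derivation ℝ X.Fn X.Fn

instance (X : DSpace.{u}) : AddCommGroup X.Field := inferInstance

instance (X : DSpace.{u}) : Module ℝ X.Field := inferInstance

/-- The functions generated by a set `S` of functions: the smallest class which contains `S`, is
closed under composition with smooth functions and is local. -/
inductive Gen {X : Type u} (S : Set (X → ℝ)) : (X → ℝ) → Prop
  | base (f : X → ℝ) : f ∈ S → Gen S f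
  | comp (n : ℕ) (g : (Fin n → ℝ) → ℝ) (hg : ContDiff ℝ ∞ g) (f : Fin n → X → ℝ)
      (hf : ∀ i, Gen S (f i)) : Gen S (fun x => g (fun i => f i x))
  | glue (f : X → ℝ) (h g : X → X → ℝ) (hh : ∀ x, Gen S (h x)) (hx : ∀ x, h x x ≠ 0)
      (hg : ∀ x, Gen S (g x)) (hf : ∀ x y, h x y ≠ 0 → f y = g x y) : Gen S f

/-- The differential space generated by a set of functions. -/
def generate {X : Type u} (S : Set (X → ℝ)) : DSpace.{u} where
  carrier := X
  IsSmooth := Gen S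
  comp_smooth n g hg f hf := Gen.comp n g hg f hf
  local_smooth f hf := by
    choose h hh hx g hg hfg using hf
    exact Gen.glue f h g hh hx hg hfg

/-- The subset `A` of `X` with the induced structure. -/
def sub (X : DSpace.{u}) (A : Set X) : DSpace.{u} :=
  generate (X := A) {f | ∃ g : X → ℝ, X.IsSmooth g ∧ f = fun a => g a.1}

/-- The product of two differential spaces. -/
def prod (X : DSpace.{u}) (Y : DSpace.{v}) : DSpace.{max u v} :=
  generate (X := X × Y) ({f | ∃ g : X → ℝ, X.IsSmooth g ∧ f = fun a => g a.1} ∪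
    {f | ∃ g : Y → ℝ, Y.IsSmooth g ∧ f = fun a => g a.2})

/-- A (finite dimensional, Mathlib) manifold with its `C^∞` functions. -/
def ofManifold (n : ℕ) (M : Type u) [TopologicalSpace M] [ChartedSpace (EuclideanSpace ℝ (Fin n)) M] :
    DSpace.{u} where
  carrier := M
  IsSmooth f := ContMDiff (𝓡 n) 𝓘(ℝ, ℝ) ∞ f
  comp_smooth k g hg f hf :=
    hg.contMDiff.comp (contMDiff_pi_space.2 hf)
  local_smooth f hf := by
    intro x
    obtain ⟨h, hh, hx, g, hg, hfg⟩ := hf x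
    refine (hg x).congr_of_eventuallyEq ?_
    filter_upwards [hh.continuous.continuousAt.eventually_ne hx] with y hy using hfg y hy

/-- `ℝ^d`. -/
def euclidean (d : ℕ) : DSpace.{0} := ofManifold d (EuclideanSpace ℝ (Fin d))

end DSpace

/-- Smooth maps. -/
@[ext]
structure SMap (X : DSpace.{u}) (Y : DSpace.{v}) where
  toFun : X → Y
  smooth_comp : ∀ f : Y → ℝ, Y.IsSmooth f → X.IsSmooth (fun x => f (toFun x))

namespace SMap

instance (X : DSpace.{u}) (Y : DSpace.{v}) : CoeFun (SMap X Y) (fun _ => X → Y) := ⟨SMap.toFun⟩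

variable {X : DSpace.{u}} {Y : DSpace.{v}} {Z : DSpace.{w}}

def comp (p : SMap Y Z) (q : SMap X Y) : SMap X Z where
  toFun x := p (q x)
  smooth_comp f hf := q.smooth_comp _ (p.smooth_comp f hf)

/-- The pullback of functions. -/
def pullback (p : SMap X Y) : Y.Fn →ₐ[ℝ] X.Fn where
  toFun f := ⟨fun x => f.1 (p x), p.smooth_comp f.1 f.2⟩
  map_one' := rfl
  map_mul' _ _ := rfl
  map_zero' := rfl
  map_add' _ _ := rfl
  commutes' _ := rfl

/-- A map into a generated space is smooth once it pulls the generators back to smooth functions. -/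
def ofGenerate {Y' : Type v} {S : Set (Y' → ℝ)} (p : X → Y') (hp : ∀ f ∈ S, X.IsSmooth (fun x => f (p x))) :
    SMap X (DSpace.generate S) where
  toFun := p
  smooth_comp f hf := by
    induction hf with
    | base f hf => exact hp f hf
    | comp n g hg f _ ih => exact X.comp_smooth n g hg _ ih
    | glue f h g _ hx _ hf ihh ihg =>
      exact X.local_smooth _ fun x => ⟨_, ihh (p x), hx (p x), _, ihg (p x),
        fun y hy => hf (p x) (p y) hy⟩

/-- The inclusion of a subset. -/
def incl (X : DSpace.{u}) (A : Set X) : SMap (X.sub A) X where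
  toFun a := a.1
  smooth_comp f hf := DSpace.Gen.base _ ⟨f, hf, rfl⟩

/-- `p` is a smooth fibre bundle: it is surjective and, over a neighbourhood `{h ≠ 0}` of each point
`b`, diffeomorphic over the base to the product of that neighbourhood and the fibre over `b`. -/
def IsBundle (p : SMap X Y) : Prop :=
  Function.Surjective p ∧
  ∀ b : Y, ∃ h : Y.Fn, h.1 b ≠ 0 ∧
    ∃ (Φ : SMap (X.sub {x | h.1 (p x) ≠ 0}) ((Y.sub {y | h.1 y ≠ 0}).prod (X.sub {x | p x = b})))
      (Ψ : SMap ((Y.sub {y | h.1 y ≠ 0}).prod (X.sub {x | p x = b})) (X.sub {x | h.1 (p x) ≠ 0})),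
      Function.LeftInverse Ψ Φ ∧ Function.RightInverse Ψ Φ ∧ ∀ x, (Φ x).1.1 = p x.1

/-- `p` is a surjective submersion: each point lies on a smooth local section. -/
def IsSubmersion (p : SMap X Y) : Prop :=
  Function.Surjective p ∧
  ∀ x : X, ∃ h : Y.Fn, ∃ hx : h.1 (p x) ≠ 0, ∃ σ : SMap (Y.sub {y | h.1 y ≠ 0}) X,
    (∀ y, p (σ y) = y.1) ∧ σ ⟨p x, hx⟩ = x

end SMap

namespace DSpace

/-- Finite dimensional smooth manifolds: separated, second countable, and locally diffeomorphic to
open subsets of `ℝ^d`. -/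
def IsSmoothManifold (X : DSpace.{u}) : Prop :=
  (∀ x y : X, x ≠ y → ∃ f : X.Fn, f.1 x ≠ f.1 y) ∧
  @SecondCountableTopology X
    (TopologicalSpace.generateFrom {O : Set X | ∃ h : X.Fn, O = {x | h.1 x ≠ 0}}) ∧
  ∀ x : X, ∃ h : X.Fn, h.1 x ≠ 0 ∧ ∃ (d : ℕ) (V : Set (EuclideanSpace ℝ (Fin d))), IsOpen V ∧
    ∃ (Φ : SMap (X.sub {x | h.1 x ≠ 0}) ((euclidean d).sub V))
      (Ψ : SMap ((euclidean d).sub V) (X.sub {x | h.1 x ≠ 0})),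
      Function.LeftInverse Ψ Φ ∧ Function.RightInverse Ψ Φ

/-- Smooth manifolds of finite or infinite dimension: inverse limits of sequences of surjective
submersions of finite dimensional smooth manifolds. -/
def IsProManifold (X : DSpace.{u}) : Prop :=
  ∃ (N : ℕ → DSpace.{u}) (q : ∀ s, SMap (N (s + 1)) (N s)) (p : ∀ s, SMap X (N s)),
    (∀ s, (N s).IsSmoothManifold) ∧ (∀ s, (q s).IsSubmersion) ∧
    (∀ s x, q s (p (s + 1) x) = p s x) ∧
    (∀ a : ∀ s, N s, (∀ s, q s (a (s + 1)) = a s) → ∃! x, ∀ s, p s x = a s) ∧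
    ∀ f : X → ℝ, X.IsSmooth f ↔
      Gen {f | ∃ (s : ℕ) (g : N s → ℝ), (N s).IsSmooth g ∧ f = fun x => g (p s x)} f

variable (X : DSpace.{u})

/-! ### Forms, form-valued derivations and the Frölicher–Nijenhuis bracket -/

/-- Alternating functions of `i` vector fields. -/
abbrev Alt (i : ℕ) : Type u := X.Field [⋀^Fin i]→ₗ[ℝ] X.Fn

instance (i : ℕ) : AddCommGroup (X.Alt i) := inferInstance

instance (i : ℕ) : Module ℝ (X.Alt i) := inferInstance

instance (i : ℕ) : Module X.Fn (X.Alt i) := inferInstance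

/-- `Λ^i(X)`, the differential `i`-forms: locally finite sums of `f dg₁ ∧ … ∧ dgᵢ`. -/
def Form (i : ℕ) : Submodule X.Fn (X.Alt i) where
  carrier := {ρ | ∀ x : X, ∃ h : X.Fn, h.1 x ≠ 0 ∧ ∃ (ι : Type) (_ : Fintype ι)
    (f : ι → X.Fn) (g : ι → Fin i → X.Fn), ∀ y : X, h.1 y ≠ 0 → ∀ V : Fin i → X.Field,
      (ρ V).1 y = ∑ a, (f a).1 y * (Matrix.of fun k l => (V k (g a l)).1 y).det}
  zero_mem' := fun x => ⟨1, one_ne_zero, PEmpty, inferInstance, PEmpty.elim, PEmpty.elim,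
    fun y _ V => by
      rw [Fintype.sum_empty]; rfl⟩
  add_mem' := by
    intro ρ η hρ hη x
    obtain ⟨h, hx, ι, _, f, g, H⟩ := hρ x
    obtain ⟨h', hx', ι', _, f', g', H'⟩ := hη x
    refine ⟨h * h', mul_ne_zero hx hx', ι ⊕ ι', inferInstance, Sum.elim f f', Sum.elim g g', ?_⟩
    intro y hy V
    have hy' : h.1 y * h'.1 y ≠ 0 := hy
    rw [Fintype.sum_sum_type]
    simp only [Sum.elim_inl, Sum.elim_inr]
    rw [← H y (left_ne_zero_of_mul hy') V, ← H' y (right_ne_zero_of_mul hy') V]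
    rfl
  smul_mem' := by
    intro c ρ hρ x
    obtain ⟨h, hx, ι, _, f, g, H⟩ := hρ x
    refine ⟨h, hx, ι, inferInstance, fun a => c * f a, g, ?_⟩
    intro y hy V
    have e : ((c • ρ) V).1 y = c.1 y * (ρ V).1 y := rfl
    rw [e, H y hy V, Finset.mul_sum]
    refine Finset.sum_congr rfl fun a _ => ?_
    have e' : (c * f a).1 y = c.1 y * (f a).1 y := rfl
    rw [e', mul_assoc]

instance (i : ℕ) : IsScalarTower ℝ X.Fn (X.Alt i) :=
  ⟨fun a b c => by ext V : 1; exact smul_assoc a b (c V)⟩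

instance (i : ℕ) : Module ℝ (X.Form i) := Submodule.module' (S := ℝ) (X.Form i)

/-- `D(Λ^i(X))`, the derivations `C^∞(X) → Λ^i(X)`. -/
abbrev VForm (i : ℕ) : Type u := Derivation ℝ X.Fn (X.Form i)

instance (i : ℕ) : AddCommGroup (X.VForm i) := inferInstance

instance (i : ℕ) : Module ℝ (X.VForm i) := inferInstance

variable {X}

/-- `∑ₖ (-1)^k Vₖ(ρ(…, V̂ₖ, …))`. -/
def extDLead (m : ℕ) : X.Alt m →ₗ[ℝ] X.Alt (m + 1) :=
  AlternatingMap.alternatizeUncurryFinLM ∘ₗ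
    LinearMap.mk₂ ℝ (fun (ρ : X.Alt m) (V : X.Field) => (V : X.Fn →ₗ[ℝ] X.Fn).compAlternatingMap ρ)
      (fun _ _ _ => by ext; simp) (fun _ _ _ => by ext; simp)
      (fun _ _ _ => by ext; simp) (fun _ _ _ => by ext; simp)

/-- `∑_{k ≠ l} ± ρ([Vₖ, Vₗ], …)`, the antisymmetrization of `ρ([V₀, V₁], V₂, …)` in two steps: each
unordered pair `{k, l}` occurs twice, so this is `-2 ∑_{k<l} (-1)^(k+l) ρ([Vₖ, Vₗ], …)`. -/
def extDBracket (m : ℕ) : X.Alt (m + 1) →ₗ[ℝ] X.Alt (m + 2) :=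
  AlternatingMap.alternatizeUncurryFinLM ∘ₗ
    LinearMap.mk₂ ℝ (fun (ρ : X.Alt (m + 1)) (V : X.Field) =>
        AlternatingMap.alternatizeUncurryFin (ρ.curryLeft ∘ₗ (LieModule.toEnd ℝ X.Field X.Field V)))
      (fun _ _ _ => by rw [← AlternatingMap.alternatizeUncurryFin_add]; rfl)
      (fun _ _ _ => by rw [← AlternatingMap.alternatizeUncurryFin_smul]; rfl)
      (fun _ _ _ => by
        rw [← AlternatingMap.alternatizeUncurryFin_add, ← LinearMap.comp_add, map_add])
      (fun _ _ _ => by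
        rw [← AlternatingMap.alternatizeUncurryFin_smul, ← LinearMap.comp_smul, map_smul])

/-- The exterior differential,
`dρ(V₀, …, V_m) = ∑ₖ (-1)^k Vₖ(ρ(…, V̂ₖ, …)) + ∑_{k<l} (-1)^(k+l) ρ([Vₖ, Vₗ], …, V̂ₖ, …, V̂ₗ, …)`. -/
def extD : ∀ m : ℕ, X.Alt m →ₗ[ℝ] X.Alt (m + 1)
  | 0 => extDLead 0
  | m + 1 => extDLead (m + 1) - (1 / 2 : ℝ) • extDBracket m

/-- A derivation `Ω` with values in `i`-forms as a vector-field-valued form: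
`Ω(V₁, …, Vᵢ)(f) = Ω(f)(V₁, …, Vᵢ)`. -/
def VForm.toAlt (i : ℕ) : X.VForm i →ₗ[ℝ] X.Field [⋀^Fin i]→ₗ[ℝ] X.Field where
  toFun Ω :=
    { toFun := fun V => Derivation.mk'
        { toFun := fun f => (Ω f).1 V
          map_add' := fun _ _ => by simp
          map_smul' := fun _ _ => by simp }
        (fun a b => by simp)
      map_update_add' := fun V k x y => by ext f : 1; simp
      map_update_smul' := fun V k c x => by ext f : 1; simp
      map_eq_zero_of_eq' := fun V k l h hkl => by
        ext f : 1; simpa using (Ω f).1.map_eq_zero_of_eq V h hkl }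
  map_add' _ _ := by ext; simp
  map_smul' _ _ := by ext; simp

/-- The inner product `i_Ω ρ`, where `Ω` has degree `i` and `ρ` has degree `m + 1`: the
antisymmetrization, over the `(i, m)`-shuffles, of `ρ(Ω(V₁, …, Vᵢ), Vᵢ₊₁, …, Vᵢ₊ₘ)`.
(On functions `i_Ω` is zero.) -/
def innerProd (i m : ℕ) : X.VForm i →ₗ[ℝ] X.Alt (m + 1) →ₗ[ℝ] X.Alt (i + m) :=
  LinearMap.mk₂ ℝ (fun Ω ρ => (1 / (i.factorial * m.factorial) : ℝ) •
      MultilinearMap.alternatization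
        ((MultilinearMap.uncurrySum (ι := Fin i) (ι' := Fin m) (N := fun _ => X.Field)
          (((AlternatingMap.toMultilinearMapLM (S := ℝ)) ∘ₗ ρ.curryLeft).compMultilinearMap
            (VForm.toAlt i Ω).toMultilinearMap)).domDomCongr finSumFinEquiv))
    (fun _ _ _ => by
      rw [← smul_add, ← map_add]; congr 2; ext; simp; rfl)
    (fun c _ _ => by
      rw [smul_comm c]; congr 1; ext
      simp [MultilinearMap.alternatization_apply, Finset.smul_sum, smul_comm c])
    (fun _ _ _ => by
      rw [← smul_add, ← map_add]; congr 2)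
    (fun c _ _ => by
      rw [smul_comm c]; congr 1; ext
      simp [MultilinearMap.alternatization_apply, Finset.smul_sum, smul_comm c])

/-- The Lie derivative `L_Ω = i_Ω d - (-1)^(i-1) d i_Ω` along `Ω ∈ D(Λ^i(X))`. -/
def lieD (i : ℕ) : ∀ j : ℕ, X.VForm i →ₗ[ℝ] X.Alt j →ₗ[ℝ] X.Alt (i + j)
  | 0 => (innerProd i 0).compl₂ (extD (X := X) 0)
  | m + 1 => (innerProd i (m + 1)).compl₂ (extD (X := X) (m + 1)) -
      ((-1) ^ (i + 1) : ℝ) • ((innerProd i m).compr₂ (extD (X := X) (i + m)) :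
        X.VForm i →ₗ[ℝ] X.Alt (m + 1) →ₗ[ℝ] X.Alt (i + (m + 1)))

/-- The Frölicher–Nijenhuis bracket `[[Ω, Θ]](f) = L_Ω(Θ(f)) - (-1)^(ij) L_Θ(Ω(f))`. -/
def fnBracket (i j : ℕ) (Ω : X.VForm i) :
    X.VForm j →ₗ[ℝ] X.Fn →ₗ[ℝ] X.Alt (i + j) where
  toFun Θ :=
    { toFun := fun f => lieD i j Ω (Θ f).1 - ((-1) ^ (i * j) : ℝ) •
        (lieD j i Θ (Ω f).1).domDomCongr (finCongr (add_comm j i))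
      map_add' := fun _ _ => by ext; simp; ring
      map_smul' := fun c _ => by
        ext V : 1; simp [smul_sub, smul_comm c] }
  map_add' _ _ := by ext; simp; ring
  map_smul' c _ := by ext f V : 2; simp [smul_sub, smul_comm c]

/-- `∂_U = [[U, ·]] : D(Λ^i(X)) → D(Λ^(i+1)(X))` for `U ∈ D(Λ^1(X))`. -/
def delta (U : X.VForm 1) (i : ℕ) : X.VForm i →ₗ[ℝ] X.Fn →ₗ[ℝ] X.Alt (i + 1) :=
  (LinearMap.compRight ℝ
    (AlternatingMap.domDomCongrₗ ℝ (finCongr (add_comm 1 i))).toLinearMap) ∘ₗ (fnBracket 1 i U)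

/-- The identification `D(X) = D(Λ^0(X))`. -/
def ofField : X.Field ≃ₗ[ℝ] X.VForm 0 where
  toFun V := Derivation.mk'
    { toFun := fun f => (⟨AlternatingMap.constOfIsEmpty ℝ X.Field (Fin 0) (V f), fun x =>
        ⟨1, one_ne_zero, PUnit, inferInstance, fun _ => V f, fun _ k => k.elim0, fun y _ W => by
          simp⟩⟩ : X.Form 0)
      map_add' := fun a b => by ext; simp
      map_smul' := fun c a => by ext; simp }
    (fun a b => by ext; simp)
  map_add' a b := by ext; simp
  map_smul' c a := by ext; simp
  invFun Ω := VForm.toAlt 0 Ω ![]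
  left_inv V := by ext f; rfl
  right_inv Ω := by
    ext f W
    rw [Subsingleton.elim W ![]]; rfl

end DSpace

/-! ### Flat connections and structural elements -/

/-- The value at `x` of a vector field, regarded as a functional on functions. -/
def DSpace.value {X : DSpace.{u}} (V : X.Field) (x : X) : X.Fn →ₗ[ℝ] ℝ where
  toFun f := (V f).1 x
  map_add' a b := by rw [map_add]; rfl
  map_smul' c a := by rw [Derivation.map_smul]; rfl

/-- `ζ` is a tangent vector at `x`. -/
def DSpace.IsTangentAt {X : DSpace.{u}} (x : X) (ζ : X.Fn →ₗ[ℝ] ℝ) : Prop :=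
  ∀ f g : X.Fn, ζ (f * g) = f.1 x * ζ g + g.1 x * ζ f

/-- The differential of a smooth map, on tangent vectors. -/
def SMap.push {X : DSpace.{u}} {Y : DSpace.{v}} (p : SMap X Y) (ζ : X.Fn →ₗ[ℝ] ℝ) : Y.Fn →ₗ[ℝ] ℝ :=
  ζ ∘ₗ p.pullback.toLinearMap

/-- A flat connection `D(M) → D(W)` in the bundle `ξ : W → M`. -/
@[ext]
structure FlatConnection {W : DSpace.{v}} {M : DSpace.{u}} (ξ : SMap W M) where
  toFun : M.Field → W.Field
  map_add : ∀ Z Z', toFun (Z + Z') = toFun Z + toFun Z'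
  map_smul : ∀ (f : M.Fn) (Z : M.Field), toFun (f • Z) = ξ.pullback f • toFun Z
  lift : ∀ (Z : M.Field) (f : M.Fn), toFun Z (ξ.pullback f) = ξ.pullback (Z f)
  flat : ∀ Z Z', toFun ⁅Z, Z'⁆ = ⁅toFun Z, toFun Z'⁆

section Bundle

variable {W : DSpace.{v}} {B : DSpace.{w}}

/-- The `p`-vertical part of `D(Λ^i(W))`: the derivations that vanish on functions on the base. -/
def vertical (p : SMap W B) (i : ℕ) : Submodule ℝ (W.VForm i) where
  carrier := {Ω | ∀ f : B.Fn, Ω (p.pullback f) = 0}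
  zero_mem' _ := rfl
  add_mem' {a b} ha hb f := by rw [Derivation.add_apply, ha f, hb f, add_zero]
  smul_mem' c a ha f := by rw [Derivation.smul_apply, ha f, smul_zero]

/-- The `p`-vertical vector fields. -/
def verticalFields (p : SMap W B) : Submodule ℝ W.Field where
  carrier := {V | ∀ f : B.Fn, V (p.pullback f) = 0}
  zero_mem' _ := rfl
  add_mem' {a b} ha hb f := by rw [Derivation.add_apply, ha f, hb f, add_zero]
  smul_mem' c a ha f := by rw [Derivation.smul_apply, ha f, smul_zero]

variable {M : DSpace.{u}} {ξ : SMap W M} (C : FlatConnection ξ)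

/-- The module of vector fields lying in the horizontal distribution: at every point such a field
takes the value of the lift of some vector field on `M`. -/
def FlatConnection.horizontal : Set W.Field :=
  {V | ∀ x : W, ∃ Z : M.Field, DSpace.value V x = DSpace.value (C.toFun Z) x}

/-- `U` is the connection form of `C`: the `1`-form `U(f)` vanishes on horizontal fields, and takes
the value `V(f)` on each vertical field `V`. -/
def FlatConnection.IsStructuralElement (U : W.VForm 1) : Prop :=
  (∀ (f : W.Fn) (V : W.Field), V ∈ C.horizontal → (U f).1 ![V] = 0) ∧
  ∀ (f : W.Fn) (V : W.Field), V ∈ verticalFields ξ → (U f).1 ![V] = V f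

end Bundle

/-! ### Jets, equations and their infinite prolongations -/

section Jets

variable (n : ℕ) {M : Type u} [TopologicalSpace M] [ChartedSpace (EuclideanSpace ℝ (Fin n)) M]
  (F : Type w) [NormedAddCommGroup F] [NormedSpace ℝ F]
  (E : M → Type v) [∀ x, AddCommGroup (E x)] [∀ x, Module ℝ (E x)] [∀ x, TopologicalSpace (E x)]
  [TopologicalSpace (Bundle.TotalSpace F E)] [FiberBundle F E] [VectorBundle ℝ F E]

/-- Smooth sections of the vector bundle. -/
abbrev Section : Type (max u v) := ContMDiffSection (𝓡 n) F ∞ E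

instance : Module (DSpace.ofManifold n M).Fn (Section n F E) where
  smul f s := ⟨fun x => f.1 x • s x, ContMDiff.smul_section f.2 s.contMDiff⟩
  one_smul s := by ext x; exact one_smul ℝ (s x)
  mul_smul f g s := by ext x; exact mul_smul (f.1 x) (g.1 x) (s x)
  smul_zero f := by ext x; exact smul_zero (f.1 x)
  smul_add f s t := by ext x; exact smul_add (f.1 x) (s x) (t x)
  add_smul f g s := by ext x; exact add_smul (f.1 x) (g.1 x) (s x)
  zero_smul s := by ext x; exact zero_smul ℝ (s x)

variable {n}

/-- The ideal of functions vanishing at `x`. -/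
def DSpace.maxIdeal {X : DSpace.{u}} (x : X) : Ideal X.Fn where
  carrier := {f | f.1 x = 0}
  zero_mem' := rfl
  add_mem' {a b} ha hb := by
    have : (a + b).1 x = a.1 x + b.1 x := rfl
    change (a + b).1 x = 0
    rw [this, show a.1 x = 0 from ha, show b.1 x = 0 from hb, add_zero]
  smul_mem' c a ha := by
    have : (c • a).1 x = c.1 x * a.1 x := rfl
    change (c • a).1 x = 0
    rw [this, show a.1 x = 0 from ha, mul_zero]

variable (n)

/-- The sections that vanish at `x` together with their derivatives of order `≤ k`. -/
def vanishing (x : DSpace.ofManifold n M) (k : ℕ∞) :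
    Submodule (DSpace.ofManifold n M).Fn (Section n F E) :=
  ⨅ (r : ℕ) (_ : (r : ℕ∞) ≤ k), (DSpace.maxIdeal x ^ (r + 1)) • ⊤

theorem vanishing_mono (x : DSpace.ofManifold n M) {k l : ℕ∞} (h : k ≤ l) :
    vanishing n F E x l ≤ vanishing n F E x k := by
  unfold vanishing
  exact le_iInf₂ fun r hr => iInf₂_le r (hr.trans h)

/-- The points of `J^k(π)`, `0 ≤ k ≤ ∞`: a point `x` of `M` and a `k`-jet of sections at `x`. -/
abbrev Jet (k : ℕ∞) : Type (max u v) := Σ x : DSpace.ofManifold n M, Section n F E ⧸ vanishing n F E x k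

variable {n F E}

/-- The jet `[s]_x^k`. -/
def jet (k : ℕ∞) (s : Section n F E) (x : DSpace.ofManifold n M) : Jet n F E k :=
  ⟨x, Submodule.Quotient.mk s⟩

/-- The projection `J^l(π) → J^k(π)`, `k ≤ l`. -/
def Jet.trunc {k l : ℕ∞} (h : k ≤ l) (θ : Jet n F E l) : Jet n F E k :=
  ⟨θ.1, Submodule.factor (vanishing_mono n F E θ.1 h) θ.2⟩

/-- Linear scalar differential operators of order `≤ r` on sections. -/
def IsDiffOp : ℕ → (Section n F E → (DSpace.ofManifold n M).Fn) → Prop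
  | 0, Δ => (∀ s t, Δ (s + t) = Δ s + Δ t) ∧
      ∀ (f : (DSpace.ofManifold n M).Fn) (s : Section n F E), Δ (f • s) = f * Δ s
  | r + 1, Δ => (∀ s t, Δ (s + t) = Δ s + Δ t) ∧ (∀ (c : ℝ) s, Δ (c • s) = c • Δ s) ∧
      ∀ f : (DSpace.ofManifold n M).Fn, IsDiffOp r fun s => Δ (f • s) - f * Δ s

variable (n F E)

/-- The functions generating the smooth functions on `J^k(π)`: the functions on `M` and the functions
`[s]_x ↦ Δ(s)(x)`, where `Δ` is a differential operator of finite order `r ≤ k` (such an operator maps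
sections vanishing to order `r` at `x` to functions vanishing at `x`). -/
def jetGenerators (k : ℕ∞) : Set (Jet n F E k → ℝ) :=
  {φ | (∃ f : (DSpace.ofManifold n M).Fn, φ = fun θ => f.1 θ.1) ∨
    ∃ (r : ℕ) (Δ : Section n F E → (DSpace.ofManifold n M).Fn), (r : ℕ∞) ≤ k ∧ IsDiffOp r Δ ∧
      ∀ s x, φ (jet k s x) = (Δ s).1 x}

/-- `J^k(π)` as a differential space, `0 ≤ k ≤ ∞`. -/
def jetSpace (k : ℕ∞) : DSpace.{max u v} := DSpace.generate (jetGenerators n F E k)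

variable {n F E}

theorem smooth_comp_jet (k : ℕ∞) (s : Section n F E) (φ : Jet n F E k → ℝ)
    (hφ : φ ∈ jetGenerators n F E k) :
    (DSpace.ofManifold n M).IsSmooth (fun x => φ (jet k s x)) := by
  rcases hφ with ⟨f, rfl⟩ | ⟨r, Δ, -, -, h⟩
  · exact f.2
  · have : (fun x => φ (jet k s x)) = (Δ s).1 := funext fun x => h s x
    rw [this]; exact (Δ s).2

/-- The map `j^k s : M → J^k(π)`. -/
def jetMap (k : ℕ∞) (s : Section n F E) : SMap (DSpace.ofManifold n M) (jetSpace n F E k) :=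
  SMap.ofGenerate (S := jetGenerators n F E k) (jet k s) (smooth_comp_jet k s)

/-- The projection `J^k(π) → M`. -/
def jetProj (k : ℕ∞) : SMap (jetSpace n F E k) (DSpace.ofManifold n M) where
  toFun θ := Sigma.fst θ
  smooth_comp f hf := DSpace.Gen.base _ (Or.inl ⟨⟨f, hf⟩, rfl⟩)

variable {k : ℕ} (𝓔 : Set (jetSpace n F E k))

/-- The `s`-th prolongation of the equation `𝓔 ⊂ J^k(π)`: the jets `[f]_x^(k+s)` of sections `f`
such that `[f]_x^k` lies in `𝓔` and the graph of `j^k f` is tangent to `𝓔` at this point with order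
`≥ s`, i.e. functions vanishing on `𝓔` restrict to functions of `x` with vanishing `s`-jet. -/
def prolongation (s : ℕ) : Set (jetSpace n F E (k + s : ℕ)) :=
  {θ | ∃ (x : DSpace.ofManifold n M) (f : Section n F E), θ = jet (k + s : ℕ) f x ∧
    jet (k : ℕ∞) f x ∈ 𝓔 ∧
    ∀ φ : (jetSpace n F E k).Fn, (∀ y ∈ 𝓔, φ.1 y = 0) →
      (jetMap (k : ℕ∞) f).pullback φ ∈ DSpace.maxIdeal x ^ (s + 1)}

/-- The points of the infinite prolongation `𝓔^∞ ⊂ J^∞(π)`. -/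
def infSet : Set (jetSpace n F E ⊤) :=
  {θ | ∀ s : ℕ, Jet.trunc (k := ((k + s : ℕ) : ℕ∞)) le_top θ ∈ prolongation 𝓔 s}

/-- The infinite prolongation `𝓔^∞`. -/
def infProlongation : DSpace.{max u v} := (jetSpace n F E ⊤).sub (infSet 𝓔)

/-- The inclusion `𝓔^∞ ⊂ J^∞(π)`. -/
def infIncl : SMap (infProlongation 𝓔) (jetSpace n F E ⊤) := SMap.incl _ _

/-- The projection `π_𝓔 : 𝓔^∞ → M`. -/
def infProj : SMap (infProlongation 𝓔) (DSpace.ofManifold n M) := (jetProj ⊤).comp (infIncl 𝓔)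

/-- Formal integrability: all prolongations are smooth submanifolds and `π_𝓔 : 𝓔^∞ → M` is a smooth
bundle. -/
def FormallyIntegrable : Prop :=
  (∀ s, ((jetSpace n F E (k + s : ℕ)).sub (prolongation 𝓔 s)).IsSmoothManifold) ∧
  (infProj 𝓔).IsBundle

variable {𝓔}

/-- `C` is the Cartan connection of `𝓔`: the value of `C(Z)` at `[s]_x^∞` is the image of the value
of `Z` at `x` under the differential of `j^∞ s : M → J^∞(π)`, so it is tangent to the graph of
`j^∞ s`. -/
def IsCartan (C : FlatConnection (infProj 𝓔)) : Prop :=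
  ∀ (Z : (DSpace.ofManifold n M).Field) (s : Section n F E) (x : DSpace.ofManifold n M)
    (θ : infProlongation 𝓔), infIncl 𝓔 θ = jetMap ⊤ s x →
    (infIncl 𝓔).push (DSpace.value (C.toFun Z) θ) = (jetMap ⊤ s).push (DSpace.value Z x)

variable {W : DSpace.{t}} (τ : SMap W (infProlongation 𝓔))

/-- The flat connection `C` in the bundle `π_𝓔 ∘ τ` is a covering structure in `τ : W → 𝓔^∞`: the
differential of `τ` maps the horizontal planes on `W` onto the Cartan planes on `𝓔^∞`, that is, onto
the tangent planes of the graphs of infinite jets. -/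
def IsCovering (C : FlatConnection ((infProj 𝓔).comp τ)) : Prop :=
  ∀ (Z : (DSpace.ofManifold n M).Field) (s : Section n F E) (x : DSpace.ofManifold n M) (y : W),
    infIncl 𝓔 (τ y) = jetMap ⊤ s x →
    ((infIncl 𝓔).comp τ).push (DSpace.value (C.toFun Z) y) =
      (jetMap ⊤ s).push (DSpace.value Z x)

end Jets

/-! ### The vertical tangent bundle and shadows -/

section Shadows

variable {M : DSpace.{u}} {B : DSpace.{v}} (p : SMap B M)

/-- The points of `T^v p`, the `p`-vertical tangent vectors. -/
structure VertVec where
  pt : B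
  vec : B.Fn →ₗ[ℝ] ℝ
  tangent : DSpace.IsTangentAt pt vec
  vert : p.push vec = 0

/-- `T^v p`: smooth functions are generated by the functions on the base and by the fibrewise linear
functions `v ↦ v(f)`. -/
def vertTangent : DSpace.{v} :=
  DSpace.generate (X := VertVec p)
    ({φ | ∃ f : B.Fn, φ = fun y => f.1 y.pt} ∪ {φ | ∃ f : B.Fn, φ = fun y => y.vec f})

/-- The pullback of a function on the base to `T^v p`. -/
def vertPull (f : B.Fn) : (vertTangent p).Fn :=
  ⟨fun y => f.1 (VertVec.pt y), DSpace.Gen.base _ (Or.inl ⟨f, rfl⟩)⟩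

/-- The function `v ↦ v(f)` on `T^v p`. -/
def vertLin (f : B.Fn) : (vertTangent p).Fn :=
  ⟨fun y => VertVec.vec y f, DSpace.Gen.base _ (Or.inr ⟨f, rfl⟩)⟩

variable {p}

/-- The Cartan plane at the point `y` of `T^v p`, for a flat connection `C` in `p`. It consists of the
lifts of the values of the fields `C(Z)`; here the lift of `C(Z)` differentiates the function
`v ↦ v(f)` to `v ↦ v(C(Z)(f))`. Equivalently, it is the horizontal lift for the linear connection
`Y ↦ [C(Z), Y]` on vertical fields `Y`. -/
def cartanPlane (C : FlatConnection p) (y : vertTangent p) : Set ((vertTangent p).Fn →ₗ[ℝ] ℝ) :=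
  {ζ | DSpace.IsTangentAt y ζ ∧ ∃ Z : M.Field, ∀ f : B.Fn,
    ζ (vertPull p f) = (C.toFun Z f).1 (VertVec.pt y) ∧
    ζ (vertLin p f) = VertVec.vec y (C.toFun Z f)}

/-- A shadow in `τ : W → B`: a smooth map `W → T^v p` over `τ` whose differential takes the horizontal
distribution of `W` to the Cartan distribution of `T^v p`. -/
structure Shadow (C : FlatConnection p) {W : DSpace.{w}} (τ : SMap W B)
    (Cτ : FlatConnection (p.comp τ)) where
  map : SMap W (vertTangent p)
  overBase : ∀ y : W, VertVec.pt (map y) = τ y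
  cartan : ∀ V ∈ Cτ.horizontal, ∀ y : W, map.push (DSpace.value V y) ∈ cartanPlane C (map y)

end Shadows

/-! ### Cohomology, symmetries and deformations -/

section Cohomology

variable {M : DSpace.{u}} {B : DSpace.{v}} {W : DSpace.{w}} {p : SMap B M} (τ : SMap W B)

/-- The cocycles of degree `i` of the complex `D^g(Λ^i(W))` of `τ`-vertical derivations with the
differential `∂_U`. For `i = 0` this is `H_g^0`. -/
def gaugeCocycles (U : W.VForm 1) (i : ℕ) : Submodule ℝ (W.VForm i) :=
  vertical τ i ⊓ LinearMap.ker (DSpace.delta U i)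

/-- The coboundaries of degree `i + 1` of the complex of `τ`-vertical derivations. -/
def gaugeCoboundaries (U : W.VForm 1) (i : ℕ) : Submodule ℝ (W.VForm (i + 1)) where
  carrier := {Ω | ∃ Θ ∈ vertical τ i, ∀ f, (Ω f).1 = DSpace.delta U i Θ f}
  zero_mem' := ⟨0, zero_mem _, fun f => by simp⟩
  add_mem' := by
    rintro a b ⟨Θ, hΘ, h⟩ ⟨Θ', hΘ', h'⟩
    exact ⟨Θ + Θ', add_mem hΘ hΘ', fun f => by simp [h, h']⟩
  smul_mem' := by
    rintro c a ⟨Θ, hΘ, h⟩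
    exact ⟨c • Θ, Submodule.smul_mem _ c hΘ, fun f => by simp [h]⟩

/-- `H_g^(i+1)`. -/
abbrev GaugeCohomology (U : W.VForm 1) (i : ℕ) : Type w :=
  gaugeCocycles τ U (i + 1) ⧸ (gaugeCoboundaries τ U i).submoduleOf (gaugeCocycles τ U (i + 1))

/-- `D^s(Λ^i(W)) = D^v(Λ^i(W)) / D^g(Λ^i(W))`, the terms of the quotient complex; `p ∘ τ : W → M`. -/
abbrev ShadowForms (p : SMap B M) (i : ℕ) : Type w :=
  vertical (p.comp τ) i ⧸ (vertical τ i).submoduleOf (vertical (p.comp τ) i)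

/-- `H_s^0`, the kernel of `∂_s : D^s(W) → D^s(Λ^1(W))`: the classes of those `Ω` in `D^v(W)` for
which `∂_U Ω` vanishes on the functions on the base of `τ`. -/
def shadowH0 (p : SMap B M) (U : W.VForm 1) : Submodule ℝ (ShadowForms τ p 0) :=
  Submodule.map (Submodule.mkQ _)
    (LinearMap.ker ((LinearMap.lcomp ℝ _ τ.pullback.toLinearMap) ∘ₗ DSpace.delta U 0 ∘ₗ
      (vertical (p.comp τ) 0).subtype))

variable {τ}

/-- Nonlocal `τ`-symmetries: vector fields on `W` which are vertical over `M` and preserve the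
horizontal distribution. -/
def IsNonlocalSymmetry (C : FlatConnection (p.comp τ)) (V : W.Field) : Prop :=
  V ∈ verticalFields (p.comp τ) ∧ ∀ Y ∈ C.horizontal, ⁅V, Y⁆ ∈ C.horizontal

variable (τ)

/-- An infinitesimal deformation `U + tΩ` of the structure `U`, to first order in `t`, which leaves
the structure on the base of `τ` unchanged: `[[U + tΩ, U + tΩ]] = O(t^2)`, and `U + tΩ` agrees with
`U` on the functions on the base. -/
structure InfDeformation (U : W.VForm 1) where
  Ω : W.VForm 1
  integrable : ∃ R : W.Fn →ₗ[ℝ] W.Alt 2, ∀ t : ℝ,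
    DSpace.fnBracket 1 1 (U + t • Ω) (U + t • Ω) = t ^ 2 • R
  base : ∀ (t : ℝ) (f : B.Fn), (U + t • Ω) (τ.pullback f) = U (τ.pullback f)

/-- Two infinitesimal deformations `U_t = U + tΩ` and `U'_t = U + tΩ'` are equivalent if a first order
family of transformations of `W` over the base of `τ` takes one to the other. Such a family acts by
`f ↦ f + t V(f)` on functions and by `ρ ↦ ρ + t L_V ρ` on forms, where `V` is a `τ`-vertical vector
field, and the condition is `U_t(f) + t L_V(U_t(f)) = U'_t(f + t V(f)) + O(t^2)`. -/
def InfDeformation.Equiv {U : W.VForm 1} (D D' : InfDeformation τ U) : Prop :=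
  ∃ V ∈ verticalFields τ, ∀ f : W.Fn, ∃ R : W.Alt 1, ∀ t : ℝ,
    (((U + t • D.Ω) f).1 + t • DSpace.lieD 0 1 (DSpace.ofField V) ((U + t • D.Ω) f).1 : W.Alt 1) -
      ((U + t • D'.Ω) (f + t • V f)).1 = t ^ 2 • R

end Cohomology

end

/-! Let P be the projection of fields on W onto vertical fields along the horizontal distribution.
As a field-valued one-form, U is P, and expanding the bracket gives (∂_U X)(Y) = P[X, Y] - [X, PY]
for a field X. If X is vertical, this vanishes for vertical Y, because then [X, Y] is vertical. On a
lift Y = C(Z) it equals [X, C(Z)], which is vertical because C(Z) projects to Z. Horizontal fields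
are locally combinations of lifts, so (∂_U X)(f) = 0 exactly when every [X, C(Z)] annihilates f
(`FlatConnection.IsStructuralElement.delta_ofField_eq_zero_iff`). Degree zero rests on this.

Gauge symmetries: when all f are tested, X commutes with the lifts. This amounts to preserving the
horizontal distribution, since [X, C(Z)] is vertical and only the zero field is both vertical and
horizontal.

Shadows: when only f = τ^*g is tested, the condition reads C(Z)(X(τ^*g)) = X(τ^*(C₀(Z)g)), which
says that y ↦ τ_*X_y respects the Cartan planes. A class modulo D^g is determined by this map. The
substantial point is surjectivity, that is, lifting a shadow to a field on W
(`SMap.IsBundle.exists_lift`). In a local trivialization the lift is taken with no component along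
the fibre, and local lifts are glued with locally finite weights. Countably many of them suffice
because W is an inverse limit of a sequence of second countable manifolds.

Deformations: on D(Λ^1) the bracket is symmetric, so [[U + tΩ, U + tΩ]] = [[U, U]] + 2t[[U, Ω]] +
t²[[Ω, Ω]]. Flatness gives [[U, U]] = 0, so first order integrability is closedness of Ω, and the
t-linear part of the equivalence condition is Ω - Ω' = ∂_U X.

Local frames on M, obtained from Hadamard's lemma and bump functions, give U and the splitting. The
Cartan connection is obtained by descent: C(Z) sends the function of jets given by a differential
operator Δ to the one given by Z ∘ Δ, so it preserves the functions pulled back by τ. -/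

noncomputable section
-- Hadamard's lemma
/-- Smooth dependence on the parameter of the integral over `[0, 1]` of a smooth function. -/
theorem contDiff_integral_param {E : Type} [NormedAddCommGroup E] [NormedSpace ℝ E]
    [FiniteDimensional ℝ E] (n : ℕ) :
    ∀ {F : Type} [NormedAddCommGroup F] [NormedSpace ℝ F] [CompleteSpace F] (G : E × ℝ → F),
      ContDiff ℝ ∞ G → ContDiff ℝ n fun y => ∫ s in (0 : ℝ)..1, G (y, s) := by
  induction n with
  | zero =>
    intro F _ _ _ G hG
    exact contDiff_zero.2
      (intervalIntegral.continuous_parametric_intervalIntegral_of_continuous'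
        (f := fun y s => G (y, s)) hG.continuous 0 1)
  | succ n ih =>
    intro F _ _ _ G hG
    -- The partial derivative takes values in `E →L[ℝ] F`, which is why the codomain is quantified
    -- inside the induction.
    have hG' : ContDiff ℝ ∞ fun q : E × ℝ =>
        (fderiv ℝ G q).comp (ContinuousLinearMap.inl ℝ E ℝ) :=
      (hG.fderiv_right (m := ∞) le_rfl).clm_comp contDiff_const
    refine (contDiff_succ_iff_hasFDerivAt (n := n)).2 ⟨_, ih _ hG', fun y => ?_⟩
    have hder : ∀ z s, HasFDerivAt (fun z => G (z, s))
        ((fderiv ℝ G (z, s)).comp (ContinuousLinearMap.inl ℝ E ℝ)) z := fun z s =>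
      ((hG.differentiable (by simp)) (z, s)).hasFDerivAt.comp z (hasFDerivAt_prodMk_left z s)
    have hcont : ∀ z, Continuous fun s => G (z, s) := fun z =>
      hG.continuous.comp (Continuous.prodMk_right z)
    have hcont' : ∀ z, Continuous fun s => (fderiv ℝ G (z, s)).comp (ContinuousLinearMap.inl ℝ E ℝ) :=
      fun z => hG'.continuous.comp (Continuous.prodMk_right z)
    -- The dominating constant comes from compactness of the closed unit ball around y times [0, 1];
    -- this is where finite dimension of the parameter space enters.
    obtain ⟨c, hc⟩ := ((isCompact_closedBall y 1).prod (isCompact_Icc (a := (0 : ℝ)) (b := 1))).exists_bound_of_continuousOn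
      hG'.continuous.continuousOn
    refine intervalIntegral.hasFDerivAt_integral_of_dominated_of_fderiv_le
      (F := fun z s => G (z, s))
      (F' := fun z s => (fderiv ℝ G (z, s)).comp (ContinuousLinearMap.inl ℝ E ℝ))
      (bound := fun _ => c) (Metric.ball_mem_nhds y one_pos) ?_ ?_ ?_ ?_ ?_ ?_
    · exact Filter.Eventually.of_forall fun z => (hcont z).aestronglyMeasurable
    · exact (hcont y).intervalIntegrable 0 1
    · exact (hcont' y).aestronglyMeasurable
    · refine Filter.Eventually.of_forall fun s hs z hz => hc (z, s) ⟨Metric.ball_subset_closedBall hz, ?_⟩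
      rw [Set.uIoc_of_le zero_le_one] at hs
      exact ⟨hs.1.le, hs.2⟩
    · exact intervalIntegrable_const
    · exact Filter.Eventually.of_forall fun s _ z _ => hder z s

/-- Hadamard's lemma. -/
theorem exists_hadamard {n : ℕ} {g : (Fin n → ℝ) → ℝ} (hg : ContDiff ℝ ∞ g) (a : Fin n → ℝ) :
    ∃ q : Fin n → (Fin n → ℝ) → ℝ, (∀ i, ContDiff ℝ ∞ (q i)) ∧
      (∀ y, g y = g a + ∑ i, (y i - a i) * q i y) ∧
      ∀ i, q i a = fderiv ℝ g a (Pi.single i 1) := by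
  have hline : ∀ y : Fin n → ℝ, ∀ s : ℝ, HasDerivAt (fun s => a + s • (y - a)) (y - a) s := fun y s => by
    simpa using ((hasDerivAt_id s).smul_const (y - a)).const_add a
  have hfd : ContDiff ℝ ∞ (fderiv ℝ g) := hg.fderiv_right le_rfl
  have hG : ∀ i : Fin n, ContDiff ℝ ∞ fun q : (Fin n → ℝ) × ℝ =>
      fderiv ℝ g (a + q.2 • (q.1 - a)) (Pi.single i 1) := fun i =>
    (hfd.comp (contDiff_const.add (contDiff_snd.smul (contDiff_fst.sub contDiff_const)))).clm_apply
      contDiff_const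
  -- The i-th quotient is the mean of the i-th partial derivative over the segment from a to y. At y
  -- = a the integrand is constant.
  refine ⟨fun i y => ∫ s in (0 : ℝ)..1, fderiv ℝ g (a + s • (y - a)) (Pi.single i 1),
    fun i => contDiff_infty.2 fun m => contDiff_integral_param m _ (hG i), fun y => ?_, fun i => ?_⟩
  · have hc : ∀ i : Fin n, Continuous fun s : ℝ => fderiv ℝ g (a + s • (y - a)) (Pi.single i 1) :=
      fun i => (hG i).continuous.comp (Continuous.prodMk_right y)
    have key : ∀ s : ℝ, HasDerivAt (fun s => g (a + s • (y - a)))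
        (∑ i, (y i - a i) * fderiv ℝ g (a + s • (y - a)) (Pi.single i 1)) s := fun s => by
      have h := ((hg.differentiable (by simp)) (a + s • (y - a))).hasFDerivAt.comp_hasDerivAt s (hline y s)
      have e : ∀ T : (Fin n → ℝ) →L[ℝ] ℝ, T (y - a) = ∑ i, (y i - a i) * T (Pi.single i 1) := fun T => by
        have : y - a = ∑ i, (y i - a i) • (Pi.single i 1 : Fin n → ℝ) := by
          ext j; simp [Finset.sum_apply, Pi.single_apply]
        rw [this, map_sum]; simp
      rw [e] at h
      exact h
    have h := intervalIntegral.integral_eq_sub_of_hasDerivAt (a := 0) (b := 1) (fun s _ => key s)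
      ((continuous_finsetSum _ fun i _ => (hc i).const_mul _).intervalIntegrable 0 1)
    rw [intervalIntegral.integral_finsetSum fun i _ => ((hc i).const_mul _).intervalIntegrable 0 1] at h
    simp only [intervalIntegral.integral_const_mul] at h
    rw [h]; simp
  · simp

/-! ### Pointwise calculus of smooth functions -/

namespace DSpace

section Values

variable {X : DSpace.{u}}

theorem Fn.ext {f g : X.Fn} (h : ∀ x, f.1 x = g.1 x) : f = g := Subtype.ext (funext h)

@[simp] theorem Fn.val_add (f g : X.Fn) (x : X) : (f + g).1 x = f.1 x + g.1 x := rfl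

@[simp] theorem Fn.val_mul (f g : X.Fn) (x : X) : (f * g).1 x = f.1 x * g.1 x := rfl

@[simp] theorem Fn.val_smul_fn (f g : X.Fn) (x : X) : (f • g).1 x = f.1 x * g.1 x := rfl

@[simp] theorem Fn.val_sub (f g : X.Fn) (x : X) : (f - g).1 x = f.1 x - g.1 x := rfl

@[simp] theorem Fn.val_neg (f : X.Fn) (x : X) : (-f).1 x = -f.1 x := rfl

@[simp] theorem Fn.val_smul (c : ℝ) (f : X.Fn) (x : X) : (c • f).1 x = c * f.1 x := rfl

@[simp] theorem Fn.val_zero (x : X) : (0 : X.Fn).1 x = 0 := rfl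

@[simp] theorem Fn.val_one (x : X) : (1 : X.Fn).1 x = 1 := rfl

@[simp] theorem Fn.val_algebraMap (c : ℝ) (x : X) : (algebraMap ℝ X.Fn c).1 x = c := rfl

/-- Evaluation at a point. -/
def Fn.eval (x : X) : X.Fn →ₐ[ℝ] ℝ where
  toFun f := f.1 x
  map_one' := rfl
  map_mul' _ _ := rfl
  map_zero' := rfl
  map_add' _ _ := rfl
  commutes' _ := rfl

@[simp] theorem Fn.val_sum {ι : Type*} (s : Finset ι) (f : ι → X.Fn) (x : X) :
    (∑ i ∈ s, f i).1 x = ∑ i ∈ s, (f i).1 x := map_sum (Fn.eval x) f s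

theorem Fn.val_prod {ι : Type*} (s : Finset ι) (f : ι → X.Fn) (x : X) :
    (∏ i ∈ s, f i).1 x = ∏ i ∈ s, (f i).1 x := map_prod (Fn.eval x) f s

/-- Composition with a smooth function of one variable. -/
def Fn.map (g : ℝ → ℝ) (hg : ContDiff ℝ ∞ g) (f : X.Fn) : X.Fn :=
  ⟨fun x => g (f.1 x), X.comp_smooth 1 (fun v => g (v 0)) (hg.comp (contDiff_apply ℝ ℝ 0))
    (fun _ => f.1) fun _ => f.2⟩

@[simp] theorem Fn.map_val (g : ℝ → ℝ) (hg : ContDiff ℝ ∞ g) (f : X.Fn) (x : X) :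
    (Fn.map g hg f).1 x = g (f.1 x) := rfl

end Values

/-! ### Locally smooth functions -/

/-- The function `w` is smooth near `x`. -/
def SmoothAt (X : DSpace.{u}) (w : X → ℝ) (x : X) : Prop :=
  ∃ k g : X.Fn, k.1 x ≠ 0 ∧ ∀ y, k.1 y ≠ 0 → w y = g.1 y

section SmoothAt

variable {X : DSpace.{u}}

theorem isSmooth_of_smoothAt {w : X → ℝ} (h : ∀ x, X.SmoothAt w x) : X.IsSmooth w :=
  X.local_smooth w fun x => by
    obtain ⟨k, g, hk, hg⟩ := h x
    exact ⟨k.1, k.2, hk, g.1, g.2, hg⟩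

theorem Fn.smoothAt (f : X.Fn) (x : X) : X.SmoothAt f.1 x := ⟨1, f, one_ne_zero, fun _ _ => rfl⟩

theorem SmoothAt.congr {w w' : X → ℝ} {x : X} (h : X.SmoothAt w x) (k : X.Fn) (hk : k.1 x ≠ 0)
    (hw : ∀ y, k.1 y ≠ 0 → w' y = w y) : X.SmoothAt w' x := by
  obtain ⟨l, g, hl, hg⟩ := h
  refine ⟨k * l, g, mul_ne_zero hk hl, fun y hy => ?_⟩
  have hy' : k.1 y * l.1 y ≠ 0 := hy
  rw [hw y (left_ne_zero_of_mul hy'), hg y (right_ne_zero_of_mul hy')]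

theorem SmoothAt.comp {m : ℕ} {g : (Fin m → ℝ) → ℝ} (hg : ContDiff ℝ ∞ g) {w : Fin m → X → ℝ} {x : X}
    (h : ∀ i, X.SmoothAt (w i) x) : X.SmoothAt (fun y => g fun i => w i y) x := by
  choose k f hk hf using h
  refine ⟨∏ i, k i, ⟨_, X.comp_smooth m g hg (fun i => (f i).1) fun i => (f i).2⟩, ?_, fun y hy => ?_⟩
  · rw [Fn.val_prod]; exact Finset.prod_ne_zero_iff.2 fun i _ => hk i
  · rw [Fn.val_prod] at hy
    have : (fun i => w i y) = fun i => (f i).1 y :=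
      funext fun i => hf i y (Finset.prod_ne_zero_iff.1 hy i (Finset.mem_univ i))
    simp only [this]

theorem SmoothAt.mul {w w' : X → ℝ} {x : X} (h : X.SmoothAt w x) (h' : X.SmoothAt w' x) :
    X.SmoothAt (fun y => w y * w' y) x :=
  SmoothAt.comp (g := fun v : Fin 2 → ℝ => v 0 * v 1) (by fun_prop) (w := ![w, w'])
    (by intro i; fin_cases i <;> simpa)

theorem SmoothAt.sum {m : ℕ} {w : Fin m → X → ℝ} {x : X} (h : ∀ i, X.SmoothAt (w i) x) :
    X.SmoothAt (fun y => ∑ i, w i y) x :=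
  SmoothAt.comp (g := fun v : Fin m → ℝ => ∑ i, v i) (by fun_prop) h

/-- The smooth functions on a subset are, locally, restrictions of smooth functions. -/
theorem exists_restrict {A : Set X} {f : A → ℝ} (hf : (X.sub A).IsSmooth f) (a : A) :
    ∃ k g : X.Fn, k.1 a.1 ≠ 0 ∧ ∀ y : A, k.1 y.1 ≠ 0 → f y = g.1 y.1 := by
  induction hf generalizing a with
  | base f hf =>
    obtain ⟨g, hg, rfl⟩ := hf
    exact ⟨1, ⟨g, hg⟩, one_ne_zero, fun _ _ => rfl⟩
  | comp m g hg f _ ih =>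
    choose k l hk hl using fun i => ih i a
    refine ⟨∏ i, k i, ⟨_, X.comp_smooth m g hg (fun i => (l i).1) fun i => (l i).2⟩, ?_, fun y hy => ?_⟩
    · rw [Fn.val_prod]; exact Finset.prod_ne_zero_iff.2 fun i _ => hk i
    · rw [Fn.val_prod] at hy
      have : (fun i => f i y) = fun i => (l i).1 y.1 :=
        funext fun i => hl i y (Finset.prod_ne_zero_iff.1 hy i (Finset.mem_univ i))
      simp only [this]
  | glue f h g _ hx _ hf ihh ihg =>
    obtain ⟨k, l, hk, hl⟩ := ihh a a
    obtain ⟨k', l', hk', hl'⟩ := ihg a a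
    refine ⟨k * l * k', l', mul_ne_zero (mul_ne_zero hk ?_) hk', fun y hy => ?_⟩
    · rw [← hl a hk]; exact hx a
    · have hy' : k.1 y.1 * l.1 y.1 * k'.1 y.1 ≠ 0 := hy
      have h1 := left_ne_zero_of_mul (left_ne_zero_of_mul hy')
      have h2 := right_ne_zero_of_mul (left_ne_zero_of_mul hy')
      rw [hf a y (by rw [hl y h1]; exact h2), hl' y (right_ne_zero_of_mul hy')]

end SmoothAt

/-! ### Tangent vectors -/

namespace IsTangentAt

variable {X : DSpace.{u}} {x : X} {ζ ζ' : X.Fn →ₗ[ℝ] ℝ}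

theorem map_one (h : IsTangentAt x ζ) : ζ 1 = 0 := by
  have := h 1 1
  simp only [mul_one, Fn.val_one, one_mul] at this
  linarith

theorem map_algebraMap (h : IsTangentAt x ζ) (c : ℝ) : ζ (algebraMap ℝ X.Fn c) = 0 := by
  rw [Algebra.algebraMap_eq_smul_one, map_smul, h.map_one, smul_zero]

/-- Tangent vectors are local without any bump function: k(f - g) vanishes identically, f - g
vanishes at x, and the Leibniz rule leaves k(x)ζ(f - g) = 0. -/
theorem congr_of_eq (h : IsTangentAt x ζ) {f g : X.Fn} (k : X.Fn) (hk : k.1 x ≠ 0)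
    (hfg : ∀ y, k.1 y ≠ 0 → f.1 y = g.1 y) : ζ f = ζ g := by
  have e : k * (f - g) = 0 := Fn.ext fun y => by
    by_cases hy : k.1 y = 0
    · simp [hy]
    · simp [hfg y hy]
  have := h k (f - g)
  rw [e, map_zero, Fn.val_sub, hfg x hk, sub_self, zero_mul, add_zero] at this
  rw [← sub_eq_zero, ← map_sub]
  exact (mul_eq_zero.1 this.symm).resolve_left hk

theorem map_sum_mul (h : IsTangentAt x ζ) {ι : Type*} (s : Finset ι) (a b : ι → X.Fn) :
    ζ (∑ i ∈ s, a i * b i) = ∑ i ∈ s, ((a i).1 x * ζ (b i) + (b i).1 x * ζ (a i)) := by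
  rw [map_sum]; exact Finset.sum_congr rfl fun i _ => h _ _

/-- The chain rule. -/
theorem chain (h : IsTangentAt x ζ) {m : ℕ} {g : (Fin m → ℝ) → ℝ} (hg : ContDiff ℝ ∞ g)
    (f : Fin m → X.Fn) (F : X.Fn) (hF : ∀ y, F.1 y = g fun i => (f i).1 y) :
    ζ F = ∑ i, fderiv ℝ g (fun i => (f i).1 x) (Pi.single i 1) * ζ (f i) := by
  obtain ⟨q, hq, hgq, hqa⟩ := exists_hadamard hg fun i => (f i).1 x
  let Q : Fin m → X.Fn := fun i => ⟨_, X.comp_smooth m (q i) (hq i) (fun i => (f i).1) fun i => (f i).2⟩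
  -- Hadamard's lemma composed with the functions f i. Since f i - (f i)(x) vanishes at x, the
  -- Leibniz rule keeps only Q i (x) ζ(f i).
  have e : F = algebraMap ℝ X.Fn (g fun i => (f i).1 x) +
      ∑ i, (f i - algebraMap ℝ X.Fn ((f i).1 x)) * Q i := Fn.ext fun y => by
    rw [hF, hgq, Fn.val_add, Fn.val_sum]; rfl
  rw [e, map_add, h.map_algebraMap, zero_add, h.map_sum_mul]
  refine Finset.sum_congr rfl fun i _ => ?_
  rw [Fn.val_sub, Fn.val_algebraMap, sub_self, zero_mul, zero_add, map_sub, h.map_algebraMap, sub_zero,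
    ← hqa i]

/-- Tangent vectors are determined by their values on a generating set. -/
theorem ext_generate {T : Type u} {S : Set (T → ℝ)} {x : generate S} {ζ ζ' : (generate S).Fn →ₗ[ℝ] ℝ}
    (h : IsTangentAt x ζ) (h' : IsTangentAt x ζ')
    (hS : ∀ f (hf : f ∈ S), ζ ⟨f, Gen.base f hf⟩ = ζ' ⟨f, Gen.base f hf⟩) : ζ = ζ' := by
  suffices key : ∀ f (hf : Gen S f), ζ ⟨f, hf⟩ = ζ' ⟨f, hf⟩ from LinearMap.ext fun f => key f.1 f.2
  intro f hf
  induction hf with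
  | base f hf => exact hS f hf
  | comp m g hg f hf ih =>
    refine (h.chain hg (fun i => ⟨f i, hf i⟩) _ fun _ => rfl).trans
      (Eq.trans ?_ (h'.chain hg (fun i => ⟨f i, hf i⟩) _ fun _ => rfl).symm)
    exact Finset.sum_congr rfl fun i _ => congrArg _ (ih i)
  | glue f k g hk hx hg hf ihh ihg =>
    exact (h.congr_of_eq (f := ⟨f, _⟩) (g := ⟨g x, hg x⟩) ⟨k x, hk x⟩ (hx x) (hf x)).trans ((ihg x).trans
      (h'.congr_of_eq (f := ⟨f, _⟩) (g := ⟨g x, hg x⟩) ⟨k x, hk x⟩ (hx x) (hf x)).symm)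

theorem push {Y : DSpace.{v}} (p : SMap X Y) (h : IsTangentAt x ζ) : IsTangentAt (p x) (p.push ζ) :=
  fun f g => by
    change ζ (p.pullback (f * g)) = _
    rw [map_mul, h]; rfl

end IsTangentAt

theorem isTangentAt_value {X : DSpace.{u}} (V : X.Field) (x : X) : IsTangentAt x (value V x) :=
  fun f g => by
    change (V (f * g)).1 x = _
    rw [Derivation.leibniz]; rfl

end DSpace

namespace DSpace

/-! ### Brackets and Lie derivatives in low degrees -/

section LowDegree

variable {X : DSpace.{u}}

theorem extD_zero_apply (ρ : X.Alt 0) (v : Fin 1 → X.Field) : extD 0 ρ v = v 0 (ρ ![]) := by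
  simp only [extD, extDLead, LinearMap.coe_comp, Function.comp_apply,
    AlternatingMap.alternatizeUncurryFinLM_apply, AlternatingMap.alternatizeUncurryFin_apply]
  simp [Subsingleton.elim (Fin.tail v) ![]]

theorem extD_one_apply (ρ : X.Alt 1) (v : Fin 2 → X.Field) :
    extD 1 ρ v = v 0 (ρ ![v 1]) - v 1 (ρ ![v 0]) - ρ ![⁅v 0, v 1⁆] := by
  have h1 : Fin.tail v = ![v 1] := by ext i; fin_cases i; rfl
  have h0 : Fin.removeNth 1 v = ![v 0] := by ext i; fin_cases i; rfl
  have hs : ρ ![⁅v 1, v 0⁆] = -ρ ![⁅v 0, v 1⁆] := by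
    have := ρ.map_vecCons_smul ![] (-1 : ℝ) ⁅v 0, v 1⁆
    simpa only [neg_smul, one_smul, lie_skew] using this
  have e : ∀ Y : X.Field, ∀ z : Fin 0 → X.Field, Matrix.vecCons Y z = ![Y] := fun Y z => by
    rw [Subsingleton.elim z ![]]
  simp only [extD, extDLead, extDBracket, LinearMap.sub_apply, LinearMap.smul_apply, LinearMap.coe_comp,
    Function.comp_apply, AlternatingMap.alternatizeUncurryFinLM_apply, AlternatingMap.sub_apply,
    AlternatingMap.smul_apply, AlternatingMap.alternatizeUncurryFin_apply]
  simp [AlternatingMap.alternatizeUncurryFin_apply, Fin.sum_univ_two, h1, h0, e]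
  -- `extDBracket` counts the pair once in each order; skew-symmetry merges the two copies and the
  -- factor 1/2 in `extD` leaves one.
  rw [hs, sub_eq_add_neg, sub_eq_add_neg]
  congr 1
  rw [smul_neg, neg_neg, ← add_smul]
  norm_num

theorem innerProd_zero_zero_apply (V : X.VForm 0) (ρ : X.Alt 1) (v : Fin (0 + 0) → X.Field) :
    innerProd 0 0 V ρ v = ρ ![VForm.toAlt 0 V ![]] := by
  simp only [innerProd, LinearMap.mk₂_apply, AlternatingMap.smul_apply,
    MultilinearMap.alternatization_apply]
  simp
  congr 1
  ext i : 1
  fin_cases i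
  exact congrArg (VForm.toAlt 0 V) (Subsingleton.elim _ _)

theorem innerProd_zero_one_apply (V : X.VForm 0) (ρ : X.Alt 2) (v : Fin (0 + 1) → X.Field) :
    innerProd 0 1 V ρ v = ρ ![VForm.toAlt 0 V ![], v 0] := by
  simp only [innerProd, LinearMap.mk₂_apply, AlternatingMap.smul_apply,
    MultilinearMap.alternatization_apply]
  have e : (Finset.univ : Finset (Equiv.Perm (Fin (0 + 1)))) = {1} := by decide
  rw [e, Finset.sum_singleton]
  simp
  congr 1
  ext i : 1
  fin_cases i
  · exact congrArg (VForm.toAlt 0 V) (Subsingleton.elim _ _)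
  · rfl

theorem innerProd_one_zero_apply (U : X.VForm 1) (ρ : X.Alt 1) (v : Fin (1 + 0) → X.Field) :
    innerProd 1 0 U ρ v = ρ ![VForm.toAlt 1 U v] := by
  simp only [innerProd, LinearMap.mk₂_apply, AlternatingMap.smul_apply,
    MultilinearMap.alternatization_apply]
  simp
  congr 1
  ext i : 1
  fin_cases i
  refine congrArg (VForm.toAlt 1 U) (funext fun i => ?_)
  fin_cases i
  rfl

theorem innerProd_one_one_apply (U : X.VForm 1) (ρ : X.Alt 2) (v : Fin (1 + 1) → X.Field) :
    innerProd 1 1 U ρ v = ρ ![VForm.toAlt 1 U ![v 0], v 1] - ρ ![VForm.toAlt 1 U ![v 1], v 0] := by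
  simp only [innerProd, LinearMap.mk₂_apply, AlternatingMap.smul_apply,
    MultilinearMap.alternatization_apply]
  have e : (Finset.univ : Finset (Equiv.Perm (Fin (1 + 1)))) = {1, Equiv.swap 0 1} := by decide
  have h1 : (1 : Equiv.Perm (Fin (1 + 1))) ≠ Equiv.swap 0 1 := by decide
  rw [e, Finset.sum_pair h1]
  simp
  rw [sub_eq_add_neg]
  congr 2
  · ext i : 1
    fin_cases i
    · refine congrArg (VForm.toAlt 1 U) (funext fun i => ?_)
      fin_cases i
      rfl
    · rfl
  · congr 1
    ext i : 1
    fin_cases i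
    · refine congrArg (VForm.toAlt 1 U) (funext fun i => ?_)
      fin_cases i
      rfl
    · rfl

theorem vec_eq_of_fin_one {α : Type*} (v : Fin 1 → α) : v = ![v 0] := by
  ext i; fin_cases i; rfl

theorem lieD_one_zero_apply (U : X.VForm 1) (ρ : X.Alt 0) (v : Fin (1 + 0) → X.Field) :
    lieD 1 0 U ρ v = VForm.toAlt 1 U v (ρ ![]) := by
  have : lieD 1 0 U ρ v = innerProd 1 0 U (extD 0 ρ) v := rfl
  rw [this, innerProd_one_zero_apply, extD_zero_apply]
  rfl

theorem lieD_zero_one_apply (Θ : X.VForm 0) (ρ : X.Alt 1) (v : Fin (0 + 1) → X.Field) :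
    lieD 0 1 Θ ρ v =
      VForm.toAlt 0 Θ ![] (ρ ![v 0]) - ρ ![⁅VForm.toAlt 0 Θ ![], v 0⁆] := by
  have : lieD 0 1 Θ ρ v = innerProd 0 1 Θ (extD 1 ρ) v -
      ((-1) ^ (0 + 1) : ℝ) • extD 0 (innerProd 0 0 Θ ρ) v := rfl
  rw [this, innerProd_zero_one_apply, extD_one_apply, extD_zero_apply, innerProd_zero_zero_apply]
  simp only [Matrix.cons_val_zero, Matrix.cons_val_one, zero_add, pow_one, neg_smul, one_smul]
  abel

/-- In i_U d - d i_U the terms where v 0 or v 1 itself differentiates cancel, so only derivatives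
along values of U remain. -/
theorem lieD_one_one_apply (U : X.VForm 1) (ρ : X.Alt 1) (v : Fin (1 + 1) → X.Field) :
    lieD 1 1 U ρ v =
      VForm.toAlt 1 U ![v 0] (ρ ![v 1]) - VForm.toAlt 1 U ![v 1] (ρ ![v 0])
        - ρ ![⁅VForm.toAlt 1 U ![v 0], v 1⁆] + ρ ![⁅VForm.toAlt 1 U ![v 1], v 0⁆]
        + ρ ![VForm.toAlt 1 U ![⁅v 0, v 1⁆]] := by
  have : lieD 1 1 U ρ v = innerProd 1 1 U (extD 1 ρ) v -
      ((-1) ^ (1 + 1) : ℝ) • extD 1 (innerProd 1 0 U ρ) v := rfl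
  rw [this, innerProd_one_one_apply, extD_one_apply, extD_one_apply, extD_one_apply,
    innerProd_one_zero_apply, innerProd_one_zero_apply, innerProd_one_zero_apply]
  simp only [Matrix.cons_val_zero, Matrix.cons_val_one, even_two, Even.neg_pow, one_pow, one_smul,
    Nat.reduceAdd]
  abel

/-- With X the field of Θ, the right-hand side is U[X, Y] - [X, UY] applied to f, for Y = v 0: the
differential of a field is minus the Lie derivative of U along it. -/
theorem delta_zero_apply (U : X.VForm 1) (Θ : X.VForm 0) (f : X.Fn) (v : Fin 1 → X.Field) :
    delta U 0 Θ f v = VForm.toAlt 1 U v (VForm.toAlt 0 Θ ![] f) -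
      VForm.toAlt 0 Θ ![] (VForm.toAlt 1 U v f) +
      VForm.toAlt 1 U ![⁅VForm.toAlt 0 Θ ![], v 0⁆] f := by
  have : delta U 0 Θ f v = lieD 1 0 U (Θ f).1 v - ((-1) ^ (1 * 0) : ℝ) • lieD 0 1 Θ (U f).1 v := rfl
  rw [this, lieD_one_zero_apply, lieD_zero_one_apply, vec_eq_of_fin_one v]
  simp only [mul_zero, pow_zero, one_smul]
  rw [sub_add]
  rfl

/-- On one-forms the bracket of two form-valued derivations is symmetric. -/
theorem fnBracket_one_one_apply (U Ω : X.VForm 1) (f : X.Fn) :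
    fnBracket 1 1 U Ω f = lieD 1 1 U (Ω f).1 + lieD 1 1 Ω (U f).1 := by
  have : fnBracket 1 1 U Ω f = lieD 1 1 U (Ω f).1 - ((-1) ^ (1 * 1) : ℝ) • lieD 1 1 Ω (U f).1 := rfl
  rw [this]
  simp only [mul_one, pow_one, neg_smul, one_smul, sub_neg_eq_add]

end LowDegree
end DSpace

/-! ### Local frames and the splitting defined by a flat connection -/

/-- Around each point there are finitely many functions and vector fields which expand all tangent
vectors as local coordinates and coordinate fields do. -/
def DSpace.HasFrames (M : DSpace.{u}) : Prop :=
  ∀ x₀ : M, ∃ (h : M.Fn) (m : ℕ) (a : Fin m → M.Fn) (Z : Fin m → M.Field), h.1 x₀ ≠ 0 ∧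
    ∀ x, h.1 x ≠ 0 → ∀ ζ, DSpace.IsTangentAt x ζ → ∀ f, ζ f = ∑ i, ζ (a i) * (Z i f).1 x

namespace FlatConnection

open DSpace

variable {W : DSpace.{v}} {M : DSpace.{u}} {ξ : SMap W M} (C : FlatConnection ξ)

theorem toFun_sum {ι : Type*} (s : Finset ι) (Z : ι → M.Field) :
    C.toFun (∑ i ∈ s, Z i) = ∑ i ∈ s, C.toFun (Z i) :=
  map_sum (AddMonoidHom.mk' C.toFun C.map_add) Z s

theorem val_sum_field {X : DSpace.{w}} {ι : Type*} (s : Finset ι) (V : ι → X.Field) (f : X.Fn) (x : X) :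
    ((∑ i ∈ s, V i) f).1 x = ∑ i ∈ s, (V i f).1 x := by
  have e : (∑ i ∈ s, V i) f = ∑ i ∈ s, V i f :=
    map_sum ((Pi.evalAddMonoidHom _ f).comp Derivation.coeFnAddMonoidHom) V s
  rw [e, Fn.val_sum]

/-- The lift of a field in terms of the lifts of a local frame. -/
theorem toFun_frame {h : M.Fn} {m : ℕ} {a : Fin m → M.Fn} {Z : Fin m → M.Field}
    (H : ∀ x, h.1 x ≠ 0 → ∀ ζ, IsTangentAt x ζ → ∀ f, ζ f = ∑ i, ζ (a i) * (Z i f).1 x)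
    (D : M.Field) (y : W) (hy : h.1 (ξ y) ≠ 0) (f : W.Fn) :
    (C.toFun D f).1 y = ∑ i, (D (a i)).1 (ξ y) * (C.toFun (Z i) f).1 y := by
  -- After multiplication by h the frame expansion holds on all of M, so linearity of the lift over
  -- functions applies; h is cancelled at the end.
  have e : h • D = ∑ i, (h * D (a i)) • Z i := by
    ext g
    refine Fn.ext fun x => ?_
    rw [val_sum_field]
    by_cases hx : h.1 x = 0
    · simp [hx]
    · have := H x hx _ (isTangentAt_value D x) g
      change (D g).1 x = ∑ i, (D (a i)).1 x * _ at this
      simp [this, Finset.mul_sum, mul_assoc]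
  have e' := congrArg (fun V => (V f).1 y) (congrArg C.toFun e)
  simp only [C.toFun_sum, C.map_smul, val_sum_field, Derivation.smul_apply, Fn.val_smul_fn] at e'
  have hp : ∀ g : M.Fn, (ξ.pullback g).1 y = g.1 (ξ y) := fun _ => rfl
  simp only [hp, Fn.val_mul, mul_assoc, ← Finset.mul_sum] at e'
  exact mul_left_cancel₀ hy e'

theorem val_lift (Z : M.Field) (g : M.Fn) (y : W) :
    (C.toFun Z (ξ.pullback g)).1 y = (Z g).1 (ξ y) := by rw [C.lift]; rfl

theorem toFun_mem_horizontal (Z : M.Field) : C.toFun Z ∈ C.horizontal := fun _ => ⟨Z, rfl⟩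

/-- A horizontal field in terms of the lifts of a local frame. -/
theorem horizontal_frame {h : M.Fn} {m : ℕ} {a : Fin m → M.Fn} {Z : Fin m → M.Field}
    (H : ∀ x, h.1 x ≠ 0 → ∀ ζ, IsTangentAt x ζ → ∀ f, ζ f = ∑ i, ζ (a i) * (Z i f).1 x)
    {V : W.Field} (hV : V ∈ C.horizontal) (y : W) (hy : h.1 (ξ y) ≠ 0) (f : W.Fn) :
    (V f).1 y = ∑ i, (V (ξ.pullback (a i))).1 y * (C.toFun (Z i) f).1 y := by
  obtain ⟨D, hD⟩ := hV y
  have hD' : ∀ f, (V f).1 y = (C.toFun D f).1 y := fun f => LinearMap.congr_fun hD f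
  rw [hD', C.toFun_frame H D y hy]
  exact Finset.sum_congr rfl fun i _ => by rw [hD', val_lift]

/-- The frame coefficients of a horizontal field are its derivatives of pulled back functions, and a
vertical field annihilates these. -/
theorem eq_zero_of_horizontal_of_vertical (hM : M.HasFrames) {V : W.Field} (hV : V ∈ C.horizontal)
    (hV' : V ∈ verticalFields ξ) : V = 0 := by
  ext f
  refine Fn.ext fun y => ?_
  obtain ⟨k, m, a, F, hk, H⟩ := hM (ξ y)
  rw [C.horizontal_frame H hV y hk]
  exact Finset.sum_eq_zero fun i _ => by rw [hV' (a i), Fn.val_zero, zero_mul]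

/-- The horizontal fields as a submodule. -/
def horizontalSubmodule : Submodule W.Fn W.Field where
  carrier := C.horizontal
  zero_mem' y := ⟨0, by
    have : C.toFun 0 = 0 := (AddMonoidHom.mk' C.toFun C.map_add).map_zero
    rw [this]⟩
  add_mem' {V V'} hV hV' y := by
    obtain ⟨Z, hZ⟩ := hV y
    obtain ⟨Z', hZ'⟩ := hV' y
    refine ⟨Z + Z', ?_⟩
    have e : value (V + V') y = value V y + value V' y := rfl
    rw [e, hZ, hZ', C.map_add]; rfl
  smul_mem' g V hV y := by
    obtain ⟨Z, hZ⟩ := hV y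
    refine ⟨algebraMap ℝ M.Fn (g.1 y) • Z, ?_⟩
    have e : value (g • V) y = g.1 y • value V y := rfl
    rw [e, hZ, C.map_smul]; rfl

/-- The vertical fields as a submodule. -/
def verticalSubmodule (ξ : SMap W M) : Submodule W.Fn W.Field where
  carrier := verticalFields ξ
  zero_mem' := zero_mem (verticalFields ξ)
  add_mem' := add_mem (S := Submodule ℝ W.Field)
  smul_mem' g V hV f := by rw [Derivation.smul_apply, hV f, smul_zero]

theorem exists_field_eq (hM : M.HasFrames) (V : W.Field) (y : W) :
    ∃ Z : M.Field, ∀ g, (V (ξ.pullback g)).1 y = (Z g).1 (ξ y) := by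
  obtain ⟨k, m, a, F, hk, H⟩ := hM (ξ y)
  refine ⟨∑ i, algebraMap ℝ M.Fn ((V (ξ.pullback (a i))).1 y) • F i, fun g => ?_⟩
  have := H (ξ y) hk _ ((isTangentAt_value V y).push ξ) g
  rw [val_sum_field]
  exact this

/-- At each y one picks Z y on M whose value at ξ y is the image of the value of V, and lifts it.
The choices need not vary smoothly: in a frame the lift has the coefficients V(ξ^*aᵢ), which are
smooth. -/
theorem exists_horizontal_part (hM : M.HasFrames) (V : W.Field) :
    ∃ H ∈ C.horizontal, V - H ∈ verticalFields ξ := by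
  choose Z hZ using exists_field_eq (ξ := ξ) hM V
  have hs : ∀ f : W.Fn, W.IsSmooth fun y => (C.toFun (Z y) f).1 y := fun f =>
    isSmooth_of_smoothAt fun y => by
      obtain ⟨k, m, a, F, hk, H⟩ := hM (ξ y)
      refine ⟨ξ.pullback k, ∑ i, V (ξ.pullback (a i)) * C.toFun (F i) f, hk, fun z hz => ?_⟩
      refine (C.toFun_frame H _ z hz f).trans ?_
      rw [Fn.val_sum]
      exact Finset.sum_congr rfl fun i _ => by rw [Fn.val_mul, hZ]
  let Hor : W.Field := Derivation.mk'
    { toFun := fun f => ⟨_, hs f⟩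
      map_add' := fun f g => Fn.ext fun y => by
        change (C.toFun (Z y) (f + g)).1 y = _
        rw [_root_.map_add]; rfl
      map_smul' := fun c f => Fn.ext fun y => by
        change (C.toFun (Z y) (c • f)).1 y = _
        rw [Derivation.map_smul]; rfl }
    fun f g => Fn.ext fun y => by
      change (C.toFun (Z y) (f * g)).1 y = _
      rw [Derivation.leibniz]; rfl
  refine ⟨Hor, fun y => ⟨Z y, rfl⟩, fun g => Fn.ext fun y => ?_⟩
  rw [Derivation.sub_apply, Fn.val_sub, hZ]
  change _ - (C.toFun (Z y) (ξ.pullback g)).1 y = 0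
  rw [val_lift, sub_self]

theorem isCompl_vertical_horizontal (hM : M.HasFrames) :
    IsCompl (verticalSubmodule ξ) C.horizontalSubmodule := by
  refine ⟨Submodule.disjoint_def.2 fun V hV hV' =>
    C.eq_zero_of_horizontal_of_vertical hM hV' hV, codisjoint_iff.2 (eq_top_iff.2 fun V _ => ?_)⟩
  obtain ⟨H, hH, hV⟩ := C.exists_horizontal_part hM V
  exact Submodule.mem_sup.2 ⟨V - H, hV, H, hH, sub_add_cancel V H⟩

/-- The vertical part of a field. -/
def verticalPart (hM : M.HasFrames) : W.Field →ₗ[W.Fn] W.Field :=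
  (verticalSubmodule ξ).subtype ∘ₗ
    Submodule.projectionOnto _ _ (C.isCompl_vertical_horizontal hM)

theorem verticalPart_of_vertical (hM : M.HasFrames) {V : W.Field} (hV : V ∈ verticalFields ξ) :
    C.verticalPart hM V = V :=
  congrArg Subtype.val (Submodule.projectionOnto_apply_left (C.isCompl_vertical_horizontal hM)
    (⟨V, hV⟩ : verticalSubmodule ξ))

theorem verticalPart_of_horizontal (hM : M.HasFrames) {V : W.Field} (hV : V ∈ C.horizontal) :
    C.verticalPart hM V = 0 :=
  congrArg Subtype.val (Submodule.projectionOnto_apply_right (C.isCompl_vertical_horizontal hM)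
    (⟨V, hV⟩ : C.horizontalSubmodule))

theorem verticalPart_mem (hM : M.HasFrames) (V : W.Field) : C.verticalPart hM V ∈ verticalFields ξ :=
  (Submodule.projectionOnto _ _ (C.isCompl_vertical_horizontal hM) V).2

theorem sub_verticalPart_mem (hM : M.HasFrames) (V : W.Field) :
    V - C.verticalPart hM V ∈ C.horizontal := by
  obtain ⟨H, hH, hV⟩ := C.exists_horizontal_part hM V
  have : C.verticalPart hM V = V - H := by
    conv_lhs => rw [← sub_add_cancel V H]
    rw [_root_.map_add, C.verticalPart_of_horizontal hM hH, add_zero, C.verticalPart_of_vertical hM hV]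
  rw [this, sub_sub_cancel]
  exact hH

/-- This is the local formula U(f) = df - ∑ C(Zᵢ)(f) d(ξ^*aᵢ), which shows that the projection is
given by genuine differential forms. -/
theorem verticalPart_frame (hM : M.HasFrames) {h : M.Fn} {m : ℕ} {a : Fin m → M.Fn} {Z : Fin m → M.Field}
    (H : ∀ x, h.1 x ≠ 0 → ∀ ζ, IsTangentAt x ζ → ∀ f, ζ f = ∑ i, ζ (a i) * (Z i f).1 x)
    (V : W.Field) (y : W) (hy : h.1 (ξ y) ≠ 0) (f : W.Fn) :
    (C.verticalPart hM V f).1 y =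
      (V f).1 y - ∑ i, (V (ξ.pullback (a i))).1 y * (C.toFun (Z i) f).1 y := by
  have := C.horizontal_frame H (C.sub_verticalPart_mem hM V) y hy f
  have e : ∀ g, ((V - C.verticalPart hM V) g).1 y = (V g).1 y - (C.verticalPart hM V g).1 y := fun _ => rfl
  simp only [e] at this
  have e' : ∀ i, (C.verticalPart hM V (ξ.pullback (a i))).1 y = 0 := fun i => by
    rw [C.verticalPart_mem hM V (a i)]; rfl
  simp only [e', sub_zero] at this
  rw [← this]; ring

/-- The connection form of a flat connection. -/
def connectionForm (hM : M.HasFrames) : W.VForm 1 := Derivation.mk'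
  { toFun := fun f => (⟨AlternatingMap.ofSubsingleton ℝ W.Field W.Fn (0 : Fin 1)
        { toFun := fun V => C.verticalPart hM V f
          map_add' := fun V V' => by rw [_root_.map_add]; rfl
          map_smul' := fun c V => by
            have : c • V = algebraMap ℝ W.Fn c • V := by rw [algebraMap_smul]
            rw [this, _root_.map_smul, algebraMap_smul]; rfl }, fun y => by
        obtain ⟨k, m, a, F, hk, H⟩ := hM (ξ y)
        -- The index `none` carries the term df, the others carry -C(Fᵢ)(f) d(ξ^*aᵢ).
        refine ⟨ξ.pullback k, hk, Option (Fin m), inferInstance,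
          fun o => o.elim 1 fun i => -C.toFun (F i) f,
          fun o _ => o.elim f fun i => ξ.pullback (a i), fun z hz V => ?_⟩
        refine (C.verticalPart_frame hM H (V 0) z hz f).trans ?_
        rw [Fintype.sum_option]
        simp only [Matrix.det_fin_one, Matrix.of_apply, Option.elim, Fn.val_one, one_mul, Fn.val_neg,
          neg_mul, Finset.sum_neg_distrib, sub_eq_add_neg]
        congr 2
        exact Finset.sum_congr rfl fun i _ => mul_comm _ _⟩ : W.Form 1)
    map_add' := fun f g => by
      ext V : 2
      exact _root_.map_add (C.verticalPart hM (V 0)) f g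
    map_smul' := fun c f => by
      ext V : 2
      exact Derivation.map_smul (C.verticalPart hM (V 0)) c f }
  fun f g => by
    ext V : 2
    exact Derivation.leibniz (C.verticalPart hM (V 0)) f g

theorem connectionForm_apply (hM : M.HasFrames) (f : W.Fn) (V : W.Field) :
    (C.connectionForm hM f).1 ![V] = C.verticalPart hM V f := rfl

theorem isStructuralElement_connectionForm (hM : M.HasFrames) :
    C.IsStructuralElement (C.connectionForm hM) :=
  ⟨fun f V hV => by rw [connectionForm_apply, C.verticalPart_of_horizontal hM hV]; rfl,
    fun f V hV => by rw [connectionForm_apply, C.verticalPart_of_vertical hM hV]⟩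

/-- Splitting V into vertical and horizontal parts leaves no freedom for U, whence its uniqueness.
-/
theorem IsStructuralElement.apply_eq {C : FlatConnection ξ} {U : W.VForm 1} (hU : C.IsStructuralElement U)
    (hM : M.HasFrames) (V : W.Field) : VForm.toAlt 1 U ![V] = C.verticalPart hM V := by
  ext f : 1
  change (U f).1 ![V] = _
  have e : (U f).1 ![V] = (U f).1 ![V - C.verticalPart hM V] + (U f).1 ![C.verticalPart hM V] := by
    rw [← AlternatingMap.map_vecCons_add, sub_add_cancel]
  rw [e, hU.1 f _ (C.sub_verticalPart_mem hM V), hU.2 f _ (C.verticalPart_mem hM V), zero_add]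

theorem existsUnique_isStructuralElement (hM : M.HasFrames) :
    ∃! U : W.VForm 1, C.IsStructuralElement U := by
  refine ⟨C.connectionForm hM, C.isStructuralElement_connectionForm hM, fun U hU => ?_⟩
  ext f V : 3
  rw [vec_eq_of_fin_one V]
  exact DFunLike.congr_fun (hU.apply_eq hM (V 0)) f

end FlatConnection

/-! ### Brackets with horizontal fields and closedness with respect to the connection form -/

namespace FlatConnection

open DSpace

section Brackets

variable {W : DSpace.{v}} {M : DSpace.{u}} {ξ : SMap W M} (C : FlatConnection ξ)

theorem val_bracket {X : DSpace.{w}} (V V' : X.Field) (f : X.Fn) (x : X) :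
    (⁅V, V'⁆ f).1 x = (V (V' f)).1 x - (V' (V f)).1 x := by
  rw [Derivation.commutator_apply]; rfl

/-- The bracket with a horizontal field in terms of a local frame. -/
theorem bracket_horizontal_frame {h : M.Fn} {m : ℕ} {a : Fin m → M.Fn} {Z : Fin m → M.Field}
    (H : ∀ x, h.1 x ≠ 0 → ∀ ζ, IsTangentAt x ζ → ∀ f, ζ f = ∑ i, ζ (a i) * (Z i f).1 x)
    (T : W.Field) {Y : W.Field} (hY : Y ∈ C.horizontal) (y : W) (hy : h.1 (ξ y) ≠ 0) (f : W.Fn) :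
    (⁅T, Y⁆ f).1 y = ∑ i, ((T (Y (ξ.pullback (a i)))).1 y * (C.toFun (Z i) f).1 y +
      (Y (ξ.pullback (a i))).1 y * (⁅T, C.toFun (Z i)⁆ f).1 y) := by
  have e1 : (T (Y f)).1 y = ∑ i, ((Y (ξ.pullback (a i))).1 y * (T (C.toFun (Z i) f)).1 y +
      (C.toFun (Z i) f).1 y * (T (Y (ξ.pullback (a i)))).1 y) := by
    have h1 := (isTangentAt_value T y).congr_of_eq (f := Y f)
      (g := ∑ i, Y (ξ.pullback (a i)) * C.toFun (Z i) f) (ξ.pullback h) hy fun z hz => by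
        rw [Fn.val_sum]; exact C.horizontal_frame H hY z hz f
    exact h1.trans ((isTangentAt_value T y).map_sum_mul _ _ _)
  rw [val_bracket, e1, C.horizontal_frame H hY y hy (T f), ← Finset.sum_sub_distrib]
  refine Finset.sum_congr rfl fun i _ => ?_
  rw [val_bracket]; ring

/-- By the Leibniz rule, [T, ∑ cᵢC(Fᵢ)] = ∑ (T(cᵢ)C(Fᵢ) + cᵢ[T, C(Fᵢ)]), so lifts suffice as test
fields. Being horizontal is a pointwise condition, so the coefficients may be frozen at y. -/
theorem bracket_mem_horizontal_of (hM : M.HasFrames) {T : W.Field}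
    (hT : ∀ Z, ⁅T, C.toFun Z⁆ ∈ C.horizontal) {Y : W.Field} (hY : Y ∈ C.horizontal) :
    ⁅T, Y⁆ ∈ C.horizontal := fun y => by
  obtain ⟨k, m, a, F, hk, H⟩ := hM (ξ y)
  choose D hD using fun i => hT (F i) y
  refine ⟨∑ i, (algebraMap ℝ M.Fn ((T (Y (ξ.pullback (a i)))).1 y) • F i +
    algebraMap ℝ M.Fn ((Y (ξ.pullback (a i))).1 y) • D i), LinearMap.ext fun f => ?_⟩
  refine (C.bracket_horizontal_frame H T hY y hk f).trans ?_
  change _ = (C.toFun (∑ i, _) f).1 y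
  rw [C.toFun_sum, val_sum_field]
  refine Finset.sum_congr rfl fun i _ => ?_
  rw [C.map_add, C.map_smul, C.map_smul, Derivation.add_apply, Derivation.smul_apply,
    Derivation.smul_apply, Fn.val_add]
  exact congrArg₂ _ rfl (congrArg _ (LinearMap.congr_fun (hD i) f))

/-- The horizontal distribution of a flat connection is involutive. -/
theorem bracket_mem_horizontal (hM : M.HasFrames) {X Y : W.Field} (hX : X ∈ C.horizontal)
    (hY : Y ∈ C.horizontal) : ⁅X, Y⁆ ∈ C.horizontal := by
  -- Each argument in turn is reduced to a lift, with skew-symmetry exchanging the two; the bracket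
  -- of two lifts is a lift by flatness.
  refine C.bracket_mem_horizontal_of hM (fun Z => ?_) hY
  rw [← lie_skew]
  refine C.horizontalSubmodule.neg_mem (C.bracket_mem_horizontal_of hM (fun Z' => ?_) hX)
  rw [← C.flat]
  exact C.toFun_mem_horizontal _

theorem bracket_mem_vertical {V V' : W.Field} (hV : V ∈ verticalFields ξ) (hV' : V' ∈ verticalFields ξ) :
    ⁅V, V'⁆ ∈ verticalFields ξ := fun f => by
  rw [Derivation.commutator_apply, hV f, hV' f, map_zero, map_zero, sub_zero]

/-- Lifts are projectable: they map functions from M to functions from M. For a general horizontal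
field the bracket need not be vertical. -/
theorem bracket_lift_mem_vertical {V : W.Field} (hV : V ∈ verticalFields ξ) (Z : M.Field) :
    ⁅V, C.toFun Z⁆ ∈ verticalFields ξ := fun f => by
  rw [Derivation.commutator_apply, hV f, C.lift, hV (Z f), map_zero, sub_zero]

/-- If the brackets of a vertical field `V` with the lifts annihilate `f`, then so do the vertical parts
of its brackets with horizontal fields. -/
theorem verticalPart_bracket_apply (hM : M.HasFrames) {V : W.Field} (hV : V ∈ verticalFields ξ)
    {f : W.Fn} (hf : ∀ Z, ⁅V, C.toFun Z⁆ f = 0) {Y : W.Field} (hY : Y ∈ C.horizontal) :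
    C.verticalPart hM ⁅V, Y⁆ f = 0 := Fn.ext fun y => by
  obtain ⟨k, m, a, F, hk, H⟩ := hM (ξ y)
  rw [C.verticalPart_frame hM H _ y hk, C.bracket_horizontal_frame H V hY y hk,
    ← Finset.sum_sub_distrib]
  refine Finset.sum_eq_zero fun i _ => ?_
  -- As V is vertical, [V, Y](aᵢ) = V(Y(aᵢ)), so taking the vertical part removes exactly the terms
  -- where V differentiates the coefficients of Y.
  rw [hf, val_bracket, hV (a i), map_zero, Fn.val_zero]
  ring

end Brackets

section Structural

variable {W : DSpace.{v}} {M : DSpace.{u}} {ξ : SMap W M} {C : FlatConnection ξ}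
  {U : W.VForm 1}

theorem IsStructuralElement.delta_ofField_apply (hU : C.IsStructuralElement U) (hM : M.HasFrames)
    (V : W.Field) (f : W.Fn) (v : Fin 1 → W.Field) :
    delta U 0 (ofField V) f v = C.verticalPart hM ⁅V, v 0⁆ f - ⁅V, C.verticalPart hM (v 0)⁆ f := by
  have e : VForm.toAlt 0 (ofField V) ![] = V := rfl
  rw [delta_zero_apply, e, hU.apply_eq hM, vec_eq_of_fin_one v, hU.apply_eq hM,
    Derivation.commutator_apply]
  simp only [Matrix.cons_val_zero]
  abel

/-- For Y = C(Z) the expression P[V, Y] - [V, PY] reduces to [V, C(Z)]; for vertical Y it is zero,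
and a horizontal Y is controlled by the lifts. The equivalence is stated for one f at a time because
gauge symmetries test all functions on W, shadows only those from the base of τ. -/
theorem IsStructuralElement.delta_ofField_eq_zero_iff (hU : C.IsStructuralElement U) (hM : M.HasFrames)
    {V : W.Field} (hV : V ∈ verticalFields ξ) (f : W.Fn) :
    delta U 0 (ofField V) f = 0 ↔ ∀ Z, ⁅V, C.toFun Z⁆ f = 0 := by
  refine ⟨fun h Z => ?_, fun h => ?_⟩
  · have := DFunLike.congr_fun h ![C.toFun Z]
    rw [hU.delta_ofField_apply hM] at this
    simp only [Matrix.cons_val_zero] at this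
    rw [C.verticalPart_of_vertical hM (C.bracket_lift_mem_vertical hV Z),
      C.verticalPart_of_horizontal hM (C.toFun_mem_horizontal Z), lie_zero] at this
    simpa using this
  · ext v : 1
    rw [hU.delta_ofField_apply hM]
    have e := C.verticalPart_bracket_apply hM hV h (C.sub_verticalPart_mem hM (v 0))
    rw [lie_sub, _root_.map_sub, C.verticalPart_of_vertical hM
      (bracket_mem_vertical hV (C.verticalPart_mem hM (v 0)))] at e
    exact e

/-- The connection form of a flat connection is integrable. -/
theorem IsStructuralElement.fnBracket_self (hU : C.IsStructuralElement U) (hM : M.HasFrames) :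
    fnBracket 1 1 U U = 0 := by
  ext f v : 2
  have key : lieD 1 1 U (U f).1 v = 0 := by
    have e : ∀ Y, (U f).1 ![Y] = C.verticalPart hM Y f := fun Y =>
      DFunLike.congr_fun (hU.apply_eq hM Y) f
    rw [lieD_one_one_apply]
    simp only [e, hU.apply_eq hM]
    rw [C.verticalPart_of_vertical hM (C.verticalPart_mem hM ⁅v 0, v 1⁆)]
    generalize v 0 = X
    generalize v 1 = Y
    have hX := C.sub_verticalPart_mem hM X
    have hY := C.sub_verticalPart_mem hM Y
    have hPX := C.verticalPart_mem hM X
    have hPY := C.verticalPart_mem hM Y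
    set PX := C.verticalPart hM X
    set PY := C.verticalPart hM Y
    -- Flatness enters here: P[X - PX, Y - PY] = 0 expands to P[X, Y] - P[X, PY] - P[PX, Y] + [PX,
    -- PY] = 0, the combination that makes up L_U(U(f)).
    have h1 := C.verticalPart_of_horizontal hM (C.bracket_mem_horizontal hM hX hY)
    have h2 := C.verticalPart_of_vertical hM (bracket_mem_vertical hPX hPY)
    have h3 : C.verticalPart hM ⁅PY, X⁆ = -C.verticalPart hM ⁅X, PY⁆ := by
      rw [← lie_skew, _root_.map_neg]
    simp only [lie_sub, sub_lie, _root_.map_sub, h2] at h1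
    have h4 : ⁅PX, PY⁆ f = PX (PY f) - PY (PX f) := Derivation.commutator_apply _
    have h5 := DFunLike.congr_fun h1 f
    simp only [Derivation.sub_apply, Derivation.zero_apply, h4] at h5
    rw [h3, Derivation.neg_apply, ← h5]
    abel
  rw [fnBracket_one_one_apply, AlternatingMap.add_apply, key, add_zero]
  rfl

end Structural

end FlatConnection

/-! ### Gauge symmetries and infinitesimal deformations -/

section Gauge

open DSpace

theorem ofField_mem_vertical {W : DSpace.{v}} {B : DSpace.{w}} {p : SMap W B} {V : W.Field} :
    ofField V ∈ vertical p 0 ↔ V ∈ verticalFields p := by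
  refine forall_congr' fun f => ⟨fun h => ?_, fun h => ?_⟩
  · exact congrArg (fun ρ : W.Form 0 => ρ.1 ![]) h
  · ext v
    exact h

variable {M : DSpace.{u}} {B : DSpace.{v}} {W : DSpace.{w}} {p : SMap B M} {τ : SMap W B}

theorem verticalFields_le_comp : verticalFields τ ≤ verticalFields (p.comp τ) :=
  fun _ hV f => hV (p.pullback f)

/-- Closedness means that V commutes with all lifts. Conversely, if V preserves the horizontal
distribution, [V, C(Z)] is both horizontal and vertical, hence zero. -/
theorem mem_gaugeCocycles_zero_iff {C : FlatConnection (p.comp τ)} {U : W.VForm 1}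
    (hU : C.IsStructuralElement U) (hM : M.HasFrames) (V : W.Field) :
    ofField V ∈ gaugeCocycles τ U 0 ↔ IsNonlocalSymmetry C V ∧ V ∈ verticalFields τ := by
  have hd : V ∈ verticalFields (p.comp τ) →
      (ofField V ∈ LinearMap.ker (delta U 0) ↔ ∀ Y ∈ C.horizontal, ⁅V, Y⁆ ∈ C.horizontal) := fun hV => by
    rw [LinearMap.mem_ker]
    refine ⟨fun h Y hY => C.bracket_mem_horizontal_of hM (fun Z => ?_) hY, fun h => ?_⟩
    · have : ⁅V, C.toFun Z⁆ = 0 := by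
        ext f : 1
        exact (hU.delta_ofField_eq_zero_iff hM hV f).1 (DFunLike.congr_fun h f) Z
      rw [this]
      exact C.horizontalSubmodule.zero_mem
    · ext f : 1
      refine (hU.delta_ofField_eq_zero_iff hM hV f).2 fun Z => ?_
      rw [C.eq_zero_of_horizontal_of_vertical hM (h _ (C.toFun_mem_horizontal Z))
        (C.bracket_lift_mem_vertical hV Z)]
      rfl
  rw [gaugeCocycles, Submodule.mem_inf, ofField_mem_vertical]
  exact ⟨fun h => ⟨⟨verticalFields_le_comp h.1, (hd (verticalFields_le_comp h.1)).1 h.2⟩, h.1⟩,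
    fun h => ⟨h.2, (hd h.1.1).2 h.1.2⟩⟩

theorem fnBracket_one_one_comm (U Ω : W.VForm 1) : fnBracket 1 1 U Ω = fnBracket 1 1 Ω U := by
  ext f : 1
  exact (fnBracket_one_one_apply U Ω f).trans
    ((add_comm _ _).trans (fnBracket_one_one_apply Ω U f).symm)

theorem fnBracket_add_smul_self (U Ω : W.VForm 1) (c : ℝ) :
    fnBracket 1 1 (U + c • Ω) (U + c • Ω) = fnBracket 1 1 U U + (2 * c) • fnBracket 1 1 U Ω +
      c ^ 2 • fnBracket 1 1 Ω Ω := by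
  have e : fnBracket 1 1 (U + c • Ω) U = fnBracket 1 1 U U + c • fnBracket 1 1 U Ω := by
    rw [fnBracket_one_one_comm, map_add, map_smul]
  have e' : fnBracket 1 1 (U + c • Ω) Ω = fnBracket 1 1 U Ω + c • fnBracket 1 1 Ω Ω := by
    rw [fnBracket_one_one_comm, map_add, map_smul, fnBracket_one_one_comm Ω U]
  rw [map_add, map_smul, e, e']
  module

namespace InfDeformation

variable {U : W.VForm 1}

theorem mem_gaugeCocycles (D : InfDeformation τ U) : D.Ω ∈ gaugeCocycles τ U 1 := by
  refine ⟨fun f => ?_, ?_⟩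
  · have := D.base 1 f
    rw [Derivation.add_apply, one_smul] at this
    exact left_eq_add.1 this.symm
  · change fnBracket 1 1 U D.Ω = 0
    obtain ⟨R, hR⟩ := D.integrable
    have h0 := hR 0
    have h1 := hR 1
    have h2 := hR (-1)
    simp only [fnBracket_add_smul_self] at h0 h1 h2
    -- t²R takes the same value at t = 1 and t = -1; the difference of the two expansions is 4[[U,
    -- Ω]].
    have h3 := h1.trans ((by norm_num : (1 : ℝ) ^ 2 • R = (-1 : ℝ) ^ 2 • R).trans h2.symm)
    have h4 : (4 : ℝ) • fnBracket 1 1 U D.Ω = 0 := by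
      have := sub_eq_zero.2 h3
      rw [← this]
      module
    exact (smul_eq_zero.1 h4).resolve_left (by norm_num)

/-- With the constant and linear terms gone, the remainder is exactly t²[[Ω, Ω]]. -/
theorem exists_of_mem_gaugeCocycles (hUU : fnBracket 1 1 U U = 0) {Ω : W.VForm 1}
    (hΩ : Ω ∈ gaugeCocycles τ U 1) : ∃ D : InfDeformation τ U, D.Ω = Ω := by
  have h : fnBracket 1 1 U Ω = 0 := hΩ.2
  refine ⟨⟨Ω, ⟨fnBracket 1 1 Ω Ω, fun t => ?_⟩, fun t f => ?_⟩, rfl⟩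
  · rw [fnBracket_add_smul_self, hUU, h, smul_zero, zero_add, zero_add]
  · rw [Derivation.add_apply, Derivation.smul_apply, hΩ.1 f, smul_zero, add_zero]

/-- The defect of equivalence is a polynomial in t without constant term, with linear coefficient
Ω(f) - Ω'(f) - (∂_U V)(f). Comparing t = 1 and t = -1 isolates this coefficient. -/
theorem equiv_iff (D D' : InfDeformation τ U) :
    InfDeformation.Equiv τ D D' ↔ D.Ω - D'.Ω ∈ gaugeCoboundaries τ U 0 := by
  have key : ∀ (V : W.Field) (f : W.Fn),
      (∃ R : W.Alt 1, ∀ t : ℝ,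
        (((U + t • D.Ω) f).1 + t • lieD 0 1 (ofField V) ((U + t • D.Ω) f).1 : W.Alt 1) -
          ((U + t • D'.Ω) (f + t • V f)).1 = t ^ 2 • R) ↔
      ((D.Ω - D'.Ω) f).1 = delta U 0 (ofField V) f := fun V f => by
    have hδ : delta U 0 (ofField V) f = (U (V f)).1 - (lieD 0 1 (ofField V) (U f).1 : W.Alt 1) := by
      ext v : 1
      rw [delta_zero_apply, AlternatingMap.sub_apply, lieD_zero_one_apply, vec_eq_of_fin_one v]
      exact sub_add _ _ _
    have hx : ∀ t : ℝ,
        (((U + t • D.Ω) f).1 + t • lieD 0 1 (ofField V) ((U + t • D.Ω) f).1 : W.Alt 1) -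
          ((U + t • D'.Ω) (f + t • V f)).1 =
        t • (((D.Ω - D'.Ω) f).1 - delta U 0 (ofField V) f) +
          t ^ 2 • ((lieD 0 1 (ofField V) (D.Ω f).1 : W.Alt 1) - (D'.Ω (V f)).1) := fun t => by
      have e1 : ((U + t • D.Ω) f).1 = (U f).1 + t • (D.Ω f).1 := rfl
      have e2 : ((U + t • D'.Ω) (f + t • V f)).1 =
          (U f).1 + t • (U (V f)).1 + t • ((D'.Ω f).1 + t • (D'.Ω (V f)).1) := by
        rw [Derivation.add_apply, Derivation.smul_apply, map_add, map_add, Derivation.map_smul,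
          Derivation.map_smul]
        rfl
      have e3 : ((D.Ω - D'.Ω) f).1 = (D.Ω f).1 - (D'.Ω f).1 := rfl
      have e4 : (lieD 0 1 (ofField V) ((U f).1 + t • (D.Ω f).1) : W.Alt 1) =
          (lieD 0 1 (ofField V) (U f).1 : W.Alt 1) + t • (lieD 0 1 (ofField V) (D.Ω f).1 : W.Alt 1) := by
        rw [map_add, map_smul]
      rw [e1, e2, e3, e4, hδ]
      module
    simp only [hx]
    refine ⟨fun ⟨R, hR⟩ => ?_, fun h => ⟨_, fun t => by rw [h, sub_self, smul_zero, zero_add]⟩⟩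
    have h1 := hR 1
    have h2 := hR (-1)
    rw [← sub_eq_zero]
    have h3 := h1.trans ((by norm_num : (1 : ℝ) ^ 2 • R = (-1 : ℝ) ^ 2 • R).trans h2.symm)
    have h4 : (2 : ℝ) • (((D.Ω - D'.Ω) f).1 - delta U 0 (ofField V) f) = 0 := by
      have := sub_eq_zero.2 h3
      rw [← this]
      module
    exact (smul_eq_zero.1 h4).resolve_left (by norm_num)
  refine ⟨fun ⟨V, hV, h⟩ => ⟨ofField V, ofField_mem_vertical.2 hV, fun f => (key V f).1 (h f)⟩,
    fun ⟨Θ, hΘ, h⟩ => ?_⟩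
  obtain ⟨V, rfl⟩ := ofField.surjective Θ
  exact ⟨V, ofField_mem_vertical.1 hΘ, fun f => (key V f).2 (h f)⟩

theorem equivalence_equiv : Equivalence (InfDeformation.Equiv τ (U := U)) where
  refl D := by rw [equiv_iff, sub_self]; exact zero_mem _
  symm {D D'} h := by
    rw [equiv_iff] at h ⊢
    rw [← neg_sub]
    exact neg_mem h
  trans {D D' D''} h h' := by
    rw [equiv_iff] at h h' ⊢
    rw [← sub_add_sub_cancel _ D'.Ω]
    exact add_mem h h'

/-- Classes of infinitesimal deformations are classes of one-cocycles. -/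
theorem exists_quot_equiv (hUU : fnBracket 1 1 U U = 0) :
    ∃ (h : ∀ D : InfDeformation τ U, D.Ω ∈ gaugeCocycles τ U 1)
      (Ψ : Quot (InfDeformation.Equiv τ (U := U)) ≃ GaugeCohomology τ U 0),
      ∀ D : InfDeformation τ U, Ψ (Quot.mk _ D) = Submodule.Quotient.mk ⟨D.Ω, h D⟩ := by
  have hq : ∀ D D' : InfDeformation τ U,
      (Submodule.Quotient.mk ⟨D.Ω, D.mem_gaugeCocycles⟩ : GaugeCohomology τ U 0) =
        Submodule.Quotient.mk ⟨D'.Ω, D'.mem_gaugeCocycles⟩ ↔ InfDeformation.Equiv τ D D' := fun D D' => by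
    rw [Submodule.Quotient.eq, equiv_iff]
    exact Iff.rfl
  let Φ : Quot (InfDeformation.Equiv τ (U := U)) → GaugeCohomology τ U 0 :=
    Quot.lift (fun D => Submodule.Quotient.mk ⟨D.Ω, D.mem_gaugeCocycles⟩) fun D D' h => (hq D D').2 h
  refine ⟨fun D => D.mem_gaugeCocycles, Equiv.ofBijective Φ ⟨?_, fun c => ?_⟩, fun D => rfl⟩
  · rintro ⟨D⟩ ⟨D'⟩ h
    exact Quot.sound ((hq D D').1 h)
  · obtain ⟨⟨Ω, hΩ⟩, rfl⟩ := Submodule.Quotient.mk_surjective _ c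
    obtain ⟨D, rfl⟩ := exists_of_mem_gaugeCocycles hUU hΩ
    exact ⟨Quot.mk _ D, rfl⟩

end InfDeformation

end Gauge

/-! ### Local frames on a manifold -/

section Frames

open DSpace

variable {n : ℕ} {M : Type u} [TopologicalSpace M] [ChartedSpace (EuclideanSpace ℝ (Fin n)) M]
  [IsManifold (𝓡 n) ∞ M]

theorem contDiffOn_comp_extChartAt_symm {φ : M → ℝ} (hφ : ContMDiff (𝓡 n) 𝓘(ℝ, ℝ) ∞ φ) (c : M) :
    ContDiffOn ℝ ∞ (φ ∘ (extChartAt (𝓡 n) c).symm) (extChartAt (𝓡 n) c).target :=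
  (hφ.comp_contMDiffOn (contMDiffOn_extChartAt_symm c)).contDiffOn

/-- A function on a manifold near a point as a smooth function of coordinates. -/
theorem exists_coordinate_expression {c x : M} (hx : x ∈ (chartAt (EuclideanSpace ℝ (Fin n)) c).source)
    {φ : M → ℝ} (hφ : ContMDiff (𝓡 n) 𝓘(ℝ, ℝ) ∞ φ) :
    ∃ g : (Fin n → ℝ) → ℝ, ContDiff ℝ ∞ g ∧
      (∀ᶠ y in nhds x, φ y = g fun i => extChartAt (𝓡 n) c y i) ∧
      ∀ i, fderiv ℝ g (fun i => extChartAt (𝓡 n) c x i) (Pi.single i 1) =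
        fderiv ℝ (φ ∘ (extChartAt (𝓡 n) c).symm) (extChartAt (𝓡 n) c x) (EuclideanSpace.single i 1) := by
  set e := extChartAt (𝓡 n) c
  have hxs : x ∈ e.source := by rwa [extChartAt_source]
  have ht : e.target ∈ nhds (e x) := (isOpen_extChartAt_target c).mem_nhds (e.map_source hxs)
  obtain ⟨r, hr, hrt⟩ := Metric.nhds_basis_closedBall.mem_iff.1 ht
  -- The coordinate expression is smooth only on the chart target; a bump function supported in a
  -- closed ball inside it makes the product smooth everywhere without changing its germ at e x.
  let β : ContDiffBump (e x) := ⟨r / 2, r, half_pos hr, half_lt_self hr⟩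
  have hf : ContDiffOn ℝ ∞ (φ ∘ e.symm) e.target := contDiffOn_comp_extChartAt_symm hφ c
  let G : EuclideanSpace ℝ (Fin n) → ℝ := fun z => β z * (φ ∘ e.symm) z
  have hG : ContDiff ℝ ∞ G := by
    refine contMDiff_iff_contDiff.1 (contMDiff_of_tsupport fun z hz => ContDiffAt.contMDiffAt ?_)
    have hz' : z ∈ e.target := hrt (by
      have := tsupport_mul_subset_left hz
      rwa [β.tsupport_eq] at this)
    exact β.contDiff.contDiffAt.mul (hf.contDiffAt ((isOpen_extChartAt_target c).mem_nhds hz'))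
  have hGe : G =ᶠ[nhds (e x)] φ ∘ e.symm := by
    filter_upwards [β.eventuallyEq_one] with z hz
    simp only [G, hz, Pi.one_apply, one_mul]
  let L := (EuclideanSpace.equiv (Fin n) ℝ).symm
  refine ⟨G ∘ L, hG.comp L.contDiff, ?_, fun i => ?_⟩
  · have hc : ContinuousAt e x := continuousAt_extChartAt' hxs
    filter_upwards [hc.eventually hGe, (isOpen_extChartAt_source c).mem_nhds hxs] with y hy hys
    change _ = G (e y)
    rw [hy, Function.comp_apply, e.left_inv hys]
  · have h1 : HasFDerivAt (G ∘ L) ((fderiv ℝ G (e x)).comp (L : (Fin n → ℝ) →L[ℝ] EuclideanSpace ℝ (Fin n)))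
        (fun i => e x i) :=
      HasFDerivAt.comp (g := G) (f := L) (fun i => e x i)
        (((hG.differentiable (by simp)) (e x)).hasFDerivAt) L.hasFDerivAt
    rw [h1.fderiv, ← hGe.fderiv_eq]
    rfl

variable [T2Space M]

theorem exists_bump {x : M} {s : Set M} (hs : s ∈ nhds x) :
    ∃ k : M → ℝ, ContMDiff (𝓡 n) 𝓘(ℝ, ℝ) ∞ k ∧ k x ≠ 0 ∧ ∀ y, k y ≠ 0 → y ∈ s := by
  obtain ⟨f, hf⟩ := (SmoothBumpFunction.nhds_basis_support (I := 𝓡 n) hs).ex_mem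
  exact ⟨f, f.contMDiff, by rw [f.eq_one]; exact one_ne_zero, fun y hy => hf (subset_tsupport f hy)⟩

/-- The vector field `ρ ∂ᵢ`, for the coordinates of the chart at `c` and a bump function `ρ`. -/
theorem exists_coordinate_field (c : M) (ρ : SmoothBumpFunction (𝓡 n) c) (i : Fin n) :
    ∃ Z : (DSpace.ofManifold n M).Field, ∀ (φ : M → ℝ) (hφ : ContMDiff (𝓡 n) 𝓘(ℝ, ℝ) ∞ φ) (x : M),
      (Z ⟨φ, hφ⟩).1 x =
        ρ x * fderiv ℝ (φ ∘ (extChartAt (𝓡 n) c).symm) (extChartAt (𝓡 n) c x)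
          (EuclideanSpace.single i 1) := by
  set e := extChartAt (𝓡 n) c
  have ht : IsOpen e.target := isOpen_extChartAt_target c
  let d : (M → ℝ) → M → ℝ := fun φ x => fderiv ℝ (φ ∘ e.symm) (e x) (EuclideanSpace.single i 1)
  have hdf : ∀ φ : M → ℝ, ContMDiff (𝓡 n) 𝓘(ℝ, ℝ) ∞ φ → ∀ x : M,
      x ∈ (chartAt (EuclideanSpace ℝ (Fin n)) c).source → DifferentiableAt ℝ (φ ∘ e.symm) (e x) :=
    fun φ hφ x hx => ((contDiffOn_comp_extChartAt_symm hφ c).contDiffAt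
      (ht.mem_nhds (e.map_source (by rwa [extChartAt_source])))).differentiableAt (by simp)
  have hs : ∀ φ : M → ℝ, ContMDiff (𝓡 n) 𝓘(ℝ, ℝ) ∞ φ →
      ContMDiff (𝓡 n) 𝓘(ℝ, ℝ) ∞ fun x => ρ x * d φ x := fun φ hφ => by
    refine ρ.contMDiff_smul (G := ℝ) (g := d φ) ?_
    have h1 : ContDiffOn ℝ ∞ (fun z => fderiv ℝ (φ ∘ e.symm) z (EuclideanSpace.single i 1)) e.target :=
      ((contDiffOn_comp_extChartAt_symm hφ c).fderiv_of_isOpen ht le_rfl).clm_apply contDiffOn_const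
    refine h1.contMDiffOn.comp (contMDiffOn_extChartAt (I := 𝓡 n) (x := c)) fun x hx => e.map_source ?_
    rwa [extChartAt_source]
  -- Off the chart domain ρ vanishes, so the derivation identities need proof only inside it.
  have hρ : ∀ (x : M) (a b : ℝ), (x ∈ (chartAt (EuclideanSpace ℝ (Fin n)) c).source → a = b) →
      ρ x * a = ρ x * b := fun x a b h => by
    by_cases hx : ρ x = 0
    · rw [hx, zero_mul, zero_mul]
    · rw [h (ρ.support_subset_source hx)]
  have hadd : ∀ φ ψ : M → ℝ, ContMDiff (𝓡 n) 𝓘(ℝ, ℝ) ∞ φ → ContMDiff (𝓡 n) 𝓘(ℝ, ℝ) ∞ ψ → ∀ x,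
      ρ x * d (φ + ψ) x = ρ x * d φ x + ρ x * d ψ x := fun φ ψ hφ hψ x => by
    rw [← mul_add]
    refine hρ x _ _ fun hx => ?_
    have e1 : ((φ + ψ) ∘ e.symm) = φ ∘ e.symm + ψ ∘ e.symm := rfl
    simp only [d]
    rw [e1, fderiv_add (hdf φ hφ x hx) (hdf ψ hψ x hx)]; rfl
  have hsmul : ∀ (a : ℝ) (φ : M → ℝ), ContMDiff (𝓡 n) 𝓘(ℝ, ℝ) ∞ φ → ∀ x,
      ρ x * d (a • φ) x = a * (ρ x * d φ x) := fun a φ hφ x => by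
    rw [mul_left_comm]
    refine hρ x _ _ fun hx => ?_
    have e1 : ((a • φ) ∘ e.symm) = a • (φ ∘ e.symm) := rfl
    simp only [d]
    rw [e1, fderiv_const_smul (hdf φ hφ x hx)]; rfl
  have hmul : ∀ φ ψ : M → ℝ, ContMDiff (𝓡 n) 𝓘(ℝ, ℝ) ∞ φ → ContMDiff (𝓡 n) 𝓘(ℝ, ℝ) ∞ ψ → ∀ x,
      ρ x * d (φ * ψ) x = φ x * (ρ x * d ψ x) + ψ x * (ρ x * d φ x) := fun φ ψ hφ hψ x => by
    rw [mul_left_comm, mul_left_comm (ψ x), ← mul_add]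
    refine hρ x _ _ fun hx => ?_
    have e1 : ((φ * ψ) ∘ e.symm) = (φ ∘ e.symm) * (ψ ∘ e.symm) := rfl
    have hx' : e.symm (e x) = x := e.left_inv (by rwa [extChartAt_source])
    simp only [d]
    rw [e1, fderiv_mul (hdf φ hφ x hx) (hdf ψ hψ x hx)]
    simp only [Function.comp_apply, hx']
    rfl
  exact ⟨Derivation.mk'
    { toFun := fun f => ⟨fun x => ρ x * d f.1 x, hs f.1 f.2⟩
      map_add' := fun f g => Fn.ext fun x => hadd f.1 g.1 f.2 g.2 x
      map_smul' := fun a f => Fn.ext fun x => hsmul a f.1 f.2 x }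
    fun f g => Fn.ext fun x => hmul f.1 g.1 f.2 g.2 x, fun φ hφ x => rfl⟩

/-- The frame consists of the cut off coordinates ρxⁱ and the fields ρ∂ᵢ. Where ρ = 1, a function is
locally a smooth function of the coordinates, and the chain rule expands any tangent vector. -/
theorem hasFrames_ofManifold : (DSpace.ofManifold n M).HasFrames := by
  suffices key : ∀ c : M, ∃ (h : M → ℝ) (hh : ContMDiff (𝓡 n) 𝓘(ℝ, ℝ) ∞ h)
      (a : Fin n → (DSpace.ofManifold n M).Fn) (Z : Fin n → (DSpace.ofManifold n M).Field), h c ≠ 0 ∧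
      ∀ x : M, h x ≠ 0 → ∀ ζ, IsTangentAt (X := DSpace.ofManifold n M) x ζ →
        ∀ (φ : M → ℝ) (hφ : ContMDiff (𝓡 n) 𝓘(ℝ, ℝ) ∞ φ),
          ζ ⟨φ, hφ⟩ = ∑ i, ζ (a i) * (Z i ⟨φ, hφ⟩).1 x from fun c => by
    obtain ⟨h, hh, a, Z, hc, H⟩ := key c
    exact ⟨⟨h, hh⟩, n, a, Z, hc, fun x hx ζ hζ f => H x hx ζ hζ f.1 f.2⟩
  intro c
  let e := extChartAt (𝓡 n) c
  obtain ⟨ρ⟩ : Nonempty (SmoothBumpFunction (𝓡 n) c) := inferInstance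
  choose Z hZ using exists_coordinate_field c ρ
  have hcoord : ∀ i : Fin n, ContMDiff (𝓡 n) 𝓘(ℝ, ℝ) ∞ fun x => ρ x * (e x) i := fun i => by
    refine ρ.contMDiff_smul (G := ℝ) (g := fun x => (e x) i) ?_
    have h1 : ContDiff ℝ ∞ fun z : EuclideanSpace ℝ (Fin n) => z i := by fun_prop
    exact h1.contMDiff.comp_contMDiffOn (contMDiffOn_extChartAt (I := 𝓡 n) (x := c))
  -- The support of h consists of points near which ρ is identically one; equality at the point
  -- alone would not suffice for tangent vectors.
  obtain ⟨h, hsm, hc, hh⟩ := exists_bump (n := n) (ρ.eventuallyEq_one.eventually_nhds)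
  refine ⟨h, hsm, fun i => ⟨_, hcoord i⟩, Z, hc, fun x hx ζ hζ φ hφ => ?_⟩
  have h1 : ∀ᶠ y in nhds x, ρ y = 1 := hh x hx
  have hxs : x ∈ (chartAt (EuclideanSpace ℝ (Fin n)) c).source := ρ.support_subset_source (by
    rw [Function.mem_support, h1.self_of_nhds]; exact one_ne_zero)
  obtain ⟨g, hg, hfg, hd⟩ := exists_coordinate_expression hxs hφ
  let a : Fin n → (DSpace.ofManifold n M).Fn := fun i => ⟨_, hcoord i⟩
  let F : (DSpace.ofManifold n M).Fn :=
    ⟨_, (DSpace.ofManifold n M).comp_smooth n g hg (fun i => (a i).1) fun i => (a i).2⟩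
  obtain ⟨k, hksm, hk, hks⟩ := exists_bump (n := n) (hfg.and h1)
  have e1 : ζ ⟨φ, hφ⟩ = ζ F := hζ.congr_of_eq ⟨k, hksm⟩ hk fun y hy => by
    obtain ⟨h2, h3⟩ := hks y hy
    refine h2.trans (congrArg g (funext fun i => ?_))
    change _ = ρ y * (e y) i
    rw [h3, one_mul]
  have hax : (fun i => (a i).1 x) = fun i => e x i := funext fun i => by
    change ρ x * (e x) i = _
    rw [h1.self_of_nhds, one_mul]
  rw [e1, hζ.chain hg a F fun _ => rfl]
  refine Finset.sum_congr rfl fun i _ => ?_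
  rw [hax, hd, hZ, h1.self_of_nhds, one_mul, mul_comm]

end Frames

/-! ### Descent of vector fields along a surjection -/

section Descent

open DSpace

/-- The identity map. -/
def SMap.id (X : DSpace.{u}) : SMap X X where
  toFun x := x
  smooth_comp _ hf := hf

theorem SMap.pullback_injective {X : DSpace.{u}} {Y : DSpace.{v}} {p : SMap X Y}
    (hp : Function.Surjective p) : Function.Injective p.pullback := fun f g h => Fn.ext fun y => by
  obtain ⟨x, rfl⟩ := hp y
  exact congrArg (fun k : X.Fn => k.1 x) h

/-- If a field maps a generating set of functions on the base to functions on the base, then it maps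
all functions on the base to functions on the base. -/
theorem exists_descent {W : DSpace.{w}} {Y : DSpace.{v}} {τ : SMap W Y} (hτ : Function.Surjective τ)
    (V : W.Field) {T : Type u} {S : Set (T → ℝ)} (q : SMap Y (generate S))
    (hS : ∀ f (hf : f ∈ S), ∃ g : Y.Fn,
      V (τ.pullback (q.pullback ⟨f, Gen.base f hf⟩)) = τ.pullback g) (f : (generate S).Fn) :
    ∃ g : Y.Fn, V (τ.pullback (q.pullback f)) = τ.pullback g := by
  suffices key : ∀ f (hf : Gen S f), ∃ g : Y.Fn,
      V (τ.pullback (q.pullback ⟨f, hf⟩)) = τ.pullback g from key f.1 f.2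
  intro f hf
  induction hf with
  | base f hf => exact hS f hf
  | comp m γ hγ f hf ih =>
    choose g hg using ih
    let P : Fin m → Y.Fn := fun i => q.pullback ⟨f i, hf i⟩
    let d : Fin m → Y.Fn := fun i => ⟨_, Y.comp_smooth m (fun z => fderiv ℝ γ z (Pi.single i 1))
      ((hγ.fderiv_right le_rfl).clm_apply contDiff_const) (fun j => (P j).1) fun j => (P j).2⟩
    refine ⟨∑ i, d i * g i, Fn.ext fun y => ?_⟩
    refine ((isTangentAt_value V y).chain hγ (fun i => τ.pullback (P i)) _ fun _ => rfl).trans ?_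
    rw [map_sum, Fn.val_sum]
    refine Finset.sum_congr rfl fun i _ => ?_
    rw [map_mul, Fn.val_mul, ← hg i]
    rfl
  | glue f h g hh hx hg hf ihh ihg =>
    choose k hk using ihg
    -- σ is merely a set-theoretic section; F ∘ σ is nevertheless smooth, since near y₀ it agrees
    -- with the already descended function k (q y₀).
    choose σ hσ using hτ
    have hf' : Gen S f := Gen.glue f h g hh hx hg hf
    let F : W.Fn := V (τ.pullback (q.pullback ⟨f, hf'⟩))
    have key : ∀ (y₀ : Y) (y : W), h (q y₀) (q (τ y)) ≠ 0 → F.1 y = (k (q y₀)).1 (τ y) := fun y₀ y hy => by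
      have h1 := (isTangentAt_value V y).congr_of_eq (f := τ.pullback (q.pullback ⟨f, hf'⟩))
        (g := τ.pullback (q.pullback ⟨g (q y₀), hg (q y₀)⟩))
        (τ.pullback (q.pullback ⟨h (q y₀), hh (q y₀)⟩)) hy fun z hz => hf (q y₀) (q (τ z)) hz
      exact h1.trans (congrArg (fun l : W.Fn => l.1 y) (hk (q y₀)))
    have hsm : Y.IsSmooth fun y => F.1 (σ y) := isSmooth_of_smoothAt fun y₀ =>
      ⟨q.pullback ⟨h (q y₀), hh (q y₀)⟩, k (q y₀), hx (q y₀), fun y hy => by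
        have := key y₀ (σ y) (by rw [hσ]; exact hy)
        rwa [hσ] at this⟩
    refine ⟨⟨_, hsm⟩, Fn.ext fun y => ?_⟩
    have h1 := key (τ y) y (hx _)
    have h2 := key (τ y) (σ (τ y)) (by rw [hσ]; exact hx _)
    rw [hσ] at h2
    exact h1.trans h2.symm

end Descent

/-! ### Differential operators, functions on jets and the Cartan connection -/

section JetOperators

open DSpace

variable {n : ℕ} {M : Type u} [TopologicalSpace M] [ChartedSpace (EuclideanSpace ℝ (Fin n)) M]
  {F : Type w} [NormedAddCommGroup F] [NormedSpace ℝ F]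
  {E : M → Type v} [∀ x, AddCommGroup (E x)] [∀ x, Module ℝ (E x)] [∀ x, TopologicalSpace (E x)]
  [TopologicalSpace (Bundle.TotalSpace F E)] [FiberBundle F E] [VectorBundle ℝ F E]

namespace IsDiffOp

theorem map_add : ∀ {r : ℕ} {Δ : Section n F E → (DSpace.ofManifold n M).Fn}, IsDiffOp r Δ →
    ∀ s t, Δ (s + t) = Δ s + Δ t
  | 0, _, h => h.1
  | _ + 1, _, h => h.1

theorem map_smul : ∀ {r : ℕ} {Δ : Section n F E → (DSpace.ofManifold n M).Fn}, IsDiffOp r Δ →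
    ∀ (c : ℝ) s, Δ (c • s) = c • Δ s
  | 0, Δ, h, c, s => by
    have e : c • s = algebraMap ℝ (DSpace.ofManifold n M).Fn c • s := by ext x; rfl
    rw [e, h.2, Algebra.smul_def]
  | _ + 1, _, h, c, s => h.2.1 c s

theorem add : ∀ {r : ℕ} {Δ Δ' : Section n F E → (DSpace.ofManifold n M).Fn}, IsDiffOp r Δ →
    IsDiffOp r Δ' → IsDiffOp r fun s => Δ s + Δ' s
  | 0, Δ, Δ', h, h' => ⟨fun s t => by simp only [h.1, h'.1]; ring, fun f s => by
      simp only [h.2, h'.2]; ring⟩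
  | r + 1, Δ, Δ', h, h' => ⟨fun s t => by simp only [h.1, h'.1]; ring, fun c s => by
      simp only [h.2.1, h'.2.1, smul_add], fun f => by
      have := add (h.2.2 f) (h'.2.2 f)
      have e : (fun s => (Δ (f • s) + Δ' (f • s)) - f * (Δ s + Δ' s)) =
        fun s => (Δ (f • s) - f * Δ s) + (Δ' (f • s) - f * Δ' s) := funext fun s => by ring
      rwa [e]⟩

theorem mul_left (g : (DSpace.ofManifold n M).Fn) :
    ∀ {r : ℕ} {Δ : Section n F E → (DSpace.ofManifold n M).Fn}, IsDiffOp r Δ →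
      IsDiffOp r fun s => g * Δ s
  | 0, Δ, h => ⟨fun s t => by simp only [h.1]; ring, fun f s => by simp only [h.2]; ring⟩
  | r + 1, Δ, h => ⟨fun s t => by simp only [h.1]; ring, fun c s => by
      simp only [h.2.1, mul_smul_comm], fun f => by
      have := mul_left g (h.2.2 f)
      have e : (fun s => g * Δ (f • s) - f * (g * Δ s)) =
        fun s => g * (Δ (f • s) - f * Δ s) := funext fun s => by ring
      rwa [e]⟩

/-- The composition of a vector field and a differential operator. -/
theorem comp_field (Z : (DSpace.ofManifold n M).Field) :
    ∀ {r : ℕ} {Δ : Section n F E → (DSpace.ofManifold n M).Fn}, IsDiffOp r Δ →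
      IsDiffOp (r + 1) fun s => Z (Δ s)
  | 0, Δ, h => ⟨fun s t => by simp only [h.map_add, _root_.map_add], fun c s => by
      simp only [h.map_smul, Derivation.map_smul], fun f => by
      have e : (fun s => Z (Δ (f • s)) - f * Z (Δ s)) = fun s => Z f * Δ s := funext fun s => by
        rw [h.2, Derivation.leibniz]
        simp only [smul_eq_mul]
        ring
      rw [e]
      exact mul_left (Z f) h⟩
  | r + 1, Δ, h => ⟨fun s t => by simp only [h.map_add, _root_.map_add], fun c s => by
      simp only [h.map_smul, Derivation.map_smul], fun f => by
      have e : (fun s => Z (Δ (f • s)) - f * Z (Δ s)) =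
          fun s => Z (Δ (f • s) - f * Δ s) + Z f * Δ s := funext fun s => by
        rw [_root_.map_sub, Derivation.leibniz]
        simp only [smul_eq_mul]
        ring
      rw [e]
      exact add (comp_field Z (h.2.2 f)) (mul_left (Z f) h)⟩

/-- An operator of order `r` maps sections that vanish to order `r` at `x` to functions vanishing at
`x`. -/
theorem apply_eq_zero {x : DSpace.ofManifold n M} :
    ∀ {r : ℕ} {Δ : Section n F E → (DSpace.ofManifold n M).Fn}, IsDiffOp r Δ →
      ∀ s ∈ (maxIdeal x ^ (r + 1)) • (⊤ : Submodule (DSpace.ofManifold n M).Fn (Section n F E)),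
        (Δ s).1 x = 0
  | 0, Δ, h, s, hs => by
    rw [zero_add, pow_one] at hs
    refine Submodule.smul_induction_on hs (fun f hf s _ => ?_) fun s t hs ht => ?_
    · rw [h.2, Fn.val_mul, show f.1 x = 0 from hf, zero_mul]
    · rw [h.1, Fn.val_add, hs, ht, add_zero]
  | r + 1, Δ, h, s, hs => by
    -- One factor f vanishing at x is split off: Δ(fs) equals the commutator of Δ with f applied to
    -- s, plus fΔ(s). The first has order r and the second vanishes at x.
    rw [pow_succ', Submodule.mul_smul] at hs
    refine Submodule.smul_induction_on hs (fun f hf s hs => ?_) fun s t hs ht => ?_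
    · have := apply_eq_zero (h.2.2 f) s hs
      rw [Fn.val_sub, Fn.val_mul, show f.1 x = 0 from hf, zero_mul, sub_zero] at this
      exact this
    · rw [h.1, Fn.val_add, hs, ht, add_zero]

/-- The function on infinite jets defined by a differential operator. -/
theorem exists_jet_function {r : ℕ} {Δ : Section n F E → (DSpace.ofManifold n M).Fn}
    (h : IsDiffOp r Δ) :
    ∃ φ : (jetSpace n F E ⊤).Fn, ∀ s x, φ.1 (jet ⊤ s x) = (Δ s).1 x := by
  let φ : Jet n F E ⊤ → ℝ := fun θ => (Δ (Quotient.out θ.2)).1 θ.1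
  have hφ : ∀ s x, φ (jet ⊤ s x) = (Δ s).1 x := fun s x => by
    have h1 : (Submodule.Quotient.mk (Quotient.out (jet ⊤ s x).2) : Section n F E ⧸ vanishing n F E x ⊤) =
        Submodule.Quotient.mk s := Quotient.out_eq _
    rw [Submodule.Quotient.eq] at h1
    have h2 := h.apply_eq_zero _ ((Submodule.mem_iInf _).1 ((Submodule.mem_iInf _).1 h1 r) le_top)
    have h3 := h.map_add (Quotient.out (jet ⊤ s x).2 - s) s
    rw [sub_add_cancel] at h3
    have h4 := congrArg (fun f : (DSpace.ofManifold n M).Fn => f.1 x) h3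
    simp only [Fn.val_add, h2, zero_add] at h4
    exact h4
  exact ⟨⟨φ, Gen.base φ (Or.inr ⟨r, Δ, le_top, h, hφ⟩)⟩, hφ⟩

end IsDiffOp

theorem exists_eq_jetMap (θ : jetSpace n F E ⊤) : ∃ s x, θ = jetMap ⊤ s x := by
  obtain ⟨x, c⟩ := θ
  obtain ⟨s, rfl⟩ := Submodule.Quotient.mk_surjective _ c
  exact ⟨s, x, rfl⟩

variable {k : ℕ} {𝓔 : Set (jetSpace n F E k)} {W : DSpace.{t}} {τ : SMap W (infProlongation 𝓔)}
  {C : FlatConnection ((infProj 𝓔).comp τ)}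

/-- Along the graph of an infinite jet C(Z) acts as Z, so the jet function of Δ goes to that of Z ∘
Δ. The order rises by one, which is harmless on infinite jets. -/
theorem IsCovering.exists_descent (hC : IsCovering τ C) (hτ : Function.Surjective τ)
    (Z : (DSpace.ofManifold n M).Field) (f : (infProlongation 𝓔).Fn) :
    ∃ g, C.toFun Z (τ.pullback f) = τ.pullback g := by
  refine _root_.exists_descent hτ (C.toFun Z) (SMap.id _) (fun f hf => ?_) f
  obtain ⟨g, hg, rfl⟩ := hf
  -- Functions on the infinite prolongation are generated by restrictions from J^∞, which are in
  -- turn generated by jet functions; hence a second descent.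
  refine _root_.exists_descent hτ (C.toFun Z) (infIncl 𝓔) (fun φ hφ => ?_) ⟨g, hg⟩
  obtain ⟨f, rfl⟩ | ⟨r, Δ, -, hΔ, h⟩ := id hφ
  · exact ⟨(infProj 𝓔).pullback (Z f), C.lift Z f⟩
  · obtain ⟨ψ, hψ⟩ := (hΔ.comp_field Z).exists_jet_function
    refine ⟨(infIncl 𝓔).pullback ψ, Fn.ext fun y => ?_⟩
    obtain ⟨s, x, hs⟩ := exists_eq_jetMap (infIncl 𝓔 (τ y))
    refine (LinearMap.congr_fun (hC Z s x y hs) ⟨φ, Gen.base φ hφ⟩).trans ?_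
    have e : (jetMap ⊤ s).pullback ⟨φ, Gen.base φ hφ⟩ = Δ s := Fn.ext fun x => h s x
    have e2 : ψ.1 (infIncl 𝓔 (τ y)) = (Z (Δ s)).1 x := by rw [hs]; exact hψ s x
    exact (congrArg (fun l => (Z l).1 x) e).trans e2.symm

/-- A Cartan connection is related to all covering structures. -/
theorem IsCartan.pullback_toFun {C₀ : FlatConnection (infProj 𝓔)} (hC₀ : IsCartan C₀)
    (hC : IsCovering τ C) (Z : (DSpace.ofManifold n M).Field) (f : (infProlongation 𝓔).Fn) :
    C.toFun Z (τ.pullback f) = τ.pullback (C₀.toFun Z f) := Fn.ext fun y => by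
  obtain ⟨s, x, hs⟩ := exists_eq_jetMap (infIncl 𝓔 (τ y))
  have h1 := (isTangentAt_value (C.toFun Z) y).push τ
  have h2 := isTangentAt_value (C₀.toFun Z) (τ y)
  refine LinearMap.congr_fun (IsTangentAt.ext_generate h1 h2 fun f hf => ?_) f
  obtain ⟨g, hg, rfl⟩ := hf
  exact (LinearMap.congr_fun (hC Z s x y hs) ⟨g, hg⟩).trans
    (LinearMap.congr_fun (hC₀ Z s x (τ y) hs) ⟨g, hg⟩).symm

/-- The lifts of C descend along τ, and injectivity of the pullback lets every axiom, and uniqueness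
too, be checked on W. -/
theorem IsCovering.existsUnique_isCartan (hC : IsCovering τ C) (hτ : Function.Surjective τ) :
    ∃! C₀ : FlatConnection (infProj 𝓔), IsCartan C₀ := by
  have hinj := SMap.pullback_injective hτ
  choose D hD using hC.exists_descent hτ
  let V : (DSpace.ofManifold n M).Field → (infProlongation 𝓔).Field := fun Z => Derivation.mk'
    { toFun := D Z
      map_add' := fun f g => hinj (by rw [map_add, ← hD, ← hD, ← hD, map_add, map_add])
      map_smul' := fun c f => hinj (by
        rw [RingHom.id_apply, map_smul, ← hD, ← hD, map_smul, Derivation.map_smul]) }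
    fun f g => hinj (by
      change τ.pullback (D Z (f * g)) = τ.pullback (f * D Z g + g * D Z f)
      rw [map_add, map_mul, map_mul, ← hD, ← hD, ← hD, map_mul, Derivation.leibniz]; rfl)
  have hV : ∀ Z f, C.toFun Z (τ.pullback f) = τ.pullback (V Z f) := hD
  let C₀ : FlatConnection (infProj 𝓔) :=
    { toFun := V
      map_add := fun Z Z' => by
        ext f : 1
        apply hinj
        rw [Derivation.add_apply, map_add, ← hV, ← hV, ← hV, C.map_add, Derivation.add_apply]
      map_smul := fun g Z => by
        ext f : 1
        apply hinj
        rw [Derivation.smul_apply, smul_eq_mul, map_mul, ← hV, ← hV, C.map_smul, Derivation.smul_apply]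
        rfl
      lift := fun Z f => hinj (by rw [← hV]; exact C.lift Z f)
      flat := fun Z Z' => by
        ext f : 1
        apply hinj
        rw [Derivation.commutator_apply, map_sub, ← hV, ← hV, ← hV, ← hV, ← hV, C.flat,
          Derivation.commutator_apply] }
  refine ⟨C₀, fun Z s x θ hθ => ?_, fun C₁ h₁ => ?_⟩
  · obtain ⟨y, rfl⟩ := hτ θ
    rw [← hC Z s x y hθ]
    ext g
    exact (congrArg (fun l : W.Fn => l.1 y) (hV Z ((infIncl 𝓔).pullback g))).symm
  · ext Z f : 3
    apply hinj
    rw [← h₁.pullback_toFun hC]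
    exact hV Z f

end JetOperators

/-! ### Cutoff functions -/

section Cutoff

open DSpace

/-- A smooth cutoff function of `f` which vanishes exactly where `f ≤ c` and equals one where
`f ≥ c + r`. -/
def DSpace.Fn.cutoff {X : DSpace.{u}} (c r : ℝ) (f : X.Fn) : X.Fn :=
  Fn.map (fun t => Real.smoothTransition ((t - c) / r))
    (Real.smoothTransition.contDiff.comp (by fun_prop)) f

variable {X : DSpace.{u}} {c r : ℝ} {f : X.Fn} {x : X}

theorem DSpace.Fn.cutoff_ne_zero_iff (hr : 0 < r) : (Fn.cutoff c r f).1 x ≠ 0 ↔ c < f.1 x := by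
  change Real.smoothTransition ((f.1 x - c) / r) ≠ 0 ↔ _
  rw [Ne, Real.smoothTransition.zero_iff_nonpos, not_le, div_pos_iff_of_pos_right hr, sub_pos]

theorem DSpace.Fn.cutoff_eq_zero (hr : 0 < r) (h : f.1 x ≤ c) : (Fn.cutoff c r f).1 x = 0 := by
  by_contra h'
  exact absurd ((Fn.cutoff_ne_zero_iff hr).1 h') (not_lt.2 h)

theorem DSpace.Fn.cutoff_eq_one (hr : 0 < r) (h : c + r ≤ f.1 x) : (Fn.cutoff c r f).1 x = 1 :=
  Real.smoothTransition.one_of_one_le ((one_le_div hr).2 (by linarith))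

theorem DSpace.Fn.cutoff_nonneg (c r : ℝ) (f : X.Fn) (x : X) : 0 ≤ (Fn.cutoff c r f).1 x :=
  Real.smoothTransition.nonneg _

end Cutoff

/-! ### Extension of functions from an open subset -/

section Extension

open DSpace

variable {B : DSpace.{u}} {h N : B.Fn}

open Classical in
/-- The extension by zero of the product of a function on `{h ≠ 0}` and a cutoff function. -/
def cutoffExtensionFun (N : B.Fn) (f : (B.sub {y | h.1 y ≠ 0}).Fn) (u : B) : ℝ :=
  if hu : h.1 u ≠ 0 then (Fn.cutoff (1 / 8) (1 / 8) N).1 u * f.1 ⟨u, hu⟩ else 0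

theorem cutoffExtensionFun_of_ne (f : (B.sub {y | h.1 y ≠ 0}).Fn) {u : B} (hu : h.1 u ≠ 0) :
    cutoffExtensionFun N f u = (Fn.cutoff (1 / 8) (1 / 8) N).1 u * f.1 ⟨u, hu⟩ := dif_pos hu

theorem cutoffExtensionFun_of_eq (f : (B.sub {y | h.1 y ≠ 0}).Fn) {u : B} (hu : h.1 u = 0) :
    cutoffExtensionFun N f u = 0 := dif_neg (not_not.2 hu)

theorem smooth_cutoffExtensionFun (hN : ∀ u, h.1 u = 0 → N.1 u = 0)
    (f : (B.sub {y | h.1 y ≠ 0}).Fn) : B.IsSmooth (cutoffExtensionFun N f) :=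
  isSmooth_of_smoothAt fun u => by
    by_cases hu : h.1 u = 0
    · refine ⟨Fn.cutoff (-1 / 8) 1 (-N), 0, ?_, fun z hz => ?_⟩
      · rw [Fn.cutoff_ne_zero_iff one_pos, Fn.val_neg, hN u hu]; norm_num
      · rw [Fn.cutoff_ne_zero_iff one_pos, Fn.val_neg] at hz
        by_cases hz' : h.1 z = 0
        · exact cutoffExtensionFun_of_eq f hz'
        · rw [cutoffExtensionFun_of_ne f hz', Fn.cutoff_eq_zero (by norm_num) (by linarith), zero_mul]
          rfl
    · obtain ⟨k, g, hk, hg⟩ := exists_restrict f.2 ⟨u, hu⟩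
      refine ⟨h * k, Fn.cutoff (1 / 8) (1 / 8) N * g, mul_ne_zero hu hk, fun z hz => ?_⟩
      have hz' : h.1 z * k.1 z ≠ 0 := hz
      rw [cutoffExtensionFun_of_ne f (left_ne_zero_of_mul hz'), hg _ (right_ne_zero_of_mul hz')]
      rfl

/-- Extension of functions on `{h ≠ 0}`, after multiplication by a cutoff function that vanishes near
`{h = 0}`. -/
def cutoffExtension (hN : ∀ u, h.1 u = 0 → N.1 u = 0) : (B.sub {y | h.1 y ≠ 0}).Fn →ₗ[ℝ] B.Fn where
  toFun f := ⟨cutoffExtensionFun N f, smooth_cutoffExtensionFun hN f⟩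
  map_add' f g := Fn.ext fun u => by
    change cutoffExtensionFun N (f + g) u = cutoffExtensionFun N f u + cutoffExtensionFun N g u
    by_cases hu : h.1 u = 0
    · rw [cutoffExtensionFun_of_eq _ hu, cutoffExtensionFun_of_eq _ hu, cutoffExtensionFun_of_eq _ hu,
        add_zero]
    · rw [cutoffExtensionFun_of_ne _ hu, cutoffExtensionFun_of_ne _ hu, cutoffExtensionFun_of_ne _ hu]
      exact mul_add _ _ _
  map_smul' a f := Fn.ext fun u => by
    change cutoffExtensionFun N (a • f) u = a * cutoffExtensionFun N f u
    by_cases hu : h.1 u = 0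
    · rw [cutoffExtensionFun_of_eq _ hu, cutoffExtensionFun_of_eq _ hu, mul_zero]
    · rw [cutoffExtensionFun_of_ne _ hu, cutoffExtensionFun_of_ne _ hu]
      exact mul_left_comm _ _ _

theorem base_ne_zero (hN : ∀ u, h.1 u = 0 → N.1 u = 0) {u : B} (hu : 1 / 4 < N.1 u) : h.1 u ≠ 0 := fun h0 => by
  rw [hN u h0] at hu
  norm_num at hu

variable (hN : ∀ u, h.1 u = 0 → N.1 u = 0)

/-- The threshold is 1/4 = 1/8 + 1/8, beyond which the cutoff equals one. -/
theorem cutoffExtension_apply {u : B} (hu : 1 / 4 < N.1 u) (f : (B.sub {y | h.1 y ≠ 0}).Fn) :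
    (cutoffExtension hN f).1 u = f.1 ⟨u, base_ne_zero hN hu⟩ := by
  refine (cutoffExtensionFun_of_ne f (base_ne_zero hN hu)).trans ?_
  rw [Fn.cutoff_eq_one (by norm_num) (by linarith), one_mul]

variable {ζ : B.Fn →ₗ[ℝ] ℝ} {u : B}

/-- The extension is multiplicative only where the cutoff is one. As {N > 1/4} is open, locality of
ζ gives the Leibniz rule. -/
theorem IsTangentAt.cutoffExtension (hζ : IsTangentAt u ζ) (hu : 1 / 4 < N.1 u) :
    IsTangentAt (X := B.sub {y | h.1 y ≠ 0}) ⟨u, base_ne_zero hN hu⟩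
      (ζ ∘ₗ _root_.cutoffExtension hN) := fun f g => by
  have h1 := hζ.congr_of_eq (f := _root_.cutoffExtension hN (f * g))
    (g := _root_.cutoffExtension hN f * _root_.cutoffExtension hN g) (Fn.cutoff (1 / 4) 1 N)
    ((Fn.cutoff_ne_zero_iff one_pos).2 hu) fun z hz => by
      have hz' := (Fn.cutoff_ne_zero_iff one_pos).1 hz
      rw [Fn.val_mul, cutoffExtension_apply hN hz', cutoffExtension_apply hN hz',
        cutoffExtension_apply hN hz']
      rfl
  refine h1.trans ((hζ _ _).trans ?_)
  rw [cutoffExtension_apply hN hu, cutoffExtension_apply hN hu]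
  rfl

theorem IsTangentAt.cutoffExtension_restrict (hζ : IsTangentAt u ζ) (hu : 1 / 4 < N.1 u) (g : B.Fn) :
    ζ (_root_.cutoffExtension hN ((SMap.incl B {y | h.1 y ≠ 0}).pullback g)) = ζ g :=
  hζ.congr_of_eq (Fn.cutoff (1 / 4) 1 N) ((Fn.cutoff_ne_zero_iff one_pos).2 hu) fun z hz => by
    rw [cutoffExtension_apply hN ((Fn.cutoff_ne_zero_iff one_pos).1 hz)]
    rfl

end Extension

/-! ### Local lifts along a fibre bundle -/

section LocalLift

open DSpace

/-- The inclusion of a slice of a product. -/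
def DSpace.slice (U : DSpace.{u}) {Y : DSpace.{v}} (c : Y) : SMap U (U.prod Y) :=
  SMap.ofGenerate (fun u => (u, c)) (by
    rintro _ (⟨g, hg, rfl⟩ | ⟨g, hg, rfl⟩)
    · exact hg
    · exact (algebraMap ℝ U.Fn (g c)).2)

variable {W : DSpace.{w}} {B : DSpace.{u}} {τ : SMap W B} {s : W → B.Fn →ₗ[ℝ] ℝ}
  {h N : B.Fn} {Y : DSpace.{v}}

open Classical in
/-- A function on the product, read on the total space in a trivialization, and extended by zero. -/
def readFn (Φ : SMap (W.sub {x | h.1 (τ x) ≠ 0}) ((B.sub {y | h.1 y ≠ 0}).prod Y))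
    (G : ((B.sub {y | h.1 y ≠ 0}).prod Y).Fn) (y : W) : ℝ :=
  if hy : h.1 (τ y) ≠ 0 then G.1 (Φ ⟨y, hy⟩) else 0

theorem readFn_eq (Φ : SMap (W.sub {x | h.1 (τ x) ≠ 0}) ((B.sub {y | h.1 y ≠ 0}).prod Y))
    (G : ((B.sub {y | h.1 y ≠ 0}).prod Y).Fn) {y : W} (hy : h.1 (τ y) ≠ 0) :
    readFn Φ G y = G.1 (Φ ⟨y, hy⟩) := dif_pos hy

theorem smoothAt_readFn (Φ : SMap (W.sub {x | h.1 (τ x) ≠ 0}) ((B.sub {y | h.1 y ≠ 0}).prod Y))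
    (G : ((B.sub {y | h.1 y ≠ 0}).prod Y).Fn) {y : W} (hy : h.1 (τ y) ≠ 0) :
    W.SmoothAt (readFn Φ G) y := by
  obtain ⟨k, g, hk, hg⟩ := exists_restrict (Φ.pullback G).2 ⟨y, hy⟩
  refine ⟨τ.pullback h * k, g, mul_ne_zero hy hk, fun z hz => ?_⟩
  have hz' : h.1 (τ z) * k.1 z ≠ 0 := hz
  rw [readFn, dif_pos (left_ne_zero_of_mul hz'), ← hg ⟨z, _⟩ (right_ne_zero_of_mul hz')]
  rfl

variable (hN : ∀ u, h.1 u = 0 → N.1 u = 0)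

open Classical in
/-- The derivative along `s` of a function on the product in the first variable. -/
def sliceDeriv (s : W → B.Fn →ₗ[ℝ] ℝ) (hN : ∀ u, h.1 u = 0 → N.1 u = 0)
    (Φ : SMap (W.sub {x | h.1 (τ x) ≠ 0}) ((B.sub {y | h.1 y ≠ 0}).prod Y))
    (y : W) : ((B.sub {y | h.1 y ≠ 0}).prod Y).Fn →ₗ[ℝ] ℝ :=
  if hy : h.1 (τ y) ≠ 0 then
    s y ∘ₗ cutoffExtension hN ∘ₗ ((B.sub {y | h.1 y ≠ 0}).slice (Φ ⟨y, hy⟩).2).pullback.toLinearMap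
  else 0

variable {Φ : SMap (W.sub {x | h.1 (τ x) ≠ 0}) ((B.sub {y | h.1 y ≠ 0}).prod Y)}

theorem isTangentAt_sliceDeriv (hs : ∀ y, IsTangentAt (τ y) (s y))
    (hΦ : ∀ x, (Φ x).1.1 = τ x.1) {y : W} (hy : 1 / 4 < N.1 (τ y)) :
    IsTangentAt (Φ ⟨y, base_ne_zero hN hy⟩) (sliceDeriv s hN Φ y) := by
  have h1 := IsTangentAt.push ((B.sub {y | h.1 y ≠ 0}).slice (Φ ⟨y, base_ne_zero hN hy⟩).2)
    (IsTangentAt.cutoffExtension hN (hs y) hy)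
  have e : ((B.sub {y | h.1 y ≠ 0}).slice (Φ ⟨y, base_ne_zero hN hy⟩).2)
      ⟨τ y, base_ne_zero hN hy⟩ = Φ ⟨y, base_ne_zero hN hy⟩ :=
    Prod.ext (Subtype.ext (hΦ ⟨y, base_ne_zero hN hy⟩).symm) rfl
  rw [e] at h1
  rw [sliceDeriv, dif_pos (base_ne_zero hN hy)]
  exact h1

/-- The slice moves with y, so smoothness of s alone is not enough, and the proof follows the
generation of G. Functions of the first factor reduce to s, functions of the fibre are constant on
slices and give zero, and the chain rule and locality do the rest. -/
theorem smoothAt_sliceDeriv (hs : ∀ y, IsTangentAt (τ y) (s y))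
    (hΦ : ∀ x, (Φ x).1.1 = τ x.1) (hsm : ∀ f, W.IsSmooth fun y => s y f)
    (G : ((B.sub {y | h.1 y ≠ 0}).prod Y).Fn) {y : W} (hy : 1 / 4 < N.1 (τ y)) :
    W.SmoothAt (fun z => sliceDeriv s hN Φ z G) y := by
  have hk : (Fn.cutoff (1 / 4) 1 (τ.pullback N)).1 y ≠ 0 := (Fn.cutoff_ne_zero_iff one_pos).2 hy
  have hk' : ∀ z, (Fn.cutoff (1 / 4) 1 (τ.pullback N)).1 z ≠ 0 → 1 / 4 < N.1 (τ z) := fun z hz =>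
    (Fn.cutoff_ne_zero_iff one_pos).1 hz
  suffices key : ∀ G (hG : Gen _ G), W.SmoothAt (fun z => sliceDeriv s hN Φ z ⟨G, hG⟩) y from
    key G.1 G.2
  intro G hG
  induction hG with
  | base G hG =>
    obtain ⟨g, hg, rfl⟩ | ⟨g, hg, rfl⟩ := id hG
    · refine SmoothAt.congr (Fn.smoothAt ⟨_, hsm (cutoffExtension hN ⟨g, hg⟩)⟩ y) _ hk fun z hz => ?_
      rw [sliceDeriv, dif_pos (base_ne_zero hN (hk' z hz))]
      rfl
    · refine SmoothAt.congr (Fn.smoothAt (0 : W.Fn) y) _ hk fun z hz => ?_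
      have h1 := (IsTangentAt.cutoffExtension hN (hs z) (hk' z hz)).map_algebraMap
        (g (Φ ⟨z, base_ne_zero hN (hk' z hz)⟩).2)
      rw [sliceDeriv, dif_pos (base_ne_zero hN (hk' z hz))]
      exact h1
  | comp m γ hγ f hf ih =>
    refine SmoothAt.congr (w := fun z => ∑ i, fderiv ℝ γ (fun j => readFn Φ ⟨f j, hf j⟩ z) (Pi.single i 1) *
      sliceDeriv s hN Φ z ⟨f i, hf i⟩) (SmoothAt.sum fun i => SmoothAt.mul
        (SmoothAt.comp (g := fun v => fderiv ℝ γ v (Pi.single i 1))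
          ((hγ.fderiv_right le_rfl).clm_apply contDiff_const)
          fun j => smoothAt_readFn Φ _ (base_ne_zero hN hy)) (ih i)) _ hk fun z hz => ?_
    refine ((isTangentAt_sliceDeriv hN hs hΦ (hk' z hz)).chain hγ (fun i => ⟨f i, hf i⟩) _
      fun _ => rfl).trans (Finset.sum_congr rfl fun i _ => ?_)
    have e : ∀ j, readFn Φ ⟨f j, hf j⟩ z = f j (Φ ⟨z, base_ne_zero hN (hk' z hz)⟩) := fun j =>
      readFn_eq Φ _ (base_ne_zero hN (hk' z hz))
    simp only [e]
  | glue f k g hkG hx hg hf ihk ihg =>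
    let p := Φ ⟨y, base_ne_zero hN hy⟩
    obtain ⟨l, q, hl, hq⟩ := smoothAt_readFn Φ ⟨k p, hkG p⟩ (base_ne_zero hN hy)
    have hread : ∀ z (hz : 1 / 4 < N.1 (τ z)), readFn Φ ⟨k p, hkG p⟩ z =
        k p (Φ ⟨z, base_ne_zero hN hz⟩) := fun z hz =>
      readFn_eq Φ _ (base_ne_zero hN hz)
    refine SmoothAt.congr (ihg p) (Fn.cutoff (1 / 4) 1 (τ.pullback N) * (l * q))
      (mul_ne_zero hk (mul_ne_zero hl ?_)) fun z hz => ?_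
    · rw [← hq y hl, hread y hy]
      exact hx p
    · have hz1 : (Fn.cutoff (1 / 4) 1 (τ.pullback N)).1 z * (l.1 z * q.1 z) ≠ 0 := hz
      have hz2 := hk' z (left_ne_zero_of_mul hz1)
      have hz3 := right_ne_zero_of_mul (right_ne_zero_of_mul hz1)
      rw [← hq z (left_ne_zero_of_mul (right_ne_zero_of_mul hz1)), hread z hz2] at hz3
      exact (isTangentAt_sliceDeriv hN hs hΦ hz2).congr_of_eq (f := ⟨f, _⟩) (g := ⟨g p, hg p⟩)
        ⟨k p, hkG p⟩ hz3 (hf p)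

/-- Local lifts of a field along a bundle. -/
theorem SMap.IsBundle.exists_local_lift (hτ : τ.IsBundle)
    (hs : ∀ y, IsTangentAt (τ y) (s y)) (hsm : ∀ f, W.IsSmooth fun y => s y f) (b : B) :
    ∃ (χ : B.Fn) (V : W.Field), χ.1 b ≠ 0 ∧ (∀ x, 0 ≤ χ.1 x) ∧
      ∀ g y, (V (τ.pullback g)).1 y = χ.1 (τ y) * s y g := by
  obtain ⟨h, hb, Φ, Ψ, hΨΦ, hΦΨ, hΦ⟩ := hτ.2 b
  -- Normalized to N b = 1, so that χ, which vanishes for N ≤ 1/2 and is one for N ≥ 1, is supported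
  -- well inside {N > 1/4}.
  let N : B.Fn := (h.1 b)⁻¹ • h
  have hN : ∀ u, h.1 u = 0 → N.1 u = 0 := fun u hu => by rw [Fn.val_smul, hu, mul_zero]
  let χ : B.Fn := Fn.cutoff (1 / 2) (1 / 2) N
  -- The lift reads a function in the trivialization through Ψ and differentiates it in the first
  -- factor only.
  let P : W.Fn →ₐ[ℝ] ((B.sub {y | h.1 y ≠ 0}).prod (W.sub {x | τ x = b})).Fn :=
    ((SMap.incl W {x | h.1 (τ x) ≠ 0}).comp Ψ).pullback
  have hχ : ∀ y, ¬ 1 / 4 < N.1 (τ y) → χ.1 (τ y) = 0 := fun y hy =>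
    Fn.cutoff_eq_zero (by norm_num) (by linarith)
  have hsmooth : ∀ f, W.IsSmooth fun y => χ.1 (τ y) * sliceDeriv s hN Φ y (P f) := fun f =>
    isSmooth_of_smoothAt fun y => by
      by_cases hy : 1 / 4 < N.1 (τ y)
      · exact (Fn.smoothAt (τ.pullback χ) y).mul (smoothAt_sliceDeriv hN hs hΦ hsm (P f) hy)
      -- The complement of {N > 1/4} lies in the open set {N < 1/2}, where χ is zero.
      · refine SmoothAt.congr (Fn.smoothAt (0 : W.Fn) y) (Fn.cutoff (-1 / 2) 1 (τ.pullback (-N))) ?_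
          fun z hz => ?_
        · rw [Fn.cutoff_ne_zero_iff one_pos]
          change -1 / 2 < -N.1 (τ y)
          linarith
        · rw [Fn.cutoff_ne_zero_iff one_pos] at hz
          have hz' : -1 / 2 < -N.1 (τ z) := hz
          have h0 : χ.1 (τ z) = 0 := Fn.cutoff_eq_zero (by norm_num) (by linarith)
          rw [h0, zero_mul]
          rfl
  have hP : ∀ (f : W.Fn) (x : W.sub {x | h.1 (τ x) ≠ 0}), (P f).1 (Φ x) = f.1 x.1 := fun f x =>
    congrArg (fun x : W.sub {x | h.1 (τ x) ≠ 0} => f.1 x.1) (hΨΦ x)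
  refine ⟨χ, Derivation.mk'
    { toFun := fun f => ⟨_, hsmooth f⟩
      map_add' := fun f g => Fn.ext fun y => ?_
      map_smul' := fun a f => Fn.ext fun y => ?_ } fun f g => Fn.ext fun y => ?_, ?_,
    Fn.cutoff_nonneg _ _ _, fun g y => ?_⟩
  · change _ * sliceDeriv s hN Φ y (P (f + g)) = _ + _
    rw [map_add, map_add]; exact mul_add _ _ _
  · change _ * sliceDeriv s hN Φ y (P (a • f)) = a * _
    rw [map_smul, map_smul]; exact mul_left_comm _ _ _
  · change χ.1 (τ y) * sliceDeriv s hN Φ y (P (f * g)) =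
      f.1 y * (χ.1 (τ y) * sliceDeriv s hN Φ y (P g)) + g.1 y * (χ.1 (τ y) * sliceDeriv s hN Φ y (P f))
    by_cases hy : 1 / 4 < N.1 (τ y)
    · have h1 : sliceDeriv s hN Φ y (P f * P g) =
          f.1 y * sliceDeriv s hN Φ y (P g) + g.1 y * sliceDeriv s hN Φ y (P f) :=
        (isTangentAt_sliceDeriv hN hs hΦ hy (P f) (P g)).trans
          (congrArg₂ _ (congrArg (· * _) (hP f _)) (congrArg (· * _) (hP g _)))
      rw [map_mul, h1]
      ring
    · rw [hχ y hy]; ring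
  · rw [Fn.cutoff_ne_zero_iff (by norm_num), Fn.val_smul, inv_mul_cancel₀ hb]; norm_num
  · change χ.1 (τ y) * sliceDeriv s hN Φ y (P (τ.pullback g)) = _
    by_cases hy : 1 / 4 < N.1 (τ y)
    · congr 1
      -- A function pulled back from B is independent of the fibre variable, so its derivative along
      -- the slice is that along s y.
      rw [← IsTangentAt.cutoffExtension_restrict hN (hs y) hy g, sliceDeriv,
        dif_pos (base_ne_zero hN hy)]
      refine congrArg (fun f => s y (cutoffExtension hN f)) (Fn.ext fun u => congrArg g.1 ?_)
      change τ (Ψ (u, (Φ ⟨y, _⟩).2)).1 = u.1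
      exact (hΦ _).symm.trans (congrArg (fun q => q.1.1) (hΦΨ (u, _)))
    · rw [hχ y hy, zero_mul, zero_mul]

end LocalLift

/-! ### Countable covers of inverse limits -/

section Countability

open DSpace

/-- A class of generators which are continuous for some topology generates continuous functions. -/
theorem DSpace.Gen.continuous {T : Type u} [TopologicalSpace T] {S : Set (T → ℝ)}
    (hS : ∀ f ∈ S, Continuous f) {f : T → ℝ} (hf : Gen S f) : Continuous f := by
  induction hf with
  | base f hf => exact hS f hf
  | comp m g hg f _ ih => exact hg.continuous.comp (continuous_pi ih)
  | glue f h g _ hx _ hf ihh ihg =>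
    refine continuous_iff_continuousAt.2 fun x => ((ihg x).continuousAt (x := x)).congr ?_
    filter_upwards [((ihh x).continuousAt (x := x)).eventually_ne (hx x)] with y hy
    exact (hf x y hy).symm

/-- The preimages {f > a} and {f < a} of open rays are themselves nonvanishing sets of cutoff
functions. -/
theorem DSpace.Fn.continuous_generateFrom {X : DSpace.{u}} (f : X.Fn) :
    @Continuous X ℝ (TopologicalSpace.generateFrom {O : Set X | ∃ h : X.Fn, O = {x | h.1 x ≠ 0}}) _ f.1 := by
  let : TopologicalSpace X :=
    TopologicalSpace.generateFrom {O : Set X | ∃ h : X.Fn, O = {x | h.1 x ≠ 0}}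
  refine OrderTopology.continuous_iff.2 fun a =>
    ⟨TopologicalSpace.isOpen_generateFrom_of_mem ⟨Fn.cutoff a 1 f, ?_⟩,
      TopologicalSpace.isOpen_generateFrom_of_mem ⟨Fn.cutoff (-a) 1 (-f), ?_⟩⟩
  · ext x; exact (Fn.cutoff_ne_zero_iff one_pos).symm
  · ext x
    exact Iff.trans (neg_lt_neg_iff (a := a) (b := f.1 x)).symm
      (Fn.cutoff_ne_zero_iff (f := -f) one_pos).symm

/-- On an inverse limit of second countable manifolds each cover by sets `{h ≠ 0}` has a countable
subcover. -/
theorem DSpace.IsProManifold.exists_countable_cover {X : DSpace.{u}} (hX : X.IsProManifold) (g : X → X.Fn)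
    (hg : ∀ x, (g x).1 x ≠ 0) : ∃ T : Set X, T.Countable ∧ ∀ y, ∃ x ∈ T, (g x).1 y ≠ 0 := by
  obtain ⟨N, q, p, hN, -, -, -, hgen⟩ := hX
  let tN : ∀ s, TopologicalSpace (N s) := fun s =>
    TopologicalSpace.generateFrom {O : Set (N s) | ∃ h : (N s).Fn, O = {x | h.1 x ≠ 0}}
  -- The initial topology of the countably many projections is second countable, and smooth
  -- functions are continuous for it because their generators come from the stages.
  let tX : TopologicalSpace X := ⨅ s, TopologicalSpace.induced (p s) (tN s)
  have h2 : SecondCountableTopology X := TopologicalSpace.secondCountableTopology_iInf fun s =>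
    have : @SecondCountableTopology (N s) (tN s) := (hN s).2.1
    @TopologicalSpace.secondCountableTopology_induced X (N s) (tN s) _ (p s)
  have hc : ∀ f : X.Fn, Continuous f.1 := fun f =>
    Gen.continuous (by
      rintro _ ⟨s, l, hl, rfl⟩
      have h3 : @Continuous _ _ (TopologicalSpace.induced (p s) (tN s)) (tN s) (p s) :=
        continuous_induced_dom
      have h4 : @Continuous _ _ tX (tN s) (p s) := continuous_iInf_dom h3
      exact @Continuous.comp _ _ _ tX (tN s) _ _ _ (Fn.continuous_generateFrom ⟨l, hl⟩) h4)
      ((hgen f.1).1 f.2)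
  obtain ⟨T, hT, hU⟩ := TopologicalSpace.isOpen_iUnion_countable (fun x => {y | (g x).1 y ≠ 0})
    fun x => isOpen_ne_fun (hc (g x)) continuous_const
  refine ⟨T, hT, fun y => ?_⟩
  have hy : y ∈ ⋃ x ∈ T, {y | (g x).1 y ≠ 0} := by
    rw [hU]; exact Set.mem_iUnion.2 ⟨y, hg y⟩
  simpa using hy

end Countability

/-! ### Locally finite weights and global lifts -/

section Partition

open DSpace

variable {X : DSpace.{u}}

/-- The reciprocal of a positive function is smooth. -/
theorem DSpace.Fn.smooth_inv {f : X.Fn} (hf : ∀ x, 0 < f.1 x) : X.IsSmooth fun x => (f.1 x)⁻¹ :=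
  isSmooth_of_smoothAt fun x => by
    -- To compose with a function smooth on all of ℝ, 1/s is replaced by s divided by s² plus a term
    -- which is 1 at s = 0 and vanishes for s ≥ f(x)/2.
    have hpos : ∀ s : ℝ, s ^ 2 + Real.smoothTransition (1 - s / (f.1 x / 2)) ≠ 0 := fun s => by
      rcases eq_or_ne s 0 with rfl | hs
      · simp
      · have := Real.smoothTransition.nonneg (1 - s / (f.1 x / 2))
        positivity
    have hg : ContDiff ℝ ∞ fun s : ℝ => s / (s ^ 2 + Real.smoothTransition (1 - s / (f.1 x / 2))) :=
      contDiff_id.div ((contDiff_id.pow 2).add (Real.smoothTransition.contDiff.comp (by fun_prop))) hpos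
    have h0 := hf x
    refine ⟨Fn.cutoff (f.1 x / 2) 1 f, Fn.map _ hg f, (Fn.cutoff_ne_zero_iff one_pos).2 (by linarith),
      fun y hy => ?_⟩
    have hy' := (Fn.cutoff_ne_zero_iff one_pos).1 hy
    have h1 : Real.smoothTransition (1 - f.1 y / (f.1 x / 2)) = 0 :=
      Real.smoothTransition.zero_of_nonpos (by
        have : 1 ≤ f.1 y / (f.1 x / 2) := (one_le_div (by linarith)).2 hy'.le
        linarith)
    have h2 := hf y
    rw [Fn.map_val, h1, add_zero, sq, div_mul_cancel_left₀ h2.ne']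

/-- Local finiteness of a sequence of functions. -/
def DSpace.LocFinite (b : ℕ → X.Fn) : Prop :=
  ∀ x, ∃ (k : X.Fn) (m : ℕ), k.1 x ≠ 0 ∧ ∀ j, m ≤ j → ∀ z, k.1 z ≠ 0 → (b j).1 z = 0

theorem finsum_eq_sum_range {b : ℕ → ℝ} {m : ℕ} (h : ∀ j, m ≤ j → b j = 0) :
    ∑ᶠ j, b j = ∑ j ∈ Finset.range m, b j :=
  finsum_eq_sum_of_support_subset _ fun j hj => by
    by_contra hj'
    exact hj (h j (not_lt.1 fun hlt => hj' (Finset.mem_coe.2 (Finset.mem_range.2 hlt))))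

theorem DSpace.LocFinite.smooth_finsum {b : ℕ → X.Fn} (hb : LocFinite b) :
    X.IsSmooth fun x => ∑ᶠ j, (b j).1 x :=
  isSmooth_of_smoothAt fun x => by
    obtain ⟨k, m, hk, hm⟩ := hb x
    refine ⟨k, ∑ j ∈ Finset.range m, b j, hk, fun y hy => ?_⟩
    exact (finsum_eq_sum_range fun j hj => hm j hj y hy).trans (Fn.val_sum _ _ _).symm

theorem DSpace.LocFinite.mul {b : ℕ → X.Fn} (hb : LocFinite b) (c : ℕ → X.Fn) :
    LocFinite fun j => b j * c j := fun x => by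
  obtain ⟨k, m, hk, hm⟩ := hb x
  exact ⟨k, m, hk, fun j hj z hz => by rw [Fn.val_mul, hm j hj z hz, zero_mul]⟩

/-- For a sequence of nonnegative functions without common zeros there are locally finite weights with
positive weighted sum. -/
theorem exists_weights {a : ℕ → X.Fn} (ha : ∀ j x, 0 ≤ (a j).1 x) (hcov : ∀ x, ∃ j, (a j).1 x ≠ 0) :
    ∃ ψ : ℕ → X.Fn, LocFinite ψ ∧ ∀ x, 0 < ∑ᶠ j, (ψ j * a j).1 x := by
  -- α j i is one where a i = 0 and vanishes where a i ≥ 1/(j + 1). Hence, near a point with a i >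
  -- 0, all ψ j with j large vanish.
  let α : ℕ → ℕ → X.Fn := fun j i => Fn.cutoff 0 1 (1 - ((j : ℝ) + 1) • a i)
  let ψ : ℕ → X.Fn := fun j => ∏ i ∈ Finset.range j, α j i
  have hψ0 : ∀ j x, 0 ≤ (ψ j).1 x := fun j x => by
    rw [Fn.val_prod]
    exact Finset.prod_nonneg fun i _ => Fn.cutoff_nonneg _ _ _ _
  have hfin : LocFinite ψ := fun x => by
    obtain ⟨i, hi⟩ := hcov x
    have hi0 : 0 < (a i).1 x := (ha i x).lt_of_ne' hi
    obtain ⟨m, hm⟩ := exists_nat_gt (1 / ((a i).1 x / 2))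
    refine ⟨Fn.cutoff ((a i).1 x / 2) 1 (a i), max m (i + 1),
      (Fn.cutoff_ne_zero_iff one_pos).2 (by linarith), fun j hj z hz => ?_⟩
    have hz' := (Fn.cutoff_ne_zero_iff one_pos).1 hz
    rw [Fn.val_prod]
    refine Finset.prod_eq_zero (Finset.mem_range.2 (lt_of_lt_of_le (Nat.lt_succ_self i)
      ((le_max_right m (i + 1)).trans hj))) (Fn.cutoff_eq_zero one_pos ?_)
    rw [Fn.val_sub, Fn.val_one, Fn.val_smul]
    have h1 : (m : ℝ) ≤ j := Nat.cast_le.2 ((le_max_left m (i + 1)).trans hj)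
    have h2 : 1 < (m : ℝ) * ((a i).1 x / 2) := (div_lt_iff₀ (by linarith)).1 hm
    have h3 : (m : ℝ) * ((a i).1 x / 2) ≤ ((j : ℝ) + 1) * (a i).1 z :=
      mul_le_mul (by linarith) hz'.le (by linarith) (by positivity)
    linarith
  refine ⟨ψ, hfin, fun x => ?_⟩
  obtain ⟨k, m, hk, hm⟩ := hfin x
  have hsupp : ∀ j, m ≤ j → (ψ j * a j).1 x = 0 := fun j hj => by
    rw [Fn.val_mul, hm j hj x hk, zero_mul]
  rw [finsum_eq_sum_range hsupp]
  classical
  -- At the first index i with a i (x) ≠ 0 all factors of ψ i are one, which makes the sum positive.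
  let i := Nat.find (hcov x)
  have hi : (a i).1 x ≠ 0 := Nat.find_spec (hcov x)
  have hψi : (ψ i).1 x = 1 := by
    rw [Fn.val_prod]
    refine Finset.prod_eq_one fun l hl => Fn.cutoff_eq_one one_pos ?_
    have h0 : (a l).1 x = 0 := not_not.1 (Nat.find_min (hcov x) (Finset.mem_range.1 hl))
    rw [Fn.val_sub, Fn.val_one, Fn.val_smul, h0]
    norm_num
  have him : i ∈ Finset.range m := by
    by_contra him
    have := hm i (not_lt.1 fun h => him (Finset.mem_range.2 h)) x hk
    rw [hψi] at this
    exact one_ne_zero this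
  refine Finset.sum_pos' (fun j _ => mul_nonneg (hψ0 j x) (ha j x)) ⟨i, him, ?_⟩
  rw [Fn.val_mul, hψi, one_mul]
  exact (ha i x).lt_of_ne' hi

/-- A locally finite combination of vector fields. -/
theorem exists_field_finsum {b : ℕ → X.Fn} (hb : LocFinite b) (V : ℕ → X.Field) :
    ∃ V' : X.Field, ∀ f x, (V' f).1 x = ∑ᶠ j, (b j).1 x * (V j f).1 x := by
  have hsum : ∀ x, ∃ m, ∀ f, ∑ᶠ j, (b j).1 x * (V j f).1 x =
      ∑ j ∈ Finset.range m, (b j).1 x * (V j f).1 x := fun x => by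
    obtain ⟨k, m, hk, hm⟩ := hb x
    exact ⟨m, fun f => finsum_eq_sum_range fun j hj => by rw [hm j hj x hk, zero_mul]⟩
  choose m hm using hsum
  refine ⟨Derivation.mk'
    { toFun := fun f => ⟨fun x => ∑ᶠ j, (b j).1 x * (V j f).1 x, (hb.mul fun j => V j f).smooth_finsum⟩
      map_add' := fun f g => Fn.ext fun x => ?_
      map_smul' := fun c f => Fn.ext fun x => ?_ } fun f g => Fn.ext fun x => ?_, fun f x => rfl⟩
  · change ∑ᶠ j, (b j).1 x * (V j (f + g)).1 x =
      ∑ᶠ j, (b j).1 x * (V j f).1 x + ∑ᶠ j, (b j).1 x * (V j g).1 x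
    rw [hm, hm, hm, ← Finset.sum_add_distrib]
    refine Finset.sum_congr rfl fun j _ => ?_
    rw [map_add, Fn.val_add, mul_add]
  · change ∑ᶠ j, (b j).1 x * (V j (c • f)).1 x = c * ∑ᶠ j, (b j).1 x * (V j f).1 x
    rw [hm, hm, Finset.mul_sum]
    refine Finset.sum_congr rfl fun j _ => ?_
    rw [Derivation.map_smul, Fn.val_smul, mul_left_comm]
  · change ∑ᶠ j, (b j).1 x * (V j (f * g)).1 x =
      f.1 x * ∑ᶠ j, (b j).1 x * (V j g).1 x + g.1 x * ∑ᶠ j, (b j).1 x * (V j f).1 x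
    rw [hm, hm, hm, Finset.mul_sum, Finset.mul_sum, ← Finset.sum_add_distrib]
    refine Finset.sum_congr rfl fun j _ => ?_
    have h1 : (V j (f * g)).1 x = f.1 x * (V j g).1 x + g.1 x * (V j f).1 x :=
      isTangentAt_value (V j) x f g
    rw [h1]; ring

/-- A smooth family of tangent vectors along a bundle lifts to a vector field on the total space. -/
theorem SMap.IsBundle.exists_lift {W : DSpace.{w}} {B : DSpace.{u}} {τ : SMap W B} (hτ : τ.IsBundle)
    (hW : W.IsProManifold) {s : W → B.Fn →ₗ[ℝ] ℝ} (hs : ∀ y, IsTangentAt (τ y) (s y))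
    (hsm : ∀ f, W.IsSmooth fun y => s y f) :
    ∃ V : W.Field, ∀ g y, (V (τ.pullback g)).1 y = s y g := by
  choose χ V hχ hχ0 hV using hτ.exists_local_lift hs hsm
  obtain ⟨T, hT, hcov⟩ := hW.exists_countable_cover (fun y => τ.pullback (χ (τ y))) fun y => hχ (τ y)
  rcases isEmpty_or_nonempty W with hE | ⟨⟨y₀⟩⟩
  · exact ⟨0, fun g y => (hE.false y).elim⟩
  obtain ⟨x₀, hx₀, -⟩ := hcov y₀
  obtain ⟨e, rfl⟩ := hT.exists_eq_range ⟨x₀, hx₀⟩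
  have hcov' : ∀ y, ∃ j, (τ.pullback (χ (τ (e j)))).1 y ≠ 0 := fun y => by
    obtain ⟨_, ⟨j, rfl⟩, h⟩ := hcov y
    exact ⟨j, h⟩
  obtain ⟨ψ, hψ, hpos⟩ := exists_weights (a := fun j => τ.pullback (χ (τ (e j))))
    (fun j y => hχ0 _ _) hcov'
  -- The weights are not normalized: V' lifts S times s, and division by the positive function S
  -- gives the lift.
  let S : W.Fn := ⟨_, (hψ.mul fun j => τ.pullback (χ (τ (e j)))).smooth_finsum⟩
  obtain ⟨V', hV'⟩ := exists_field_finsum hψ fun j => V (τ (e j))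
  let R : W.Fn := ⟨_, Fn.smooth_inv (f := S) hpos⟩
  refine ⟨R • V', fun g y => ?_⟩
  have h1 : (V' (τ.pullback g)).1 y = S.1 y * s y g := by
    rw [hV']
    change _ = (∑ᶠ j, (ψ j * τ.pullback (χ (τ (e j)))).1 y) * s y g
    obtain ⟨k, m, hk, hm⟩ := hψ y
    rw [finsum_eq_sum_range (m := m) fun j hj => by rw [hm j hj y hk, zero_mul],
      finsum_eq_sum_range (m := m) fun j hj => by rw [Fn.val_mul, hm j hj y hk, zero_mul], Finset.sum_mul]
    refine Finset.sum_congr rfl fun j _ => ?_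
    rw [hV, Fn.val_mul, mul_assoc]
    rfl
  change (S.1 y)⁻¹ * (V' (τ.pullback g)).1 y = _
  rw [h1, inv_mul_cancel_left₀ (hpos y).ne']

end Partition

/-! ### Shadows and classes of vertical fields -/

section Shadows

open DSpace

variable {M : DSpace.{u}} {B : DSpace.{v}} {W : DSpace.{w}} {p : SMap B M} {τ : SMap W B}
  {C₀ : FlatConnection p} {C : FlatConnection (p.comp τ)} {U : W.VForm 1}

theorem VertVec.eq_of {a b : VertVec p} (hpt : a.pt = b.pt) (hvec : a.vec = b.vec) : a = b := by
  cases a; cases b; cases hpt; cases hvec; rfl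

theorem Shadow.eq_of_vec {S S' : Shadow C₀ τ C}
    (h : ∀ y, VertVec.vec (S.map y) = VertVec.vec (S'.map y)) : S = S' := by
  have e : S.map = S'.map := SMap.ext (funext fun y =>
    VertVec.eq_of ((S.overBase y).trans (S'.overBase y).symm) (h y))
  cases S; cases S'; cases e; rfl

/-- A vertical tangent vector sees the lift of a field only through the value of that field. -/
theorem vertical_apply_toFun_congr (hM : M.HasFrames) (C₀ : FlatConnection p) {u : B}
    {ζ : B.Fn →ₗ[ℝ] ℝ} (hζ : IsTangentAt u ζ) (hv : p.push ζ = 0) {Z Z' : M.Field}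
    (h : ∀ g, (Z g).1 (p u) = (Z' g).1 (p u)) (f : B.Fn) :
    ζ (C₀.toFun Z f) = ζ (C₀.toFun Z' f) := by
  obtain ⟨k, m, a, F, hk, H⟩ := hM (p u)
  have key : ∀ D : M.Field, ζ (C₀.toFun D f) =
      ∑ i, (D (a i)).1 (p u) * ζ (C₀.toFun (F i) f) := fun D => by
    refine (hζ.congr_of_eq (g := ∑ i, p.pullback (D (a i)) * C₀.toFun (F i) f) (p.pullback k) hk
      fun z hz => ?_).trans ((hζ.map_sum_mul _ _ _).trans (Finset.sum_congr rfl fun i _ => ?_))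
    · rw [Fn.val_sum]
      exact C₀.toFun_frame H D z hz f
    -- Being vertical, ζ annihilates the coefficients, which come from M; only their values at the
    -- point survive.
    · have h0 : ζ (p.pullback (D (a i))) = 0 := LinearMap.congr_fun hv (D (a i))
      rw [h0, mul_zero, add_zero]
      rfl
  rw [key, key]
  exact Finset.sum_congr rfl fun i _ => by rw [h]

/-- The shadow of a vertical field whose brackets with the lifted fields annihilate the functions on
the base. -/
def shadowOf (hcomp : ∀ Z f, C.toFun Z (τ.pullback f) = τ.pullback (C₀.toFun Z f)) {V : W.Field}
    (hV : V ∈ verticalFields (p.comp τ)) (hb : ∀ f Z, ⁅V, C.toFun Z⁆ (τ.pullback f) = 0) :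
    Shadow C₀ τ C where
  map := SMap.ofGenerate (fun y => (⟨τ y, τ.push (value V y), (isTangentAt_value V y).push τ,
      LinearMap.ext fun g => congrArg (fun f : W.Fn => f.1 y) (hV g)⟩ : VertVec p)) (by
    rintro _ (⟨f, rfl⟩ | ⟨f, rfl⟩)
    · exact (τ.pullback f).2
    · exact (V (τ.pullback f)).2)
  overBase _ := rfl
  cartan V' hV' y := by
    obtain ⟨Z, hZ⟩ := hV' y
    refine ⟨(isTangentAt_value V' y).push _, Z, fun f => ⟨?_, ?_⟩⟩
    · exact (LinearMap.congr_fun hZ (τ.pullback f)).trans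
        (congrArg (fun f : W.Fn => f.1 y) (hcomp Z f))
    · refine (LinearMap.congr_fun hZ (V (τ.pullback f))).trans ?_
      -- The fibre component of the Cartan condition is C(Z)(V(τ^*f)) = V(τ^*(C₀(Z)f)), which is the
      -- vanishing of the bracket on τ^*f.
      have h1 := congrArg (fun f : W.Fn => f.1 y) (hb f Z)
      simp only [FlatConnection.val_bracket, Fn.val_zero] at h1
      rw [hcomp] at h1
      exact (sub_eq_zero.1 h1).symm

/-- Shadows lift to vertical fields on the total space. -/
theorem Shadow.exists_lift (hM : M.HasFrames) (hτ : τ.IsBundle) (hW : W.IsProManifold)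
    (hcomp : ∀ Z f, C.toFun Z (τ.pullback f) = τ.pullback (C₀.toFun Z f)) (S : Shadow C₀ τ C) :
    ∃ V ∈ verticalFields (p.comp τ), (∀ f Z, ⁅V, C.toFun Z⁆ (τ.pullback f) = 0) ∧
      ∀ y, τ.push (value V y) = VertVec.vec (S.map y) := by
  have htan : ∀ y, IsTangentAt (τ y) (VertVec.vec (S.map y)) := fun y => by
    rw [← S.overBase y]; exact VertVec.tangent _
  have hvert : ∀ y, p.push (VertVec.vec (S.map y)) = 0 := fun y => VertVec.vert _
  obtain ⟨V, hV⟩ := hτ.exists_lift hW htan fun f => (S.map.pullback (vertLin p f)).2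
  refine ⟨V, fun g => Fn.ext fun y => (hV (p.pullback g) y).trans (LinearMap.congr_fun (hvert y) g),
    fun f Z => Fn.ext fun y => ?_, fun y => LinearMap.ext fun g => hV g y⟩
  obtain ⟨-, Z', h12⟩ := S.cartan _ (C.toFun_mem_horizontal Z) y
  have h1 := fun f => (h12 f).1
  have h2 := fun f => (h12 f).2
  have e : V (τ.pullback f) = S.map.pullback (vertLin p f) := Fn.ext fun y => hV f y
  rw [FlatConnection.val_bracket, hcomp, hV, e]
  -- The Cartan condition supplies some Z', possibly different from Z. Its base component shows that
  -- both have the same value at p(τ y), which is all a vertical vector sees.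
  have hZ : ∀ g, (Z g).1 (p (τ y)) = (Z' g).1 (p (τ y)) := fun g => by
    have e1 := h1 (p.pullback g)
    rw [S.overBase y, C₀.val_lift] at e1
    rw [← e1]
    have e2 : S.map.pullback (vertPull p (p.pullback g)) = (p.comp τ).pullback g :=
      Fn.ext fun z => congrArg (fun b => g.1 (p b)) (S.overBase z)
    change _ = (C.toFun Z (S.map.pullback (vertPull p (p.pullback g)))).1 y
    rw [e2, C.val_lift]
    rfl
  rw [vertical_apply_toFun_congr hM C₀ (htan y) (hvert y) hZ f]
  exact sub_eq_zero.2 (h2 f).symm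

/-- Two vertical fields are congruent modulo D^g exactly when they have the same image under τ_* at
every point; this gives well-definedness and injectivity at once. Surjectivity is the lifting of
shadows. -/
theorem exists_shadow_equiv (hM : M.HasFrames) (hτ : τ.IsBundle) (hW : W.IsProManifold)
    (hcomp : ∀ Z f, C.toFun Z (τ.pullback f) = τ.pullback (C₀.toFun Z f))
    (hU : C.IsStructuralElement U) :
    ∃ Φ : shadowH0 τ p U ≃ Shadow C₀ τ C,
      ∀ (V : W.Field) (hV : ofField V ∈ vertical (p.comp τ) 0)
        (h : Submodule.Quotient.mk ⟨ofField V, hV⟩ ∈ shadowH0 τ p U) (y : W),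
        VertVec.vec ((Φ ⟨_, h⟩).map y) = τ.push (value V y) := by
  have hmk : ∀ (V V' : W.Field) (hV : ofField V ∈ vertical (p.comp τ) 0)
      (hV' : ofField V' ∈ vertical (p.comp τ) 0),
      (Submodule.Quotient.mk ⟨ofField V, hV⟩ : ShadowForms τ p 0) =
        Submodule.Quotient.mk ⟨ofField V', hV'⟩ ↔ ∀ y, τ.push (value V y) = τ.push (value V' y) := by
    intro V V' hV hV'
    rw [Submodule.Quotient.eq]
    have h1 : ofField V - ofField V' = ofField (V - V') := (map_sub _ _ _).symm
    have h2 : ((⟨ofField V, hV⟩ - ⟨ofField V', hV'⟩ : vertical (p.comp τ) 0) ∈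
        (vertical τ 0).submoduleOf (vertical (p.comp τ) 0)) ↔ ofField V - ofField V' ∈ vertical τ 0 :=
      Iff.rfl
    rw [h2, h1, ofField_mem_vertical]
    refine ⟨fun h y => LinearMap.ext fun g => ?_, fun h g => Fn.ext fun y => ?_⟩
    · exact sub_eq_zero.1 (congrArg (fun f : W.Fn => f.1 y) (h g))
    · exact sub_eq_zero.2 (LinearMap.congr_fun (h y) g)
  have hrep : ∀ c : shadowH0 τ p U, ∃ (V : W.Field) (hV : ofField V ∈ vertical (p.comp τ) 0),
      (∀ f Z, ⁅V, C.toFun Z⁆ (τ.pullback f) = 0) ∧ Submodule.Quotient.mk ⟨ofField V, hV⟩ = c.1 := by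
    rintro ⟨_, ⟨⟨Ω, hΩ⟩, hd, rfl⟩⟩
    obtain ⟨V, rfl⟩ := ofField.surjective Ω
    exact ⟨V, hΩ, fun f => (hU.delta_ofField_eq_zero_iff hM (ofField_mem_vertical.1 hΩ) _).1
      (LinearMap.congr_fun hd f), rfl⟩
  choose V hV hb hc using hrep
  let Φ : shadowH0 τ p U → Shadow C₀ τ C := fun c =>
    shadowOf hcomp (ofField_mem_vertical.1 (hV c)) (hb c)
  have hΦ : ∀ (T : W.Field) (hT : ofField T ∈ vertical (p.comp τ) 0)
      (h : Submodule.Quotient.mk ⟨ofField T, hT⟩ ∈ shadowH0 τ p U) (y : W),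
      VertVec.vec ((Φ ⟨_, h⟩).map y) = τ.push (value T y) := fun T hT h y =>
    (hmk _ _ (hV ⟨_, h⟩) hT).1 (hc ⟨_, h⟩) y
  refine ⟨Equiv.ofBijective Φ ⟨fun c c' h => Subtype.ext ?_, fun S => ?_⟩, hΦ⟩
  · rw [← hc c, ← hc c', hmk]
    exact fun y => congrArg (fun S : Shadow C₀ τ C => VertVec.vec (S.map y)) h
  · obtain ⟨T, hT, hTb, hTS⟩ := S.exists_lift hM hτ hW hcomp
    have h : Submodule.Quotient.mk ⟨ofField T, ofField_mem_vertical.2 hT⟩ ∈ shadowH0 τ p U :=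
      ⟨⟨ofField T, ofField_mem_vertical.2 hT⟩, LinearMap.ext fun f =>
        (hU.delta_ofField_eq_zero_iff hM hT _).2 (hTb f), rfl⟩
    exact ⟨⟨_, h⟩, Shadow.eq_of_vec fun y => (hΦ T _ h y).trans (hTS y)⟩

end Shadows

end

/-! ### The main theorem -/

theorem mainTheorem2 {n : ℕ} {M : Type u} [TopologicalSpace M]
    [ChartedSpace (EuclideanSpace ℝ (Fin n)) M] [IsManifold (𝓡 n) ∞ M] [T2Space M]
    [SecondCountableTopology M]
    {F : Type w} [NormedAddCommGroup F] [NormedSpace ℝ F] [FiniteDimensional ℝ F]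
    {E : M → Type v} [∀ x, AddCommGroup (E x)] [∀ x, Module ℝ (E x)] [∀ x, TopologicalSpace (E x)]
    [TopologicalSpace (Bundle.TotalSpace F E)] [FiberBundle F E] [VectorBundle ℝ F E]
    [ContMDiffVectorBundle ∞ F E (𝓡 n)]
    {k : ℕ} (𝓔 : Set (jetSpace n F E k)) (h𝓔 : FormallyIntegrable 𝓔)
    (W : DSpace.{t}) (hW : W.IsProManifold)
    (τ : SMap W (infProlongation 𝓔)) (hτ : τ.IsBundle)
    (C : FlatConnection ((infProj 𝓔).comp τ)) (hC : IsCovering τ C) :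
    (∃! C₀ : FlatConnection (infProj 𝓔), IsCartan C₀) ∧
    (∃! U : W.VForm 1, C.IsStructuralElement U) ∧
    ∀ (C₀ : FlatConnection (infProj 𝓔)) (U : W.VForm 1), IsCartan C₀ → C.IsStructuralElement U →
      (∀ V : W.Field, DSpace.ofField V ∈ gaugeCocycles τ U 0 ↔
        IsNonlocalSymmetry C V ∧ V ∈ verticalFields τ) ∧
      (∃ Φ : shadowH0 τ (infProj 𝓔) U ≃ Shadow C₀ τ C,
        ∀ (V : W.Field) (hV : DSpace.ofField V ∈ vertical ((infProj 𝓔).comp τ) 0)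
          (h : Submodule.Quotient.mk ⟨DSpace.ofField V, hV⟩ ∈ shadowH0 τ (infProj 𝓔) U) (y : W),
          VertVec.vec ((Φ ⟨_, h⟩).map y) = τ.push (DSpace.value V y)) ∧
      Equivalence (InfDeformation.Equiv τ (U := U)) ∧
      ∃ (h : ∀ D : InfDeformation τ U, D.Ω ∈ gaugeCocycles τ U 1)
        (Ψ : Quot (InfDeformation.Equiv τ (U := U)) ≃ GaugeCohomology τ U 0),
        ∀ D : InfDeformation τ U, Ψ (Quot.mk _ D) = Submodule.Quotient.mk ⟨D.Ω, h D⟩ := by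
  have hM : (DSpace.ofManifold n M).HasFrames := hasFrames_ofManifold
  refine ⟨hC.existsUnique_isCartan hτ.1, C.existsUnique_isStructuralElement hM,
    fun C₀ U hC₀ hU => ⟨mem_gaugeCocycles_zero_iff hU hM,
      exists_shadow_equiv hM hτ hW (hC₀.pullback_toFun hC) hU,
      InfDeformation.equivalence_equiv, InfDeformation.exists_quot_equiv (hU.fnBracket_self hM)⟩⟩
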